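/- Consider a sealed-bid first-price auction of one item with $n\ge 1$ buyers. Buyer $i$ has a private value that takes finitely many values $0\le v_i^1<\dots<v_i^{d_i}$ with positive probabilities $p_i^1,\dots,p_i^{d_i}$ that sum to $1$; the values of different buyers are independent and the distributions are commonly known. A strategy of buyer $i$ assigns to each value $v_i^k$ a probability distribution $\sigma_i^k$ of the bid, supported in $[0,v_i^k]$ (bids are nonnegative and nobody overbids); buyers randomize independently. A unique highest bidder wins and pays the own bid. If several buyers make the highest bid, a Vickrey auction is run among them: the one with the largest value wins and pays the largest value of the other highest bidders (among several with the largest value the winner is drawn uniformly). Utilities are quasi-linear. A strategy profile is a Bayesian Nash equilibrium if, for each buyer $i$ and each value $v_i^k$, no bid in $[0,v_i^k]$ gives a larger expected utility against the strategies of the others than the distribution $\sigma_i^k$ does. The set of winning bids of a profile is the closed set of all $b$ such that, for every neighbourhood $U$ of $b$, with positive probability some buyer wins with a bid in $U$. The bid distribution function of buyer $i$ is $F_i(x)=\sum_k p_i^k\,\sigma_i^k((-\infty,x])$. Then a Bayesian Nash equilibrium exists, and it is unique above the smallest winning bid in the following sense. There is a number $\underline b$, determined by the auction alone, that is the smallest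 winning bid of every Bayesian Nash equilibrium; and for any two Bayesian Nash equilibria $\sigma,\tau$ with bid distribution functions $F_i^\sigma,F_i^\tau$, one has $F_i^\sigma(x)=F_i^\tau(x)$ for every buyer $i$ and all $x\ge\underline b$, and $\sigma_i^k$ and $\tau_i^k$ agree on all Borel subsets of $(\underline b,\infty)$ for every buyer $i$ and every $k$. No further assumption on the value distributions is made. -/

import Mathlib

open MeasureTheory Topology

noncomputable section

/-- A first-price auction with `n` buyers and independent private values. Buyer `i` has value
`value i k` with probability `prob i k`, where `k` runs over `d i` indices. -/
structure FirstPriceAuction (n : ℕ) where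
  d : Fin n → ℕ
  value : (i : Fin n) → Fin (d i) → ℝ
  prob : (i : Fin n) → Fin (d i) → ℝ
  value_nonneg : ∀ i k, 0 ≤ value i k
  value_strictMono : ∀ i, StrictMono (value i)
  prob_pos : ∀ i k, 0 < prob i k
  prob_sum : ∀ i, ∑ k, prob i k = 1

namespace FirstPriceAuction

variable {n : ℕ}

/-! ### The outcome of one run

A realization `z : Fin n → ℝ × ℝ` lists for every buyer `j` the value `(z j).1` and the bid
`(z j).2`. -/

/-- The buyers whose bid is highest. -/
def topBidders (z : Fin n → ℝ × ℝ) : Finset (Fin n) :=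
  Finset.univ.filter fun j => ∀ k, (z k).2 ≤ (z j).2

/-- The candidates for the item: the highest bidders that have the largest value among the highest
bidders. (If there is only one highest bidder, this is that bidder.) -/
def winners (z : Fin n → ℝ × ℝ) : Finset (Fin n) :=
  (topBidders z).filter fun j => ∀ k ∈ topBidders z, (z k).1 ≤ (z j).1

/-- The probability that buyer `i` gets the item. Only a tie both in the highest bid and in the
largest value among the highest bidders is resolved at random, uniformly. -/
def winProb (i : Fin n) (z : Fin n → ℝ × ℝ) : ℝ :=
  if i ∈ winners z then 1 / ((winners z).card : ℝ) else 0

/-- What buyer `i` pays on getting the item: the own bid if no other buyer made the highest bid,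
otherwise the price of the Vickrey (second-price) auction among the highest bidders, i.e. the
largest value of the other highest bidders. -/
def price (i : Fin n) (z : Fin n → ℝ × ℝ) : ℝ :=
  if h : ((topBidders z).erase i).Nonempty then
    ((topBidders z).erase i).sup' h fun j => (z j).1
  else (z i).2

/-- Quasi-linear utility of buyer `i`. -/
def payoff (i : Fin n) (z : Fin n → ℝ × ℝ) : ℝ :=
  winProb i z * ((z i).1 - price i z)

/-! ### Strategies and equilibrium -/

/-- A profile of (randomized) strategies: `law i k` is the distribution of the bid of buyer `i`
with value `A.value i k`. Bids are nonnegative and nobody overbids. -/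
structure Profile (A : FirstPriceAuction n) where
  law : (i : Fin n) → Fin (A.d i) → Measure ℝ
  isProb : ∀ i k, IsProbabilityMeasure (law i k)
  bid_mem : ∀ i k, ∀ᵐ b ∂(law i k), 0 ≤ b ∧ b ≤ A.value i k

variable {A : FirstPriceAuction n}

/-- The joint law of the value and the bid of buyer `i`. -/
def Profile.buyerLaw (σ : A.Profile) (i : Fin n) : Measure (ℝ × ℝ) :=
  ∑ k, ENNReal.ofReal (A.prob i k) • (σ.law i k).map fun b => (A.value i k, b)

/-- The joint law of all values and bids; the buyers are independent. -/
def Profile.jointLaw (σ : A.Profile) : Measure (Fin n → ℝ × ℝ) :=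
  Measure.pi σ.buyerLaw

/-- The expected utility of buyer `i` with value `A.value i k` who bids `b` while the other buyers
follow `σ`: the own value and bid drawn from `σ` are overwritten. -/
def Profile.interimPayoff (σ : A.Profile) (i : Fin n) (k : Fin (A.d i)) (b : ℝ) : ℝ :=
  ∫ z, payoff i (Function.update z i (A.value i k, b)) ∂σ.jointLaw

/-- Bayesian Nash equilibrium: no buyer, whatever the value, gains by moving to another bid that is
allowed (nonnegative and not above the value). -/
def Profile.IsBNE (σ : A.Profile) : Prop :=
  ∀ i k, ∀ b, 0 ≤ b → b ≤ A.value i k →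
    σ.interimPayoff i k b ≤ ∫ b', σ.interimPayoff i k b' ∂(σ.law i k)

/-- The (closed) set of winning bids: bids such that, with positive probability, a buyer wins with
a bid arbitrarily close to it. -/
def Profile.winningBids (σ : A.Profile) : Set ℝ :=
  {b | ∀ U ∈ 𝓝 b, 0 < σ.jointLaw {z | ∃ i, i ∈ winners z ∧ (z i).2 ∈ U}}

/-- The cumulative distribution function of the bid of buyer `i`. -/
def Profile.bidCDF (σ : A.Profile) (i : Fin n) (x : ℝ) : ℝ :=
  ∑ k, A.prob i k * (σ.law i k).real (Set.Iic x)

end FirstPriceAuction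

end

/-!
The proof translates equilibria into families of functions of the bid, called flows, and shows that
there is exactly one flow above the smallest winning bid.

If no other bidder ties, a bid `x` of buyer `i` with value `v` earns the surplus
`(v - x) * others F i x`, where `others F i` is the product of the bid distribution functions of
the other buyers, the competition that buyer `i` faces. The Vickrey tie-breaking rule makes ties costly for buyers
whose values exceed the common bid, and harmless against a buyer whose value is the common bid.
Hence an equilibrium has no atoms above its smallest winning bid, and at most one buyer has an atom
at this bid that comes from larger values (`law_singleton_eq_zero`, `exists_exceptional`). Among
the buyers let `j` be one whose smallest value is largest. The smallest winning bid is the largest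
maximizer of the surplus of `j` with the smallest value when all other buyers bid their values
(`isReserve_bottom`), and this number does not depend on the equilibrium.

Above the smallest winning bid, the surplus of a buyer has no dips (`surplus_no_dip`), even for
values that the buyer does not bid with at that point. Consequently the bid distribution functions
have a local description (`Profile.IsBNE.isFlow`): lowering a bid does not pay for a value that has
not yet made all its bids, and raising a bid does not pay for a value that has started to bid. This
is the notion `IsFlow`. A flow also determines the strategies, because larger values bid more
(`law_restrict_eq`).

Uniqueness compares two flows from above, where both are constantly `1`. To the left of a bid `z`,
each bid distribution function grows by the factor `max 1 (g * β)`, where `g` is the growth factor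
of the product of all of them and `β < 1` is the factor by which the bid increase shrinks the
profit margin of the value at the current quantile. The equation `g = ∏ i, max 1 (g * β i)` makes
`g` antitone in the `β i` (`growth_le_growth`). So the flow that reaches `1` at a lower bid stays
above the other one, and its competition grows more slowly (`IsFlow.compare`). At the lower end all
buyers but one bid like their values, which leaves no room for a difference (`IsFlow.unique`).

For existence, the logarithms of the bid distribution functions should solve a system of
differential equations backwards from an upper end `B` at which all of them vanish: every active
buyer has to be indifferent, which fixes the growth rate of the competition, and the growth rates
of the buyers follow from the identity `sum_max_totalRate_sub`. The right-hand side is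
discontinuous in the quantile and singular where the surplus vanishes. It is therefore regularized
with a parameter `M`, and `B` is chosen by the intermediate value theorem such that the total
growth rate just reaches the bound `M` (`exists_isSolution`). The solutions satisfy the
inequalities of a flow up to errors that vanish for `M → ∞`, and converge along an ultrafilter
(`exists_isLimitFlow`). In the limit the growth rates can only blow up at the lower end, which
yields positivity, continuity and the exceptional buyer there (`IsReserve.exists_isFlow`). Finally,
the strategies read off from a flow, with truthful bids for values that cannot win, form an
equilibrium (`Profile.Follows.isBNE`).
-/

noncomputable section

namespace FirstPriceAuction

variable {n : ℕ} {A : FirstPriceAuction n}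

/-! ### The payoff in one run -/

lemma mem_topBidders {z : Fin n → ℝ × ℝ} {j : Fin n} :
    j ∈ topBidders z ↔ ∀ k, (z k).2 ≤ (z j).2 := by
  simp [topBidders]

lemma mem_winners {z : Fin n → ℝ × ℝ} {j : Fin n} :
    j ∈ winners z ↔ (∀ k, (z k).2 ≤ (z j).2) ∧
      ∀ k, (∀ l, (z l).2 ≤ (z k).2) → (z k).1 ≤ (z j).1 := by
  simp [winners, mem_topBidders]

lemma winProb_nonneg (i : Fin n) (z : Fin n → ℝ × ℝ) : 0 ≤ winProb i z := by
  unfold winProb; split_ifs <;> positivity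

lemma winProb_le_one (i : Fin n) (z : Fin n → ℝ × ℝ) : winProb i z ≤ 1 := by
  unfold winProb
  split_ifs with h
  · have : 1 ≤ (winners z).card := Finset.card_pos.mpr ⟨i, h⟩
    rw [div_le_one (by positivity)]
    exact_mod_cast this
  · exact zero_le_one

lemma payoff_eq_zero {i : Fin n} {z : Fin n → ℝ × ℝ} (h : i ∉ winners z) : payoff i z = 0 := by
  simp [payoff, winProb, h]

lemma price_le_of_mem_winners {i : Fin n} {z : Fin n → ℝ × ℝ} (hz : (z i).2 ≤ (z i).1)
    (h : i ∈ winners z) : price i z ≤ (z i).1 := by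
  unfold price
  split_ifs with hne
  · refine Finset.sup'_le _ _ fun k hk => (mem_winners.1 h).2 k ?_
    exact mem_topBidders.1 (Finset.mem_of_mem_erase hk)
  · exact hz

lemma payoff_nonneg {i : Fin n} {z : Fin n → ℝ × ℝ} (hz : (z i).2 ≤ (z i).1) :
    0 ≤ payoff i z := by
  by_cases h : i ∈ winners z
  · exact mul_nonneg (winProb_nonneg i z) (sub_nonneg.2 (price_le_of_mem_winners hz h))
  · rw [payoff_eq_zero h]

/-- When nobody overbids, the price is at least the highest bid. -/
lemma le_price {i : Fin n} {z : Fin n → ℝ × ℝ} (hz : ∀ j ≠ i, (z j).2 ≤ (z j).1) :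
    (z i).2 ≤ price i z := by
  unfold price
  split_ifs with hne
  · obtain ⟨k, hk⟩ := hne
    have h1 := mem_topBidders.1 (Finset.mem_of_mem_erase hk) i
    exact (h1.trans (hz k (Finset.ne_of_mem_erase hk))).trans
      (Finset.le_sup' (fun j => (z j).1) hk)
  · exact le_rfl

lemma payoff_le {i : Fin n} {z : Fin n → ℝ × ℝ} (hz : ∀ j, (z j).2 ≤ (z j).1) :
    payoff i z ≤ if ∀ j ≠ i, (z j).2 ≤ (z i).2 then (z i).1 - (z i).2 else 0 := by
  split_ifs with h
  · have h1 : (z i).1 - price i z ≤ (z i).1 - (z i).2 := by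
      linarith [le_price (i := i) fun j _ => hz j]
    calc payoff i z ≤ winProb i z * ((z i).1 - (z i).2) :=
          mul_le_mul_of_nonneg_left h1 (winProb_nonneg i z)
      _ ≤ 1 * ((z i).1 - (z i).2) :=
          mul_le_mul_of_nonneg_right (winProb_le_one i z) (by linarith [hz i])
      _ = _ := one_mul _
  · rw [payoff_eq_zero]
    intro hw
    exact h fun j _ => (mem_winners.1 hw).1 j

/-- Ties with buyers whose value is the tying bid are harmless: the item is won at the own bid. -/
lemma payoff_eq_of_forall {i : Fin n} {z : Fin n → ℝ × ℝ} (hv : (z i).2 < (z i).1)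
    (h : ∀ j ≠ i, (z j).2 < (z i).2 ∨ ((z j).2 = (z i).2 ∧ (z j).1 = (z i).2)) :
    payoff i z = (z i).1 - (z i).2 := by
  have hle : ∀ k, (z k).2 ≤ (z i).2 := by
    intro k
    by_cases hk : k = i
    · rw [hk]
    · rcases h k hk with h | h
      · exact h.le
      · exact h.1.le
  have hw : winners z = {i} := by
    ext j
    rw [mem_winners, Finset.mem_singleton]
    constructor
    · rintro ⟨h1, h2⟩
      by_contra hj
      have h3 := h2 i hle
      rcases h j hj with h | h
      · exact absurd (h1 i) (not_le.2 h)
      · rw [h.2] at h3; exact absurd h3 (not_le.2 hv)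
    · rintro rfl
      refine ⟨hle, fun k hk => ?_⟩
      by_cases hkj : k = j
      · rw [hkj]
      rcases h k hkj with h | h
      · exact absurd (hk j) (not_le.2 h)
      · rw [h.2]; exact hv.le
  have hp : price i z = (z i).2 := by
    unfold price
    split_ifs with hne
    · rw [Finset.sup'_eq_of_forall]
      intro k hk
      have h1 := mem_topBidders.1 (Finset.mem_of_mem_erase hk) i
      rcases h k (Finset.ne_of_mem_erase hk) with h | h
      · exact absurd h1 (not_le.2 h)
      · exact h.2
    · rfl
  simp [payoff, winProb, hw, hp]

/-- In a tie with buyer `j`, buyer `i` gets at most the excess of the own value over the value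
of `j`. -/
lemma payoff_le_of_tie {i j : Fin n} {z : Fin n → ℝ × ℝ} (hz : (z i).2 ≤ (z i).1)
    (hj : j ≠ i) (htie : (z j).2 = (z i).2) :
    payoff i z ≤ max 0 ((z i).1 - (z j).1) := by
  by_cases h : i ∈ winners z
  · have hjt : j ∈ (topBidders z).erase i := by
      rw [Finset.mem_erase, mem_topBidders, htie]
      exact ⟨hj, (mem_winners.1 h).1⟩
    have h1 : (z j).1 ≤ price i z := by
      unfold price
      rw [dif_pos ⟨j, hjt⟩]
      exact Finset.le_sup' (fun j => (z j).1) hjt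
    have h2 := price_le_of_mem_winners hz h
    refine le_max_of_le_right ?_
    calc payoff i z ≤ 1 * ((z i).1 - price i z) :=
          mul_le_mul_of_nonneg_right (winProb_le_one i z) (by linarith)
      _ ≤ _ := by linarith
  · rw [payoff_eq_zero h]; exact le_max_left _ _

lemma measurableSet_mem_topBidders (j : Fin n) :
    MeasurableSet {z : Fin n → ℝ × ℝ | j ∈ topBidders z} := by
  simp only [mem_topBidders, Set.ofPred_forall]
  exact MeasurableSet.iInter fun k => measurableSet_le (by fun_prop) (by fun_prop)

lemma measurableSet_topBidders_eq (T : Finset (Fin n)) :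
    MeasurableSet {z : Fin n → ℝ × ℝ | topBidders z = T} := by
  have : {z : Fin n → ℝ × ℝ | topBidders z = T} =
      ⋂ j, {z : Fin n → ℝ × ℝ | j ∈ topBidders z ↔ j ∈ T} := by
    ext z; simp [Finset.ext_iff]
  rw [this]
  refine MeasurableSet.iInter fun j => ?_
  by_cases hj : j ∈ T
  · simpa [hj] using measurableSet_mem_topBidders j
  · convert (measurableSet_mem_topBidders j).compl using 1
    ext z; simp [hj]

lemma measurableSet_mem_winners (j : Fin n) :
    MeasurableSet {z : Fin n → ℝ × ℝ | j ∈ winners z} := by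
  have : {z : Fin n → ℝ × ℝ | j ∈ winners z} = {z | j ∈ topBidders z} ∩
      ⋂ k, ({z : Fin n → ℝ × ℝ | k ∈ topBidders z}ᶜ ∪ {z | (z k).1 ≤ (z j).1}) := by
    ext z
    simp only [winners, Finset.mem_filter, Set.mem_ofPred_eq, Set.mem_inter_iff, Set.mem_iInter,
      Set.mem_union, Set.mem_compl_iff, imp_iff_not_or]
  rw [this]
  refine (measurableSet_mem_topBidders j).inter (MeasurableSet.iInter fun k => ?_)
  exact (measurableSet_mem_topBidders k).compl.union
    (measurableSet_le (by fun_prop) (by fun_prop))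

lemma measurable_price (i : Fin n) : Measurable (price i) := by
  have : price i = fun z => ∑ T : Finset (Fin n), if topBidders z = T then
      (if h : (T.erase i).Nonempty then (T.erase i).sup' h fun j => (z j).1 else (z i).2)
      else 0 := by
    funext z; simp [price]
  rw [this]
  refine Finset.measurable_fun_sum _ fun T _ => ?_
  refine Measurable.ite (measurableSet_topBidders_eq T) ?_ measurable_const
  split_ifs with h
  · have := Finset.measurable_sup' h (f := fun j (z : Fin n → ℝ × ℝ) => (z j).1)
      (fun j _ => by fun_prop)
    convert this using 1
    funext z
    simp
  · fun_prop

lemma measurable_winProb (i : Fin n) : Measurable (winProb i) := by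
  have hcard : Measurable fun z : Fin n → ℝ × ℝ => ((winners z).card : ℝ) := by
    have : (fun z : Fin n → ℝ × ℝ => ((winners z).card : ℝ)) =
        fun z => ∑ j : Fin n, if j ∈ winners z then (1 : ℝ) else 0 := by
      funext z; simp
    rw [this]
    exact Finset.measurable_fun_sum _ fun j _ =>
      Measurable.ite (measurableSet_mem_winners j) measurable_const measurable_const
  exact Measurable.ite (measurableSet_mem_winners i) (measurable_const.div hcard) measurable_const

lemma measurable_payoff (i : Fin n) : Measurable (payoff i) :=
  (measurable_winProb i).mul (Measurable.sub (by fun_prop) (measurable_price i))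

/-! ### Expected payoffs -/

/-- The product of the functions of all buyers but `i`; for bid distribution functions, the
probability that no other buyer bids more than `x`. -/
def others (F : Fin n → ℝ → ℝ) (i : Fin n) (x : ℝ) : ℝ := ∏ j ∈ Finset.univ.erase i, F j x

namespace Profile

variable (σ : A.Profile)

instance (i : Fin n) (k : Fin (A.d i)) : IsProbabilityMeasure (σ.law i k) := σ.isProb i k

lemma buyerLaw_apply (i : Fin n) {S : Set (ℝ × ℝ)} (hS : MeasurableSet S) :
    σ.buyerLaw i S =
      ∑ k, ENNReal.ofReal (A.prob i k) * σ.law i k {b | (A.value i k, b) ∈ S} := by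
  simp only [buyerLaw, Measure.coe_finsetSum, Finset.sum_apply, Measure.smul_apply, smul_eq_mul]
  refine Finset.sum_congr rfl fun k _ => ?_
  rw [Measure.map_apply (by fun_prop) hS]
  rfl

instance (i : Fin n) : IsProbabilityMeasure (σ.buyerLaw i) := by
  constructor
  rw [σ.buyerLaw_apply i MeasurableSet.univ]
  simp only [Set.mem_univ, Set.ofPred_true, measure_univ, mul_one]
  rw [← ENNReal.ofReal_sum_of_nonneg fun k _ => (A.prob_pos i k).le, A.prob_sum i,
    ENNReal.ofReal_one]

instance : IsProbabilityMeasure σ.jointLaw := by unfold jointLaw; infer_instance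

lemma buyerLaw_real (i : Fin n) {S : Set (ℝ × ℝ)} (hS : MeasurableSet S) :
    (σ.buyerLaw i).real S = ∑ k, A.prob i k * (σ.law i k).real {b | (A.value i k, b) ∈ S} := by
  rw [measureReal_def, σ.buyerLaw_apply i hS, ENNReal.toReal_sum]
  · refine Finset.sum_congr rfl fun k _ => ?_
    rw [ENNReal.toReal_mul, ENNReal.toReal_ofReal (A.prob_pos i k).le]
    rfl
  · intro k _
    exact ENNReal.mul_ne_top ENNReal.ofReal_ne_top (measure_ne_top _ _)

lemma buyerLaw_real_le (i : Fin n) (x : ℝ) :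
    (σ.buyerLaw i).real {p | p.2 ≤ x} = σ.bidCDF i x := by
  rw [σ.buyerLaw_real i (measurableSet_le (by fun_prop) (by fun_prop))]
  rfl

lemma ae_buyerLaw {i : Fin n} {p : ℝ × ℝ → Prop} (hp : MeasurableSet {z | p z})
    (h : ∀ k, ∀ᵐ b ∂(σ.law i k), p (A.value i k, b)) : ∀ᵐ z ∂(σ.buyerLaw i), p z := by
  rw [ae_iff]
  have : {a | ¬ p a} = {a | p a}ᶜ := rfl
  rw [this, σ.buyerLaw_apply i hp.compl]
  refine Finset.sum_eq_zero fun k _ => ?_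
  have := h k
  rw [ae_iff] at this
  simp only [Set.mem_compl_iff, Set.mem_ofPred_eq]
  rw [this, mul_zero]

lemma ae_jointLaw {p : Fin n → ℝ × ℝ → Prop} (h : ∀ i, ∀ᵐ z ∂(σ.buyerLaw i), p i z) :
    ∀ᵐ z ∂σ.jointLaw, ∀ i, p i (z i) := by
  rw [ae_all_iff]
  intro i
  exact (measurePreserving_eval σ.buyerLaw i).quasiMeasurePreserving.ae (h i)

lemma ae_bid_le_value : ∀ᵐ z ∂σ.jointLaw, ∀ i, 0 ≤ (z i).2 ∧ (z i).2 ≤ (z i).1 := by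
  refine σ.ae_jointLaw fun i => σ.ae_buyerLaw (p := fun z => 0 ≤ z.2 ∧ z.2 ≤ z.1) ?_ ?_
  · exact (measurableSet_le measurable_const measurable_snd).inter
      (measurableSet_le measurable_snd measurable_fst)
  · exact σ.bid_mem i

lemma jointLaw_real_forall_ne (i : Fin n) (S : Fin n → Set (ℝ × ℝ)) :
    σ.jointLaw.real {z | ∀ j ≠ i, z j ∈ S j} =
      ∏ j ∈ Finset.univ.erase i, (σ.buyerLaw j).real (S j) := by
  have : {z : Fin n → ℝ × ℝ | ∀ j ≠ i, z j ∈ S j} =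
      Set.pi (Finset.univ.erase i : Finset (Fin n)) S := by
    ext z; simp [Set.mem_pi]
  rw [measureReal_def, this, jointLaw, Measure.pi_pi_finset, ENNReal.toReal_prod]
  rfl

lemma measurable_update_bid (i : Fin n) (v : ℝ) :
    Measurable fun p : ℝ × (Fin n → ℝ × ℝ) => Function.update p.2 i (v, p.1) := by
  rw [measurable_pi_iff]
  intro j
  by_cases h : j = i
  · subst h; simpa using (by fun_prop : Measurable fun p : ℝ × (Fin n → ℝ × ℝ) => (v, p.1))
  · simpa [Function.update_of_ne h] using
      (by fun_prop : Measurable fun p : ℝ × (Fin n → ℝ × ℝ) => p.2 j)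

lemma measurable_interimPayoff (i : Fin n) (k : Fin (A.d i)) :
    Measurable (σ.interimPayoff i k) := by
  have h : StronglyMeasurable fun p : ℝ × (Fin n → ℝ × ℝ) =>
      payoff i (Function.update p.2 i (A.value i k, p.1)) :=
    ((measurable_payoff i).comp (measurable_update_bid i _)).stronglyMeasurable
  exact h.integral_prod_right.measurable

variable {σ} {i : Fin n} {k : Fin (A.d i)} {b : ℝ}

lemma update_bid_le (hb : b ≤ A.value i k) {z : Fin n → ℝ × ℝ} (hz : ∀ j, (z j).2 ≤ (z j).1)
    (j : Fin n) : (Function.update z i (A.value i k, b) j).2 ≤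
      (Function.update z i (A.value i k, b) j).1 := by
  by_cases h : j = i
  · subst h; simpa using hb
  · simpa [Function.update_of_ne h] using hz j

lemma ae_payoff_mem (hb : b ≤ A.value i k) : ∀ᵐ z ∂σ.jointLaw,
    0 ≤ payoff i (Function.update z i (A.value i k, b)) ∧
    payoff i (Function.update z i (A.value i k, b)) ≤
      if ∀ j ≠ i, (z j).2 ≤ b then A.value i k - b else 0 := by
  filter_upwards [σ.ae_bid_le_value] with z hz
  have hz' := update_bid_le hb fun j => (hz j).2
  refine ⟨payoff_nonneg (hz' i), (payoff_le hz').trans_eq ?_⟩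
  simp only [Function.update_self]
  congr 1
  refine propext (forall_congr' fun j => imp_congr_right fun hj => ?_)
  rw [Function.update_of_ne hj]

lemma integrable_payoff (hb : b ≤ A.value i k) :
    Integrable (fun z => payoff i (Function.update z i (A.value i k, b))) σ.jointLaw := by
  refine Integrable.of_mem_Icc 0 (A.value i k - b) ?_ ?_
  · exact ((measurable_payoff i).comp
      ((measurable_update_bid i _).comp measurable_prodMk_left)).aemeasurable
  · filter_upwards [ae_payoff_mem (σ := σ) hb] with z hz
    refine ⟨hz.1, hz.2.trans ?_⟩
    split_ifs
    · exact le_rfl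
    · linarith

lemma interimPayoff_nonneg (hb : b ≤ A.value i k) : 0 ≤ σ.interimPayoff i k b :=
  integral_nonneg_of_ae ((ae_payoff_mem hb).mono fun _ h => h.1)

lemma measurableSet_forall_le (i : Fin n) (b : ℝ) :
    MeasurableSet {z : Fin n → ℝ × ℝ | ∀ j ≠ i, (z j).2 ≤ b} := by
  simp only [Set.ofPred_forall]
  exact MeasurableSet.iInter fun j => MeasurableSet.iInter fun _ =>
    measurableSet_le (by fun_prop) measurable_const

lemma jointLaw_real_forall_le (σ : A.Profile) (i : Fin n) (b : ℝ) :
    σ.jointLaw.real {z | ∀ j ≠ i, (z j).2 ≤ b} = others σ.bidCDF i b := by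
  have := σ.jointLaw_real_forall_ne i fun _ => {p | p.2 ≤ b}
  simp only [buyerLaw_real_le] at this
  exact this

lemma interimPayoff_le (hb : b ≤ A.value i k) :
    σ.interimPayoff i k b ≤ (A.value i k - b) * others σ.bidCDF i b := by
  rw [← σ.jointLaw_real_forall_le i b, mul_comm, ← smul_eq_mul,
    ← integral_indicator_const (μ := σ.jointLaw) _ (measurableSet_forall_le i b)]
  refine integral_mono_ae (integrable_payoff hb) ?_ ?_
  · exact (integrable_const _).indicator (measurableSet_forall_le i b)
  · filter_upwards [ae_payoff_mem (σ := σ) hb] with z hz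
    refine hz.2.trans_eq ?_
    simp [Set.indicator_apply]

/-- A bid below the own value earns the full surplus whenever every other buyer bids in a range
of values and bids that cannot win against it. -/
lemma interimPayoff_ge_of_sets (hb : b < A.value i k) {S : Fin n → Set (ℝ × ℝ)}
    (hS : ∀ j, MeasurableSet (S j))
    (h : ∀ j, ∀ p ∈ S j, p.2 < b ∨ (p.2 = b ∧ p.1 = b)) :
    (A.value i k - b) * ∏ j ∈ Finset.univ.erase i, (σ.buyerLaw j).real (S j) ≤
      σ.interimPayoff i k b := by
  have hm : MeasurableSet {z : Fin n → ℝ × ℝ | ∀ j ≠ i, z j ∈ S j} := by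
    simp only [Set.ofPred_forall]
    exact MeasurableSet.iInter fun j => MeasurableSet.iInter fun _ => measurable_pi_apply j (hS j)
  rw [← σ.jointLaw_real_forall_ne i S, mul_comm, ← smul_eq_mul,
    ← integral_indicator_const (μ := σ.jointLaw) _ hm]
  refine integral_mono_ae ((integrable_const _).indicator hm) (integrable_payoff hb.le) ?_
  filter_upwards [ae_payoff_mem (σ := σ) hb.le] with z hz
  by_cases hzS : z ∈ {z : Fin n → ℝ × ℝ | ∀ j ≠ i, z j ∈ S j}
  · rw [Set.indicator_of_mem hzS, payoff_eq_of_forall]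
    · simp
    · simpa using hb
    · intro j hj
      simpa [Function.update_of_ne hj] using h j (z j) (hzS j hj)
  · rw [Set.indicator_of_notMem hzS]; exact hz.1

lemma interimPayoff_ge {y : ℝ} (hyb : y < b) (hb : b ≤ A.value i k) :
    (A.value i k - b) * others σ.bidCDF i y ≤ σ.interimPayoff i k b := by
  rcases hb.eq_or_lt with hb | hb
  · rw [hb, sub_self, zero_mul]; exact interimPayoff_nonneg le_rfl
  have := interimPayoff_ge_of_sets (σ := σ) hb (S := fun _ => {p | p.2 ≤ y})
    (fun _ => measurableSet_le (by fun_prop) (by fun_prop))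
    (fun j p hp => Or.inl (lt_of_le_of_lt hp hyb))
  simp only [buyerLaw_real_le] at this
  exact this

/-- Tying with positive probability with a buyer whose value is above the common bid costs
something. -/
lemma interimPayoff_lt_of_tie (hb : b < A.value i k) {j : Fin n} (hj : j ≠ i)
    {k' : Fin (A.d j)} (hk' : b < A.value j k') (hatom : 0 < (σ.law j k').real {b})
    (hpos : ∀ l, 0 < σ.bidCDF l b) :
    σ.interimPayoff i k b < (A.value i k - b) * others σ.bidCDF i b := by
  classical
  set S : Fin n → Set (ℝ × ℝ) := fun l => if l = j then {(A.value j k', b)} else {p | p.2 ≤ b}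
    with hSdef
  have hS : ∀ l, MeasurableSet (S l) := by
    intro l
    simp only [hSdef]
    split_ifs
    · exact measurableSet_singleton _
    · exact measurableSet_le (by fun_prop) (by fun_prop)
  set D : Set (Fin n → ℝ × ℝ) := {z | ∀ l ≠ i, z l ∈ S l} with hD
  have hDm : MeasurableSet D := by
    simp only [hD, Set.ofPred_forall]
    exact MeasurableSet.iInter fun l => MeasurableSet.iInter fun _ => measurable_pi_apply l (hS l)
  have hDpos : 0 < σ.jointLaw.real D := by
    rw [hD, σ.jointLaw_real_forall_ne i S]
    refine Finset.prod_pos fun l _ => ?_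
    by_cases hl : l = j
    · subst hl
      simp only [hSdef, if_true]
      rw [σ.buyerLaw_real l (measurableSet_singleton _)]
      refine Finset.sum_pos' (fun q _ => mul_nonneg (A.prob_pos l q).le measureReal_nonneg)
        ⟨k', Finset.mem_univ _, mul_pos (A.prob_pos l k') ?_⟩
      simpa using hatom
    · simp only [hSdef, if_neg hl]
      rw [buyerLaw_real_le]
      exact hpos l
  set E : Set (Fin n → ℝ × ℝ) := {z | ∀ j ≠ i, (z j).2 ≤ b}
  set c := min (A.value i k - b) (A.value j k' - b)
  have hc : 0 < c := lt_min (by linarith) (by linarith)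
  have key : σ.interimPayoff i k b ≤
      ∫ z, (E.indicator (fun _ => A.value i k - b) z - D.indicator (fun _ => c) z)
        ∂σ.jointLaw := by
    refine integral_mono_ae (integrable_payoff hb.le) ?_ ?_
    · exact ((integrable_const _).indicator (measurableSet_forall_le i b)).sub
        ((integrable_const _).indicator hDm)
    filter_upwards [ae_payoff_mem (σ := σ) hb.le] with z hz
    have hDE : z ∈ D → z ∈ E := by
      intro h l hl
      have := h l hl
      by_cases hlj : l = j
      · simp only [hSdef, if_pos hlj, Set.mem_singleton_iff] at this
        rw [this]
      · simp only [hSdef, if_neg hlj] at this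
        exact this
    by_cases hzD : z ∈ D
    · rw [Set.indicator_of_mem hzD, Set.indicator_of_mem (hDE hzD)]
      have hzj : z j = (A.value j k', b) := by
        have := hzD j hj
        simpa only [hSdef, if_true, Set.mem_singleton_iff] using this
      have h1 := payoff_le_of_tie (i := i) (j := j)
        (z := Function.update z i (A.value i k, b)) (by simpa using hb.le) hj
        (by simp [Function.update_of_ne hj, hzj])
      rw [Function.update_self, Function.update_of_ne hj, hzj] at h1
      refine h1.trans (max_le ?_ ?_)
      · have := min_le_left (A.value i k - b) (A.value j k' - b); simp only [c]; linarith
      · have := min_le_right (A.value i k - b) (A.value j k' - b); simp only [c]; linarith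
    · rw [Set.indicator_of_notMem hzD, sub_zero]
      refine hz.2.trans_eq ?_
      simp [Set.indicator_apply, E]
  rw [integral_sub ((integrable_const _).indicator (measurableSet_forall_le i b))
    ((integrable_const _).indicator hDm), integral_indicator_const _ (measurableSet_forall_le i b),
    integral_indicator_const _ hDm, σ.jointLaw_real_forall_le i b, smul_eq_mul, smul_eq_mul] at key
  nlinarith [mul_pos hDpos hc]

end Profile

/-! ### Distribution functions of values and bids -/

/-- The distribution function of the value of buyer `i`. -/
def valueCDF (A : FirstPriceAuction n) (i : Fin n) (x : ℝ) : ℝ :=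
  ∑ k, if A.value i k ≤ x then A.prob i k else 0

/-- The probability of a value below `A.value i k`. -/
def cumLT (A : FirstPriceAuction n) (i : Fin n) (k : Fin (A.d i)) : ℝ :=
  ∑ l, if l < k then A.prob i l else 0

/-- The probability of a value at most `A.value i k`. -/
def cumLE (A : FirstPriceAuction n) (i : Fin n) (k : Fin (A.d i)) : ℝ :=
  ∑ l, if l ≤ k then A.prob i l else 0

lemma cumLE_eq (i : Fin n) (k : Fin (A.d i)) : A.cumLE i k = A.cumLT i k + A.prob i k := by
  unfold cumLE cumLT
  have : A.prob i k = ∑ l, if l = k then A.prob i l else 0 := by simp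
  rw [this, ← Finset.sum_add_distrib]
  refine Finset.sum_congr rfl fun l _ => ?_
  rcases lt_trichotomy l k with h | h | h
  · simp [h.le, h, h.ne]
  · simp [h]
  · simp [h.not_ge, h.not_gt, h.ne']

lemma cumLT_nonneg (i : Fin n) (k : Fin (A.d i)) : 0 ≤ A.cumLT i k :=
  Finset.sum_nonneg fun l _ => by split_ifs; exacts [(A.prob_pos i l).le, le_rfl]

lemma cumLT_lt_cumLE (i : Fin n) (k : Fin (A.d i)) : A.cumLT i k < A.cumLE i k := by
  rw [cumLE_eq]; linarith [A.prob_pos i k]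

lemma cumLE_le_one (i : Fin n) (k : Fin (A.d i)) : A.cumLE i k ≤ 1 := by
  rw [← A.prob_sum i]
  refine Finset.sum_le_sum fun l _ => ?_
  split_ifs
  · exact le_rfl
  · exact (A.prob_pos i l).le

lemma cumLE_le_cumLT {i : Fin n} {k l : Fin (A.d i)} (h : k < l) : A.cumLE i k ≤ A.cumLT i l := by
  refine Finset.sum_le_sum fun m _ => ?_
  split_ifs with h1 h2
  · exact le_rfl
  · exact absurd (lt_of_le_of_lt h1 h) h2
  · exact (A.prob_pos i m).le
  · exact le_rfl

lemma valueCDF_nonneg (i : Fin n) (x : ℝ) : 0 ≤ A.valueCDF i x :=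
  Finset.sum_nonneg fun l _ => by split_ifs; exacts [(A.prob_pos i l).le, le_rfl]

lemma valueCDF_mono (i : Fin n) : Monotone (A.valueCDF i) := by
  intro x y hxy
  refine Finset.sum_le_sum fun l _ => ?_
  split_ifs with h1 h2
  · exact le_rfl
  · exact absurd (h1.trans hxy) h2
  · exact (A.prob_pos i l).le
  · exact le_rfl

lemma cumLE_le_valueCDF {i : Fin n} {k : Fin (A.d i)} {x : ℝ} (h : A.value i k ≤ x) :
    A.cumLE i k ≤ A.valueCDF i x := by
  refine Finset.sum_le_sum fun l _ => ?_
  split_ifs with h1 h2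
  · exact le_rfl
  · exact absurd (((A.value_strictMono i).monotone h1).trans h) h2
  · exact (A.prob_pos i l).le
  · exact le_rfl

lemma valueCDF_le_cumLT {i : Fin n} {k : Fin (A.d i)} {x : ℝ} (h : x < A.value i k) :
    A.valueCDF i x ≤ A.cumLT i k := by
  refine Finset.sum_le_sum fun l _ => ?_
  split_ifs with h1 h2
  · exact le_rfl
  · exact absurd ((A.value_strictMono i).lt_iff_lt.1 (lt_of_le_of_lt h1 h)) h2
  · exact (A.prob_pos i l).le
  · exact le_rfl

lemma valueCDF_le_one (i : Fin n) (x : ℝ) : A.valueCDF i x ≤ 1 := by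
  rw [← A.prob_sum i]
  refine Finset.sum_le_sum fun l _ => ?_
  split_ifs
  · exact le_rfl
  · exact (A.prob_pos i l).le

lemma valueCDF_eq_one {i : Fin n} {x : ℝ} (h : ∀ k, A.value i k ≤ x) : A.valueCDF i x = 1 := by
  rw [← A.prob_sum i]
  exact Finset.sum_congr rfl fun k _ => if_pos (h k)

lemma valueCDF_pos_iff {i : Fin n} {x : ℝ} : 0 < A.valueCDF i x ↔ ∃ k, A.value i k ≤ x := by
  constructor
  · intro h
    by_contra! hx
    refine h.ne' (Finset.sum_eq_zero fun k _ => if_neg (not_le.2 (hx k)))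
  · rintro ⟨k, hk⟩
    exact ((cumLT_nonneg i k).trans_lt (cumLT_lt_cumLE i k)).trans_le (cumLE_le_valueCDF hk)

lemma d_pos (A : FirstPriceAuction n) (i : Fin n) : 0 < A.d i := by
  by_contra h
  have h0 : A.d i = 0 := by omega
  have h1 := A.prob_sum i
  have : IsEmpty (Fin (A.d i)) := by rw [h0]; infer_instance
  simp at h1

/-- The smallest value of buyer `i`. -/
def low (A : FirstPriceAuction n) (i : Fin n) : ℝ := A.value i ⟨0, A.d_pos i⟩

lemma low_le (i : Fin n) (k : Fin (A.d i)) : A.low i ≤ A.value i k :=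
  (A.value_strictMono i).monotone (Nat.zero_le _)

lemma low_nonneg (i : Fin n) : 0 ≤ A.low i := A.value_nonneg i _

lemma valueCDF_pos {i : Fin n} {x : ℝ} : 0 < A.valueCDF i x ↔ A.low i ≤ x :=
  valueCDF_pos_iff.trans ⟨fun ⟨k, hk⟩ => (low_le i k).trans hk, fun h => ⟨_, h⟩⟩

lemma valueCDF_eq_zero {i : Fin n} {x : ℝ} (h : x < A.low i) : A.valueCDF i x = 0 :=
  le_antisymm (not_lt.1 fun h' => absurd (valueCDF_pos.1 h') (not_le.2 h)) (valueCDF_nonneg i x)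

/-- Some bound above all values. -/
def top (A : FirstPriceAuction n) : ℝ := ∑ i, ∑ k, A.value i k

lemma value_le_top (i : Fin n) (k : Fin (A.d i)) : A.value i k ≤ A.top :=
  (Finset.single_le_sum (fun l _ => A.value_nonneg i l) (Finset.mem_univ k)).trans
    (Finset.single_le_sum (f := fun i => ∑ k, A.value i k)
      (fun j _ => Finset.sum_nonneg fun l _ => A.value_nonneg j l) (Finset.mem_univ i))

lemma others_nonneg {F : Fin n → ℝ → ℝ} {i : Fin n} {x : ℝ} (h : ∀ j, 0 ≤ F j x) :
    0 ≤ others F i x := Finset.prod_nonneg fun j _ => h j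

lemma others_pos {F : Fin n → ℝ → ℝ} {i : Fin n} {x : ℝ} (h : ∀ j ≠ i, 0 < F j x) :
    0 < others F i x := Finset.prod_pos fun j hj => h j (Finset.ne_of_mem_erase hj)

lemma others_le_others {F G : Fin n → ℝ → ℝ} {i : Fin n} {x y : ℝ} (h0 : ∀ j ≠ i, 0 ≤ F j x)
    (h : ∀ j ≠ i, F j x ≤ G j y) : others F i x ≤ others G i y :=
  Finset.prod_le_prod (fun j hj => h0 j (Finset.ne_of_mem_erase hj))
    fun j hj => h j (Finset.ne_of_mem_erase hj)

lemma others_congr {F G : Fin n → ℝ → ℝ} {i : Fin n} {x y : ℝ} (h : ∀ j ≠ i, F j x = G j y) :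
    others F i x = others G i y :=
  Finset.prod_congr rfl fun j hj => h j (Finset.ne_of_mem_erase hj)

lemma others_eq_zero {F : Fin n → ℝ → ℝ} {i j : Fin n} {x : ℝ} (hj : j ≠ i) (h : F j x = 0) :
    others F i x = 0 := Finset.prod_eq_zero (Finset.mem_erase.2 ⟨hj, Finset.mem_univ _⟩) h

lemma others_mul {F : Fin n → ℝ → ℝ} (i : Fin n) (x : ℝ) :
    F i x * others F i x = ∏ j, F j x := 
  Finset.mul_prod_erase _ (fun j => F j x) (Finset.mem_univ i)

lemma others_le_one {F : Fin n → ℝ → ℝ} {i : Fin n} {x : ℝ} (h0 : ∀ j, 0 ≤ F j x)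
    (h : ∀ j, F j x ≤ 1) : others F i x ≤ 1 :=
  Finset.prod_le_one (fun j _ => h0 j) fun j _ => h j

/-- Equal positive products of componentwise ordered factors have equal factors. -/
lemma eq_of_others_le {F G : Fin n → ℝ → ℝ} {i : Fin n} {x y : ℝ} (h0 : ∀ j ≠ i, 0 < F j x)
    (h : ∀ j ≠ i, F j x ≤ G j y) (he : others G i y ≤ others F i x) :
    ∀ j ≠ i, F j x = G j y := by
  by_contra! hne
  obtain ⟨j, hj, hne⟩ := hne
  refine absurd he (not_le.2 ?_)
  exact Finset.prod_lt_prod (fun k hk => h0 k (Finset.ne_of_mem_erase hk))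
    (fun k hk => h k (Finset.ne_of_mem_erase hk))
    ⟨j, Finset.mem_erase.2 ⟨hj, Finset.mem_univ _⟩, lt_of_le_of_ne (h j hj) hne⟩

namespace Profile

variable (σ : A.Profile)

lemma bidCDF_nonneg (i : Fin n) (x : ℝ) : 0 ≤ σ.bidCDF i x :=
  Finset.sum_nonneg fun k _ => mul_nonneg (A.prob_pos i k).le measureReal_nonneg

lemma bidCDF_le_one (i : Fin n) (x : ℝ) : σ.bidCDF i x ≤ 1 := by
  rw [← A.prob_sum i]
  exact Finset.sum_le_sum fun k _ => mul_le_of_le_one_right (A.prob_pos i k).le measureReal_le_one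

lemma bidCDF_mono (i : Fin n) : Monotone (σ.bidCDF i) := fun _ _ h =>
  Finset.sum_le_sum fun k _ => mul_le_mul_of_nonneg_left
    (measureReal_mono (Set.Iic_subset_Iic.2 h)) (A.prob_pos i k).le

lemma law_Iic_eq_one {i : Fin n} {k : Fin (A.d i)} {x : ℝ} (h : A.value i k ≤ x) :
    (σ.law i k).real (Set.Iic x) = 1 := by
  have : ∀ᵐ b ∂(σ.law i k), b ∈ Set.Iic x := (σ.bid_mem i k).mono fun b hb => hb.2.trans h
  have h1 : σ.law i k (Set.Iic x) = 1 := by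
    rw [← measure_univ (μ := σ.law i k)]
    exact measure_congr (Filter.eventuallyEq_univ.2 this)
  rw [measureReal_def, h1, ENNReal.toReal_one]

lemma valueCDF_le_bidCDF (i : Fin n) (x : ℝ) : A.valueCDF i x ≤ σ.bidCDF i x := by
  refine Finset.sum_le_sum fun k _ => ?_
  split_ifs with h
  · rw [σ.law_Iic_eq_one h, mul_one]
  · exact mul_nonneg (A.prob_pos i k).le measureReal_nonneg

lemma bidCDF_eq_one {i : Fin n} {x : ℝ} (h : ∀ k, A.value i k ≤ x) : σ.bidCDF i x = 1 :=
  le_antisymm (σ.bidCDF_le_one i x) ((valueCDF_eq_one h).symm.le.trans (σ.valueCDF_le_bidCDF i x))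

lemma bidCDF_eq_zero_iff {i : Fin n} {x : ℝ} :
    σ.bidCDF i x = 0 ↔ ∀ k, (σ.law i k).real (Set.Iic x) = 0 := by
  unfold bidCDF
  rw [Finset.sum_eq_zero_iff_of_nonneg
    fun k _ => mul_nonneg (A.prob_pos i k).le measureReal_nonneg]
  simp [(A.prob_pos i _).ne']

lemma bidCDF_neg {i : Fin n} {x : ℝ} (hx : x < 0) : σ.bidCDF i x = 0 := by
  rw [bidCDF_eq_zero_iff]
  intro k
  rw [measureReal_eq_zero_iff]
  refine measure_mono_null ?_ (ae_iff.1 (σ.bid_mem i k))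
  intro b hb h
  exact absurd (h.1.trans hb) (not_le.2 hx)

lemma continuousWithinAt_law (i : Fin n) (k : Fin (A.d i)) (x : ℝ) :
    ContinuousWithinAt (fun y => (σ.law i k).real (Set.Iic y)) (Set.Ici x) x := by
  simp only [← ProbabilityTheory.cdf_eq_real]
  exact (ProbabilityTheory.cdf (σ.law i k)).right_continuous x

lemma continuousWithinAt_bidCDF (i : Fin n) (x : ℝ) :
    ContinuousWithinAt (σ.bidCDF i) (Set.Ici x) x :=
  tendsto_finsetSum _ fun k _ => (σ.continuousWithinAt_law i k x).const_mul _

lemma continuousAt_bidCDF {i : Fin n} {x : ℝ} (h : ∀ k, (σ.law i k).real {x} = 0) :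
    ContinuousAt (σ.bidCDF i) x := by
  refine tendsto_finsetSum _ fun k _ => Filter.Tendsto.const_mul _ ?_
  simp only [← ProbabilityTheory.cdf_eq_real]
  set f := ProbabilityTheory.cdf (σ.law i k)
  have hf : f.measure {x} = 0 := by
    rw [ProbabilityTheory.measure_cdf]
    exact (measureReal_eq_zero_iff).1 (h k)
  rw [StieltjesFunction.measure_singleton, ENNReal.ofReal_eq_zero] at hf
  have h1 : Function.leftLim f x = f x :=
    le_antisymm (f.mono.leftLim_le le_rfl) (by linarith)
  exact f.mono.continuousAt_iff_leftLim_eq_rightLim.2 (by rw [h1, f.rightLim_eq])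

end Profile

lemma exists_mem_of_ae {μ : Measure ℝ} [IsFiniteMeasure μ] {s : Set ℝ} {p : ℝ → Prop}
    (hs : 0 < μ.real s) (h : ∀ᵐ x ∂μ, p x) : ∃ x ∈ s, p x := by
  by_contra! hc
  refine hs.ne' ((measureReal_eq_zero_iff).2 ?_)
  exact measure_mono_null (fun x hx => hc x hx) (ae_iff.1 h)

lemma ae_measure_Iic_ne_zero (μ : Measure ℝ) : ∀ᵐ x ∂μ, μ (Set.Iic x) ≠ 0 := by
  rw [ae_iff]
  refine measure_null_of_locally_null _ fun x hx => ?_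
  simp only [not_not, Set.mem_ofPred_eq] at hx
  by_cases hmax : ∃ y, x < y ∧ μ (Set.Iic y) = 0
  · obtain ⟨y, hxy, hy⟩ := hmax
    exact ⟨Set.Iic y, mem_nhdsWithin_of_mem_nhds (Iic_mem_nhds hxy), hy⟩
  · push Not at hmax
    refine ⟨_, self_mem_nhdsWithin, measure_mono_null (fun y hy => ?_) hx⟩
    simp only [not_not, Set.mem_ofPred_eq] at hy
    by_contra hxy
    exact hmax y (not_le.1 hxy) hy

/-! ### First consequences of equilibrium -/

namespace Profile

/-- The expected utility of buyer `i` with value `A.value i k`. -/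
def utility (σ : A.Profile) (i : Fin n) (k : Fin (A.d i)) : ℝ :=
  ∫ b, σ.interimPayoff i k b ∂(σ.law i k)

variable {σ : A.Profile} {i : Fin n} {k : Fin (A.d i)}

lemma integrable_interimPayoff (σ : A.Profile) (i : Fin n) (k : Fin (A.d i)) :
    Integrable (σ.interimPayoff i k) (σ.law i k) := by
  refine Integrable.of_mem_Icc 0 (A.value i k) (σ.measurable_interimPayoff i k).aemeasurable ?_
  filter_upwards [σ.bid_mem i k] with b hb
  refine ⟨interimPayoff_nonneg hb.2, (interimPayoff_le hb.2).trans ?_⟩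
  have h1 := others_le_one (i := i) (fun j => σ.bidCDF_nonneg j b) (fun j => σ.bidCDF_le_one j b)
  have h0 := others_nonneg (i := i) (fun j => σ.bidCDF_nonneg j b)
  nlinarith

lemma continuousWithinAt_others (σ : A.Profile) (i : Fin n) (x : ℝ) :
    ContinuousWithinAt (others σ.bidCDF i) (Set.Ici x) x :=
  tendsto_finsetProd _ fun j _ => σ.continuousWithinAt_bidCDF j x

lemma others_bidCDF_nonneg (σ : A.Profile) (i : Fin n) (x : ℝ) : 0 ≤ others σ.bidCDF i x :=
  others_nonneg fun j => σ.bidCDF_nonneg j x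

lemma others_bidCDF_mono (σ : A.Profile) (i : Fin n) : Monotone (others σ.bidCDF i) :=
  fun _ _ h => others_le_others (fun j _ => σ.bidCDF_nonneg j _) fun j _ => σ.bidCDF_mono j h

namespace IsBNE

lemma utility_nonneg (hσ : σ.IsBNE) (i : Fin n) (k : Fin (A.d i)) : 0 ≤ σ.utility i k :=
  (interimPayoff_nonneg (A.value_nonneg i k)).trans (hσ i k 0 le_rfl (A.value_nonneg i k))

/-- A buyer can secure the surplus times the probability that no other bid is above `y`, by bidding
slightly more than `y`. -/
lemma surplus_le_utility (hσ : σ.IsBNE) (i : Fin n) (k : Fin (A.d i)) {y : ℝ} (hy : 0 ≤ y) :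
    (A.value i k - y) * others σ.bidCDF i y ≤ σ.utility i k := by
  rcases le_or_gt (A.value i k) y with h | h
  · exact (mul_nonpos_of_nonpos_of_nonneg (by linarith) (σ.others_bidCDF_nonneg i y)).trans
      (hσ.utility_nonneg i k)
  · have ht : Filter.Tendsto (fun b => (A.value i k - b) * others σ.bidCDF i y) (𝓝[>] y)
        (𝓝 ((A.value i k - y) * others σ.bidCDF i y)) := by
      have : Continuous fun b => (A.value i k - b) * others σ.bidCDF i y := by fun_prop
      exact this.continuousAt.tendsto.mono_left nhdsWithin_le_nhds
    refine le_of_tendsto ht ?_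
    filter_upwards [Ioo_mem_nhdsGT h] with b hb
    exact (interimPayoff_ge hb.1 hb.2.le).trans (hσ i k b (hy.trans hb.1.le) hb.2.le)

/-- Almost every bid of an equilibrium strategy attains the equilibrium utility, since no bid yields
more. It also earns the full surplus: ties cost nothing at an optimal bid, because a slightly larger
bid would avoid them. -/
lemma ae_optimal (hσ : σ.IsBNE) (i : Fin n) (k : Fin (A.d i)) : ∀ᵐ y ∂(σ.law i k),
    0 ≤ y ∧ y ≤ A.value i k ∧ σ.interimPayoff i k y = σ.utility i k ∧
      (A.value i k - y) * others σ.bidCDF i y = σ.utility i k := by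
  have hint := σ.integrable_interimPayoff i k
  have h1 : 0 ≤ᵐ[σ.law i k] fun y => σ.utility i k - σ.interimPayoff i k y := by
    filter_upwards [σ.bid_mem i k] with y hy
    exact sub_nonneg.2 (hσ i k y hy.1 hy.2)
  have h2 : ∫ y, (σ.utility i k - σ.interimPayoff i k y) ∂(σ.law i k) = 0 := by
    rw [integral_sub (integrable_const _) hint]
    simp [utility]
  rw [integral_eq_zero_iff_of_nonneg_ae h1 ((integrable_const _).sub hint)] at h2
  filter_upwards [h2, σ.bid_mem i k] with y hy hb
  have h3 : σ.interimPayoff i k y = σ.utility i k := by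
    simp only [Pi.zero_apply] at hy; linarith
  refine ⟨hb.1, hb.2, h3, le_antisymm (hσ.surplus_le_utility i k hb.1) ?_⟩
  rw [← h3]
  exact interimPayoff_le hb.2

lemma exists_optimal (hσ : σ.IsBNE) {s : Set ℝ} (hs : 0 < (σ.law i k).real s) : ∃ y ∈ s,
    0 ≤ y ∧ (A.value i k - y) * others σ.bidCDF i y = σ.utility i k := by
  obtain ⟨y, hy, h⟩ := exists_mem_of_ae hs (hσ.ae_optimal i k)
  exact ⟨y, hy, h.1, h.2.2.2⟩

/-- Two buyers with values above `x` do not both have an atom at `x`: the price of the Vickrey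
auction takes away part of the surplus in a tie, so that either of them would bid slightly more. -/
lemma not_two_atoms (hσ : σ.IsBNE) {x : ℝ} (hpos : ∀ l, 0 < σ.bidCDF l x) {j : Fin n} (hj : j ≠ i)
    {k' : Fin (A.d j)} (hk : x < A.value i k) (hk' : x < A.value j k')
    (h : 0 < (σ.law i k).real {x}) (h' : 0 < (σ.law j k').real {x}) : False := by
  obtain ⟨y, hy, h1⟩ := exists_mem_of_ae h (hσ.ae_optimal i k)
  rw [Set.mem_singleton_iff] at hy
  subst hy
  have := interimPayoff_lt_of_tie hk hj hk' h' hpos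
  rw [h1.2.2.1, h1.2.2.2] at this
  exact lt_irrefl _ this

end IsBNE

/-- The infimum of the bids at which all bid distribution functions are positive. It is the smallest
winning bid, see `isLeast_winningBids`. -/
def bottom (σ : A.Profile) : ℝ := sInf {x | ∀ i, 0 < σ.bidCDF i x}

lemma bidCDF_top (σ : A.Profile) (i : Fin n) : σ.bidCDF i A.top = 1 :=
  σ.bidCDF_eq_one fun k => value_le_top i k

lemma zero_mem_lowerBounds [NeZero n] (σ : A.Profile) :
    0 ∈ lowerBounds {x | ∀ i, 0 < σ.bidCDF i x} := by
  intro x hx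
  by_contra h
  exact (hx 0).ne' (σ.bidCDF_neg (not_le.1 h))

lemma bottom_nonneg [NeZero n] (σ : A.Profile) : 0 ≤ σ.bottom :=
  le_csInf ⟨A.top, fun i => by rw [bidCDF_top]; exact one_pos⟩ σ.zero_mem_lowerBounds

lemma bidCDF_pos_of_bottom_lt {x : ℝ} (hx : σ.bottom < x) (i : Fin n) : 0 < σ.bidCDF i x := by
  obtain ⟨y, hy, hyx⟩ := exists_lt_of_csInf_lt
    ⟨A.top, fun i => by rw [bidCDF_top]; exact one_pos⟩ hx
  exact (hy i).trans_le (σ.bidCDF_mono i hyx.le)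

lemma exists_bidCDF_eq_zero [NeZero n] {x : ℝ} (hx : x < σ.bottom) : ∃ i, σ.bidCDF i x = 0 := by
  by_contra! h
  refine absurd hx (not_lt.2 (csInf_le ⟨0, σ.zero_mem_lowerBounds⟩ fun i => ?_))
  exact lt_of_le_of_ne (σ.bidCDF_nonneg i x) (h i).symm

namespace IsBNE

lemma utility_pos [NeZero n] (hσ : σ.IsBNE) (hk : σ.bottom < A.value i k) : 0 < σ.utility i k := by
  obtain ⟨y, hy1, hy2⟩ := exists_between hk
  exact (mul_pos (sub_pos.2 hy2) (others_pos fun j _ => bidCDF_pos_of_bottom_lt hy1 j)).trans_le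
    (hσ.surplus_le_utility i k (σ.bottom_nonneg.trans hy1.le))

lemma bidCDF_eq_valueCDF {x c : ℝ} (hc : c ≤ x)
    (h : ∀ k, c < A.value i k → (σ.law i k).real (Set.Iic x) = 0) :
    σ.bidCDF i x = A.valueCDF i c := by
  refine Finset.sum_congr rfl fun k _ => ?_
  split_ifs with hk
  · rw [σ.law_Iic_eq_one (hk.trans hc), mul_one]
  · rw [h k (not_le.1 hk), mul_zero]

/-- If `F i` vanished at the bottom `c`, a bid near `c` would win next to nothing for the other
buyers, so those with values above `c` would stay away from an interval `(c, x]`. Buyer `i` would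
then bid in `(c, x]` against constant competition, and gain by moving the bid down to `c`. -/
lemma bidCDF_bottom_pos [NeZero n] (hσ : σ.IsBNE) (i : Fin n) : 0 < σ.bidCDF i σ.bottom := by
  set c := σ.bottom with hc
  by_contra hi
  have hi0 : σ.bidCDF i c = 0 := le_antisymm (not_lt.1 hi) (σ.bidCDF_nonneg i c)
  -- the other buyers with values above `c` do not bid just above `c`
  have h1 : ∀ᶠ x in 𝓝[>] c, ∀ j, j ≠ i → ∀ k, c < A.value j k →
      (σ.law j k).real (Set.Iic x) = 0 := by
    refine Filter.eventually_all.2 fun j => Filter.eventually_all.2 fun hj =>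
      Filter.eventually_all.2 fun k => Filter.eventually_all.2 fun hk => ?_
    have hU := hσ.utility_pos hk
    have h0 : others σ.bidCDF j c = 0 := others_eq_zero hj.symm hi0
    have ht : Filter.Tendsto (fun y => A.value j k * others σ.bidCDF j y) (𝓝[≥] c)
        (𝓝 (A.value j k * 0)) := by
      rw [← h0]; exact (σ.continuousWithinAt_others j c).const_mul _
    rw [mul_zero] at ht
    have := (ht.mono_left (nhdsWithin_mono c Set.Ioi_subset_Ici_self)).eventually (gt_mem_nhds hU)
    filter_upwards [this] with x hx
    by_contra hne
    obtain ⟨y, hy, hy0, hyU⟩ := hσ.exists_optimal (lt_of_le_of_ne measureReal_nonneg (Ne.symm hne))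
    have hm := σ.others_bidCDF_mono j (show y ≤ x from hy)
    have := σ.others_bidCDF_nonneg j y
    have := A.value_nonneg j k
    nlinarith
  obtain ⟨x, hx, hxc⟩ := (h1.and self_mem_nhdsWithin).exists
  have hxc : c < x := hxc
  have hF : ∀ j, j ≠ i → ∀ y, c ≤ y → y ≤ x → σ.bidCDF j y = A.valueCDF j c := by
    intro j hj y hy hyx
    refine bidCDF_eq_valueCDF hy fun k hk => ?_
    refine le_antisymm ?_ measureReal_nonneg
    rw [← hx j hj k hk]
    exact measureReal_mono (Set.Iic_subset_Iic.2 hyx)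
  have hix := bidCDF_pos_of_bottom_lt hxc i
  obtain ⟨k, hk⟩ : ∃ k, (σ.law i k).real (Set.Iic x) ≠ 0 := by
    by_contra! h
    exact hix.ne' (σ.bidCDF_eq_zero_iff.2 h)
  have hk0 := σ.bidCDF_eq_zero_iff.1 hi0 k
  have hk' : 0 < (σ.law i k).real (Set.Ioc c x) := by
    rw [← Set.Iic_sdiff_Iic, measureReal_sdiff (Set.Iic_subset_Iic.2 hxc.le) measurableSet_Iic, hk0,
      sub_zero]
    exact lt_of_le_of_ne measureReal_nonneg (Ne.symm hk)
  -- a bid of `i` in `(c, x]` is not better than the bid `c`, which wins as often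
  obtain ⟨y, hy, hy0, hyU⟩ := hσ.exists_optimal hk'
  have he : others σ.bidCDF i y = others σ.bidCDF i c := others_congr fun j hj => by
    rw [hF j hj y hy.1.le hy.2, hF j hj c le_rfl hxc.le]
  have hp : 0 < others σ.bidCDF i y := others_pos fun j _ => bidCDF_pos_of_bottom_lt hy.1 j
  have := hσ.surplus_le_utility i k σ.bottom_nonneg
  rw [← hyU, ← hc, ← he] at this
  have := le_of_mul_le_mul_right this hp
  linarith [hy.1]

lemma bidCDF_pos [NeZero n] (hσ : σ.IsBNE) {x : ℝ} (hx : σ.bottom ≤ x) (i : Fin n) :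
    0 < σ.bidCDF i x :=
  (hσ.bidCDF_bottom_pos i).trans_le (σ.bidCDF_mono i hx)

lemma others_pos_of_bottom_le [NeZero n] (hσ : σ.IsBNE) {x : ℝ} (hx : σ.bottom ≤ x) (i : Fin n) :
    0 < others σ.bidCDF i x := others_pos fun j _ => hσ.bidCDF_pos hx j

/-- Bids below the bottom never win, so that values with a positive utility do not make them. -/
lemma law_Iio_bottom [NeZero n] (hσ : σ.IsBNE) (hk : σ.bottom < A.value i k) :
    (σ.law i k).real (Set.Iio σ.bottom) = 0 := by
  rw [measureReal_eq_zero_iff]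
  have : ∀ᵐ y ∂(σ.law i k), y ∉ Set.Iio σ.bottom := by
    filter_upwards [hσ.ae_optimal i k, ae_measure_Iic_ne_zero (σ.law i k)] with y hy hne hyc
    have hU := hσ.utility_pos hk
    rw [← hy.2.2.2] at hU
    obtain ⟨j, hj⟩ := exists_bidCDF_eq_zero hyc
    by_cases hji : j = i
    · subst hji
      exact hne ((measureReal_eq_zero_iff).1 (σ.bidCDF_eq_zero_iff.1 hj k))
    · rw [others_eq_zero hji hj, mul_zero] at hU
      exact lt_irrefl _ hU
  exact measure_eq_zero_iff_ae_notMem.2 this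

lemma law_Iic_bottom [NeZero n] (hσ : σ.IsBNE) (hk : σ.bottom < A.value i k) :
    (σ.law i k).real (Set.Iic σ.bottom) = (σ.law i k).real {σ.bottom} := by
  rw [← Set.Iio_union_right, measureReal_union (by simp) (measurableSet_singleton _),
    hσ.law_Iio_bottom hk, zero_add]

/-- All buyers but one bid at most the bottom exactly when their value is at most the bottom: values
above the bottom can only have an atom there, and no two buyers have one. -/
lemma exists_exceptional [NeZero n] (hσ : σ.IsBNE) : ∃ e : Fin n, ∀ i ≠ e,
    σ.bidCDF i σ.bottom = A.valueCDF i σ.bottom := by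
  by_cases h : ∃ e, ∃ k : Fin (A.d e), σ.bottom < A.value e k ∧ 0 < (σ.law e k).real {σ.bottom}
  · obtain ⟨e, k, hk, hpos⟩ := h
    refine ⟨e, fun i hi => bidCDF_eq_valueCDF le_rfl fun l hl => ?_⟩
    rw [hσ.law_Iic_bottom hl]
    refine le_antisymm (not_lt.1 fun hl' => ?_) measureReal_nonneg
    exact hσ.not_two_atoms hσ.bidCDF_bottom_pos hi.symm hl hk hl' hpos
  · push Not at h
    refine ⟨0, fun i _ => bidCDF_eq_valueCDF le_rfl fun l hl => ?_⟩
    rw [hσ.law_Iic_bottom hl]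
    exact le_antisymm (h i l hl) measureReal_nonneg

lemma lt_value_of_optimal [NeZero n] (hσ : σ.IsBNE) {y : ℝ} (hk : σ.bottom < A.value i k)
    (hyU : (A.value i k - y) * others σ.bidCDF i y = σ.utility i k) : y < A.value i k := by
  have hU := hσ.utility_pos hk
  rw [← hyU] at hU
  by_contra h
  exact absurd hU (not_lt.2 (mul_nonpos_of_nonpos_of_nonneg (by linarith)
    (σ.others_bidCDF_nonneg i y)))

/-- There are no atoms above the bottom. Bidding just below an atom of buyer `i` is worse for the
other buyers than bidding just above it, so nobody does. Then buyer `i` can move the atom down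
without winning less often. -/
lemma law_singleton_eq_zero [NeZero n] (hσ : σ.IsBNE) {x : ℝ} (hx : σ.bottom < x) (i : Fin n)
    (k : Fin (A.d i)) :
    (σ.law i k).real {x} = 0 := by
  by_contra hne
  have hatom : 0 < (σ.law i k).real {x} := lt_of_le_of_ne measureReal_nonneg (Ne.symm hne)
  have hval : ∀ j (l : Fin (A.d j)), 0 < (σ.law j l).real {x} → x < A.value j l := by
    intro j l hl
    obtain ⟨y, hy, h1⟩ := exists_mem_of_ae hl (hσ.ae_optimal j l)
    rw [Set.mem_singleton_iff] at hy
    subst hy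
    exact hσ.lt_value_of_optimal (hx.trans_le h1.2.1) h1.2.2.2
  have hxk := hval i k hatom
  have hpos := hσ.bidCDF_pos hx.le
  set m := A.prob i k * (σ.law i k).real {x} with hm
  have hm0 : 0 < m := mul_pos (A.prob_pos i k) hatom
  have hjump : ∀ t < x, σ.bidCDF i t ≤ σ.bidCDF i x - m := by
    intro t ht
    have hsum : m = ∑ l, if l = k then A.prob i l * (σ.law i l).real {x} else 0 := by simp [hm]
    rw [hsum, bidCDF, bidCDF, ← Finset.sum_sub_distrib]
    refine Finset.sum_le_sum fun l _ => ?_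
    have h2 : (σ.law i l).real (Set.Iic t) + (σ.law i l).real {x} ≤
        (σ.law i l).real (Set.Iic x) := by
      rw [← measureReal_union (by simpa using ht) (measurableSet_singleton _)]
      refine measureReal_mono ?_
      intro y hy
      rcases hy with hy | hy
      · exact le_trans hy ht.le
      · exact le_of_eq hy
    have h3 := A.prob_pos i l
    have h4 : 0 ≤ (σ.law i l).real {x} := measureReal_nonneg
    split_ifs <;> nlinarith
  -- no other buyer bids in some interval `(y, x]`
  have h1 : ∀ᶠ y in 𝓝[<] x, ∀ j, j ≠ i → ∀ l, (σ.law j l).real (Set.Ioc y x) = 0 := by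
    refine Filter.eventually_all.2 fun j => Filter.eventually_all.2 fun hj =>
      Filter.eventually_all.2 fun l => ?_
    rcases le_or_gt (A.value j l) σ.bottom with hl | hl
    · filter_upwards [Ioo_mem_nhdsLT hx] with y hy
      refine le_antisymm ?_ measureReal_nonneg
      have h2 := σ.law_Iic_eq_one (hl.trans hy.1.le)
      have h3 : (σ.law j l).real (Set.Iic y)ᶜ = 0 := by
        rw [measureReal_compl measurableSet_Iic, h2, probReal_univ, sub_self]
      rw [← h3]
      refine measureReal_mono fun t ht => ?_
      simpa using ht.1
    have hx0 : (σ.law j l).real {x} = 0 := by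
      refine le_antisymm (not_lt.1 fun h => ?_) measureReal_nonneg
      exact hσ.not_two_atoms hpos hj hxk (hval j l h) hatom h
    have hU := hσ.utility_pos hl
    suffices hs : ∀ᶠ y in 𝓝[<] x, ∀ t, y < t → t < x → 0 ≤ t →
        (A.value j l - t) * others σ.bidCDF j t ≠ σ.utility j l by
      filter_upwards [hs] with y hy
      by_contra hne
      have h2 : (σ.law j l).real (Set.Ioo y x) ≠ 0 := by
        intro h0
        have h3 : Set.Ioc y x ⊆ Set.Ioo y x ∪ {x} := by
          intro t ht
          rcases ht.2.eq_or_lt with h | h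
          · exact Or.inr h
          · exact Or.inl ⟨ht.1, h⟩
        have h4 := (measureReal_mono (μ := σ.law j l) h3).trans (measureReal_union_le _ _)
        rw [h0, hx0, add_zero] at h4
        exact hne (le_antisymm h4 measureReal_nonneg)
      obtain ⟨t, ht, ht0, htU⟩ := hσ.exists_optimal (lt_of_le_of_ne measureReal_nonneg h2.symm)
      exact hy t ht.1 ht.2 ht0 htU
    -- a value up to `x` has too small a surplus near `x`, a larger value gains by jumping over `x`
    rcases le_or_gt (A.value j l) x with hlx | hlx
    · filter_upwards [Ioo_mem_nhdsLT (show x - σ.utility j l < x by linarith)] with y hy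
      intro t hyt htx ht0 htU
      have h2 := others_le_one (i := j) (fun i => σ.bidCDF_nonneg i t)
        (fun i => σ.bidCDF_le_one i t)
      have h3 := hσ.lt_value_of_optimal hl htU
      have := hy.1
      nlinarith
    · set R := ∏ l ∈ (Finset.univ.erase j).erase i, σ.bidCDF l x with hR
      have hR0 : 0 < R := Finset.prod_pos fun l _ => hpos l
      have hi : i ∈ Finset.univ.erase j := Finset.mem_erase.2 ⟨hj.symm, Finset.mem_univ _⟩
      have hox : others σ.bidCDF j x = σ.bidCDF i x * R :=
        (Finset.mul_prod_erase _ (fun l => σ.bidCDF l x) hi).symm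
      have hot : ∀ t < x, others σ.bidCDF j t ≤ (σ.bidCDF i x - m) * R := by
        intro t ht
        have : others σ.bidCDF j t = σ.bidCDF i t * _ :=
          (Finset.mul_prod_erase _ (fun l => σ.bidCDF l t) hi).symm
        rw [this]
        refine mul_le_mul (hjump t ht) (Finset.prod_le_prod (fun l _ => σ.bidCDF_nonneg l t)
          fun l _ => σ.bidCDF_mono l ht.le) (Finset.prod_nonneg fun l _ => σ.bidCDF_nonneg l t) ?_
        exact (σ.bidCDF_nonneg i t).trans (hjump t ht)
      have hx0' : 0 ≤ x := σ.bottom_nonneg.trans hx.le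
      have hUx := hσ.surplus_le_utility j l hx0'
      rw [hox] at hUx
      have hlim : Filter.Tendsto (fun t => (A.value j l - t) * ((σ.bidCDF i x - m) * R)) (𝓝[<] x)
          (𝓝 ((A.value j l - x) * ((σ.bidCDF i x - m) * R))) := by
        have : Continuous fun t => (A.value j l - t) * ((σ.bidCDF i x - m) * R) := by fun_prop
        exact this.continuousAt.tendsto.mono_left nhdsWithin_le_nhds
      have hlt : (A.value j l - x) * ((σ.bidCDF i x - m) * R) < σ.utility j l := by
        refine lt_of_lt_of_le ?_ hUx
        refine mul_lt_mul_of_pos_left ?_ (sub_pos.2 hlx)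
        nlinarith
      filter_upwards [hlim.eventually (gt_mem_nhds hlt)] with y hy
      intro t hyt htx ht0 htU
      have h2 := hot t htx
      have h3 := (σ.others_bidCDF_nonneg j t).trans h2
      have h4 : (A.value j l - t) * others σ.bidCDF j t ≤
          (A.value j l - t) * ((σ.bidCDF i x - m) * R) :=
        mul_le_mul_of_nonneg_left h2 (by linarith)
      nlinarith
  -- the bid `y` of buyer `i` wins as often as the bid `x`
  obtain ⟨y, hy, hyx⟩ := (h1.and (Ioo_mem_nhdsLT hx)).exists
  have he : others σ.bidCDF i y = others σ.bidCDF i x := by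
    refine others_congr fun j hj => Finset.sum_congr rfl fun l _ => ?_
    have := hy j hj l
    rw [← Set.Iic_sdiff_Iic, measureReal_sdiff (Set.Iic_subset_Iic.2 hyx.2.le) measurableSet_Iic]
      at this
    rw [sub_eq_zero.1 this]
  obtain ⟨t, ht, h2⟩ := exists_mem_of_ae hatom (hσ.ae_optimal i k)
  rw [Set.mem_singleton_iff] at ht
  subst ht
  have h3 := hσ.surplus_le_utility i k (σ.bottom_nonneg.trans hyx.1.le)
  rw [← h2.2.2.2, he] at h3
  have := le_of_mul_le_mul_right h3 (hσ.others_pos_of_bottom_le hx.le i)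
  linarith [hyx.2]

lemma continuousAt_bidCDF [NeZero n] (hσ : σ.IsBNE) {x : ℝ} (hx : σ.bottom < x) (i : Fin n) :
    ContinuousAt (σ.bidCDF i) x :=
  σ.continuousAt_bidCDF fun k => hσ.law_singleton_eq_zero hx i k

lemma continuousOn_bidCDF [NeZero n] (hσ : σ.IsBNE) (i : Fin n) :
    ContinuousOn (σ.bidCDF i) (Set.Ici σ.bottom) := by
  intro x hx
  rcases (show σ.bottom ≤ x from hx).eq_or_lt with h | h
  · rw [← h]; exact σ.continuousWithinAt_bidCDF i _
  · exact (hσ.continuousAt_bidCDF h i).continuousWithinAt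

end IsBNE
end Profile

/-! ### The smallest winning bid -/

/-- `b` is the reserve bid of the auction, relative to a buyer `j` whose smallest value is largest:
the largest bid that is optimal for buyer `j` with the smallest value if all other buyers bid
their values and lose all ties. -/
structure IsReserve (A : FirstPriceAuction n) (j : Fin n) (b : ℝ) : Prop where
  low_le_low : ∀ i, A.low i ≤ A.low j
  nonneg : 0 ≤ b
  le_low : b ≤ A.low j
  isMax : ∀ y, 0 ≤ y → y ≤ A.low j →
    (A.low j - y) * others A.valueCDF j y ≤ (A.low j - b) * others A.valueCDF j b
  isMax_strict : ∀ y, b < y → y ≤ A.low j →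
    (A.low j - y) * others A.valueCDF j y < (A.low j - b) * others A.valueCDF j b

lemma IsReserve.eq {j : Fin n} {b c : ℝ} (hb : A.IsReserve j b) (hc : A.IsReserve j c) :
    b = c := by
  rcases lt_trichotomy b c with h | h | h
  · exact absurd (hc.isMax b hb.nonneg hb.le_low) (not_le.2 (hb.isMax_strict c h hc.le_low))
  · exact h
  · exact absurd (hb.isMax c hc.nonneg hc.le_low) (not_le.2 (hc.isMax_strict b h hb.le_low))

lemma winners_nonempty [NeZero n] (z : Fin n → ℝ × ℝ) : (winners z).Nonempty := by
  obtain ⟨j, -, hj⟩ := Finset.exists_max_image Finset.univ (fun j => (z j).2) ⟨0, Finset.mem_univ _⟩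
  have hne : (topBidders z).Nonempty := ⟨j, mem_topBidders.2 fun k => hj k (Finset.mem_univ _)⟩
  obtain ⟨i, hi, hmax⟩ := Finset.exists_max_image (topBidders z) (fun j => (z j).1) hne
  exact ⟨i, Finset.mem_filter.2 ⟨hi, hmax⟩⟩

namespace Profile

variable {σ : A.Profile} {i : Fin n} {k : Fin (A.d i)}

lemma jointLaw_forall_le (σ : A.Profile) (x : ℝ) :
    σ.jointLaw.real {z | ∀ j, (z j).2 ≤ x} = ∏ j, σ.bidCDF j x := by
  have : {z : Fin n → ℝ × ℝ | ∀ j, (z j).2 ≤ x} = Set.pi Set.univ fun _ => {p | p.2 ≤ x} := by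
    ext z; simp [Set.mem_pi]
  rw [measureReal_def, this, jointLaw, Measure.pi_pi, ENNReal.toReal_prod]
  refine Finset.prod_congr rfl fun j _ => ?_
  rw [← σ.buyerLaw_real_le j x]
  rfl

lemma jointLaw_forall_le_eq_zero [NeZero n] {x : ℝ} (hx : x < σ.bottom) :
    σ.jointLaw {z | ∀ j, (z j).2 ≤ x} = 0 := by
  rw [← measureReal_eq_zero_iff, jointLaw_forall_le]
  obtain ⟨i, hi⟩ := exists_bidCDF_eq_zero hx
  exact Finset.prod_eq_zero (Finset.mem_univ i) hi

/-- The highest bid is at most `x` with the probability `∏ j, F j x`, and the highest bid wins. -/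
lemma isLeast_winningBids [NeZero n] (σ : A.Profile) : IsLeast σ.winningBids σ.bottom := by
  constructor
  · intro U hU
    obtain ⟨ε, hε, hball⟩ := Metric.mem_nhds_iff.1 hU
    have h0 := jointLaw_forall_le_eq_zero (σ := σ) (x := σ.bottom - ε / 2) (by linarith)
    have h1 : 0 < σ.jointLaw.real {z | ∀ j, (z j).2 ≤ σ.bottom + ε / 2} := by
      rw [jointLaw_forall_le]
      exact Finset.prod_pos fun j _ => bidCDF_pos_of_bottom_lt (by linarith) j
    have h2 : 0 < σ.jointLaw {z | ∀ j, (z j).2 ≤ σ.bottom + ε / 2} := by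
      rw [measureReal_def] at h1
      exact (ENNReal.toReal_pos_iff.1 h1).1
    rw [← measure_sdiff_null h0] at h2
    refine h2.trans_le (measure_mono ?_)
    rintro z ⟨hz1, hz0⟩
    obtain ⟨i, hi⟩ := winners_nonempty z
    refine ⟨i, hi, hball ?_⟩
    have hz1 : ∀ j, (z j).2 ≤ σ.bottom + ε / 2 := hz1
    have hz0 : ¬ ∀ j, (z j).2 ≤ σ.bottom - ε / 2 := hz0
    push Not at hz0
    obtain ⟨j, hj⟩ := hz0
    have h3 := (mem_winners.1 hi).1 j
    rw [Metric.mem_ball, Real.dist_eq, abs_lt]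
    constructor <;> linarith [hz1 i]
  · intro b hb
    by_contra hlt
    rw [not_le] at hlt
    obtain ⟨y, hby, hy⟩ := exists_between hlt
    refine (hb (Set.Iio y) (Iio_mem_nhds hby)).ne' (measure_mono_null ?_
      (jointLaw_forall_le_eq_zero hy))
    rintro z ⟨i, hi, hiy⟩ j
    exact ((mem_winners.1 hi).1 j).trans (le_of_lt hiy)

namespace IsBNE

/-- The smallest winning bid of an equilibrium is determined by the value distributions. If it is
less than the smallest value of buyer `j`, then `j` is the exceptional buyer, who bids the bottom
with positive probability. The bottom is therefore optimal for the smallest value of `j` against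
the equilibrium bids. If the others bid their values, larger bids win less often, but the bottom
does not, since the bid distribution functions of the others coincide with the value distribution
functions there. -/
lemma isReserve_bottom [NeZero n] (hσ : σ.IsBNE) {j : Fin n} (hj : ∀ i, A.low i ≤ A.low j) :
    A.IsReserve j σ.bottom := by
  have hle : σ.bottom ≤ A.low j := by
    by_contra! h
    obtain ⟨i, hi⟩ := exists_bidCDF_eq_zero h
    have := σ.valueCDF_le_bidCDF i (A.low j)
    rw [hi] at this
    exact absurd (valueCDF_pos.2 (hj i)) (not_lt.2 this)
  obtain ⟨e, he⟩ := hσ.exists_exceptional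
  rcases hle.eq_or_lt with heq | hlt
  -- if the bottom is the smallest value of `j`, this value has utility `0` in equilibrium
  · refine ⟨hj, σ.bottom_nonneg, hle, fun y hy0 hyl => ?_, fun y hy1 hy2 => ?_⟩
    · rw [heq, sub_self, zero_mul]
      by_contra! hpos
      have hyl' : y < A.low j := by
        rcases hyl.eq_or_lt with h | h
        · rw [h, sub_self, zero_mul] at hpos; exact absurd hpos (lt_irrefl _)
        · exact h
      have hU : 0 < σ.utility j ⟨0, A.d_pos j⟩ := by
        refine hpos.trans_le (le_trans ?_ (hσ.surplus_le_utility j ⟨0, A.d_pos j⟩ hy0))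
        exact mul_le_mul_of_nonneg_left (others_le_others (fun i _ => valueCDF_nonneg i y)
          fun i _ => σ.valueCDF_le_bidCDF i y) (by linarith)
      obtain ⟨t, ht⟩ := ((hσ.ae_optimal j ⟨0, A.d_pos j⟩).and
        (ae_measure_Iic_ne_zero (σ.law j ⟨0, A.d_pos j⟩))).exists
      obtain ⟨⟨ht0, htv, -, htU⟩, hne⟩ := ht
      change t ≤ A.low j at htv
      have hval : A.value j ⟨0, A.d_pos j⟩ = A.low j := rfl
      rw [hval] at htU
      have htl : t < σ.bottom := by
        rw [heq]
        rcases htv.eq_or_lt with h | h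
        · rw [h, sub_self, zero_mul] at htU; linarith
        · exact h
      obtain ⟨i, hi⟩ := exists_bidCDF_eq_zero htl
      by_cases hij : i = j
      · subst hij
        exact hne ((measureReal_eq_zero_iff).1 (σ.bidCDF_eq_zero_iff.1 hi _))
      · rw [others_eq_zero hij hi, mul_zero] at htU
        linarith
    · rw [heq] at hy1; linarith
  -- now the smallest value of `j` exceeds the bottom, so `j` is the exceptional buyer
  have hej : e = j := by
    by_contra hne
    have := hσ.bidCDF_bottom_pos j
    rw [he j (Ne.symm hne), valueCDF_eq_zero hlt] at this
    exact lt_irrefl _ this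
  subst hej
  have hoc : others A.valueCDF e σ.bottom = others σ.bidCDF e σ.bottom :=
    others_congr fun i hi => (he i hi).symm
  have hopos := hσ.others_pos_of_bottom_le le_rfl e
  set k0 : Fin (A.d e) := ⟨0, A.d_pos e⟩ with hk0
  have hval : A.value e k0 = A.low e := rfl
  -- the bottom is optimal for some value of `e`, hence for the smallest one, which gains even less
  -- from larger bids
  have hU0 : σ.utility e k0 = (A.low e - σ.bottom) * others σ.bidCDF e σ.bottom := by
    refine le_antisymm ?_ (hσ.surplus_le_utility e k0 σ.bottom_nonneg)
    obtain ⟨k, hk⟩ : ∃ k, (σ.law e k).real (Set.Iic σ.bottom) ≠ 0 := by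
      by_contra! h
      exact (hσ.bidCDF_bottom_pos e).ne' (σ.bidCDF_eq_zero_iff.2 h)
    rw [hσ.law_Iic_bottom (hlt.trans_le (low_le e k))] at hk
    obtain ⟨s, hs, hs0, hsU⟩ := hσ.exists_optimal (lt_of_le_of_ne measureReal_nonneg hk.symm)
    rw [Set.mem_singleton_iff] at hs
    subst hs
    have h1 : 0 < (σ.law e k0).real (Set.Ici σ.bottom) := by
      rw [← Set.compl_Iio, measureReal_compl measurableSet_Iio, hσ.law_Iio_bottom hlt]
      simp
    obtain ⟨t, ht, ht0, htU⟩ := hσ.exists_optimal h1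
    have h2 := hσ.surplus_le_utility e k ht0
    have h3 := σ.others_bidCDF_mono e (show σ.bottom ≤ t from ht)
    have h4 := low_le e k
    rw [hval] at htU
    nlinarith
  have hmax : ∀ y, 0 ≤ y → y ≤ A.low e →
      (A.low e - y) * others σ.bidCDF e y ≤ (A.low e - σ.bottom) * others σ.bidCDF e σ.bottom := by
    intro y hy0 _
    rw [← hU0]
    exact hσ.surplus_le_utility e k0 hy0
  have hΨ : ∀ y, others A.valueCDF e y ≤ others σ.bidCDF e y := fun y =>
    others_le_others (fun i _ => valueCDF_nonneg i y) fun i _ => σ.valueCDF_le_bidCDF i y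
  refine ⟨hj, σ.bottom_nonneg, hle, fun y hy0 hyl => ?_, fun y hy1 hyl => ?_⟩
  · rw [hoc]
    exact (mul_le_mul_of_nonneg_left (hΨ y) (by linarith)).trans (hmax y hy0 hyl)
  · rw [hoc]
    by_contra! hge
    have hU0pos : 0 < (A.low e - σ.bottom) * others σ.bidCDF e σ.bottom :=
      mul_pos (by linarith) hopos
    have hy0 := σ.bottom_nonneg.trans hy1.le
    have hyl' : y < A.low e := by
      rcases hyl.eq_or_lt with h | h
      · rw [h, sub_self, zero_mul] at hge; linarith
      · exact h
    have hle' : others σ.bidCDF e y ≤ others A.valueCDF e y :=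
      le_of_mul_le_mul_left ((hmax y hy0 hyl).trans hge) (by linarith)
    -- at an equally good larger bid `y`, the others would all have to bid as in `valueCDF`
    have hFΦ := eq_of_others_le (F := A.valueCDF) (i := e) (x := y) (y := y) (G := σ.bidCDF)
      (fun i hi => by
        refine lt_of_lt_of_le ?_ (valueCDF_mono i hy1.le)
        rw [← he i hi]; exact hσ.bidCDF_bottom_pos i)
      (fun i _ => σ.valueCDF_le_bidCDF i y) hle'
    -- types with a value in `(bottom, y]` bid bounded away from `y`, so a slightly lower bid
    -- of `e` wins as often as `y`
    have hev : ∀ᶠ t in 𝓝[<] y, ∀ i, ∀ l : Fin (A.d i), A.value i l ≤ y →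
        (σ.law i l).real (Set.Iic t) = 1 := by
      refine Filter.eventually_all.2 fun i => Filter.eventually_all.2 fun l =>
        Filter.eventually_all.2 fun hl => ?_
      rcases le_or_gt (A.value i l) σ.bottom with hlb | hlb
      · filter_upwards [Ioo_mem_nhdsLT hy1] with t ht
        exact σ.law_Iic_eq_one (hlb.trans ht.1.le)
      · have hU := hσ.utility_pos hlb
        filter_upwards [Ioo_mem_nhdsLT (show y - σ.utility i l < y by linarith)] with t ht
        have : ∀ᵐ s ∂(σ.law i l), s ∈ Set.Iic t := by
          filter_upwards [hσ.ae_optimal i l] with s hs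
          have h2 := others_le_one (i := i) (fun j => σ.bidCDF_nonneg j s)
            (fun j => σ.bidCDF_le_one j s)
          have h3 := hσ.lt_value_of_optimal hlb hs.2.2.2
          have h4 := hs.2.2.2
          have h5 := ht.1
          change s ≤ t
          nlinarith
        rw [measureReal_def, (mem_ae_iff_prob_eq_one measurableSet_Iic).1 this, ENNReal.toReal_one]
    obtain ⟨t, ht, htI⟩ := (hev.and (Ioo_mem_nhdsLT hy1)).exists
    have hot : others A.valueCDF e y ≤ others σ.bidCDF e t := by
      refine others_le_others (fun i _ => valueCDF_nonneg i y) fun i _ => ?_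
      refine Finset.sum_le_sum fun l _ => ?_
      split_ifs with hl
      · rw [ht i l hl, mul_one]
      · exact mul_nonneg (A.prob_pos i l).le measureReal_nonneg
    have h1 := hmax t (σ.bottom_nonneg.trans htI.1.le) (htI.2.le.trans hyl)
    have h2 : 0 < others A.valueCDF e y := by
      by_contra h
      have := mul_nonpos_of_nonneg_of_nonpos (sub_nonneg.2 hyl) (not_lt.1 h)
      linarith
    have h3 := mul_le_mul_of_nonneg_left hot (show 0 ≤ A.low e - t by linarith [htI.2])
    have h4 := mul_lt_mul_of_pos_right (show A.low e - y < A.low e - t by linarith [htI.2]) h2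
    linarith

end IsBNE
end Profile

/-- There is a reserve bid: the largest of the optimal bids among `0`, the values and the smallest
value of `j`. -/
lemma exists_isReserve (A : FirstPriceAuction n) {j : Fin n} (hj : ∀ i, A.low i ≤ A.low j) :
    ∃ b, A.IsReserve j b := by
  classical
  set f : ℝ → ℝ := fun y => (A.low j - y) * others A.valueCDF j y with hf
  set C : Finset ℝ := (insert 0 (insert (A.low j)
    (Finset.univ.image fun p : (i : Fin n) × Fin (A.d i) => A.value p.1 p.2))).filter
      fun y => 0 ≤ y ∧ y ≤ A.low j with hC
  have h0 : (0 : ℝ) ∈ C := by simp [hC, low_nonneg]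
  obtain ⟨m, hm, hmax⟩ := Finset.exists_max_image C f ⟨0, h0⟩
  set M := C.filter fun y => f y = f m with hM
  obtain ⟨b, hb, hbmax⟩ := Finset.exists_max_image M id ⟨m, by simp [hM, hm]⟩
  have hbC : b ∈ C := (Finset.mem_filter.1 hb).1
  have hfb : f b = f m := (Finset.mem_filter.1 hb).2
  have hbI : 0 ≤ b ∧ b ≤ A.low j := (Finset.mem_filter.1 hbC).2
  -- the last candidate below `y` is at least as good as `y`
  have key : ∀ y, 0 ≤ y → y ≤ A.low j → ∃ c ∈ C, c ≤ y ∧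
      others A.valueCDF j y = others A.valueCDF j c := by
    intro y hy0 hyl
    obtain ⟨c, hc, hcmax⟩ := Finset.exists_max_image (C.filter fun c => c ≤ y) id
      ⟨0, by simp [h0, hy0]⟩
    rw [Finset.mem_filter] at hc
    refine ⟨c, hc.1, hc.2, others_congr fun i _ => Finset.sum_congr rfl fun k _ => ?_⟩
    have : A.value i k ≤ y ↔ A.value i k ≤ c := by
      refine ⟨fun h => hcmax _ ?_, fun h => h.trans hc.2⟩
      simp only [hC, Finset.mem_filter, Finset.mem_insert, Finset.mem_image, Finset.mem_univ,
        true_and]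
      exact ⟨⟨Or.inr (Or.inr ⟨⟨i, k⟩, rfl⟩), A.value_nonneg i k, h.trans hyl⟩, h⟩
    simp only [this]
  have hoth : ∀ y, 0 ≤ others A.valueCDF j y := fun y => others_nonneg fun i => valueCDF_nonneg i y
  refine ⟨b, hj, hbI.1, hbI.2, fun y hy0 hyl => ?_, fun y hby hyl => ?_⟩
  · obtain ⟨c, hc, hcy, he⟩ := key y hy0 hyl
    have h1 := hmax c hc
    rw [← hfb] at h1
    refine le_trans ?_ h1
    rw [he]
    exact mul_le_mul_of_nonneg_right (by linarith) (hoth c)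
  · obtain ⟨c, hc, hcy, he⟩ := key y (hbI.1.trans hby.le) hyl
    have h1 := hmax c hc
    rcases hcy.eq_or_lt with hcy | hcy
    · subst hcy
      refine lt_of_le_of_ne (h1.trans_eq hfb.symm) fun h => ?_
      have h2 := hbmax c (Finset.mem_filter.2 ⟨hc, h.trans hfb⟩)
      exact absurd hby (not_lt.2 h2)
    · rw [he]
      rcases (hoth c).eq_or_lt with h0 | h0
      · rw [← h0, mul_zero]
        -- all bids up to `low j` would then be optimal, including `low j` itself
        have hlow : A.low j ∈ C := by simp [hC, low_nonneg]
        have h2 := hmax _ hlow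
        refine lt_of_le_of_ne (by rw [← hfb] at h2; simpa [hf] using h2) fun h => ?_
        have h3 := hbmax (A.low j) (Finset.mem_filter.2 ⟨hlow, by
          rw [← hfb]; simp only [hf, sub_self, zero_mul]; exact h⟩)
        exact absurd (hby.trans_le hyl) (not_lt.2 h3)
      · refine lt_of_lt_of_le (mul_lt_mul_of_pos_right (show A.low j - y < A.low j - c by linarith)
          h0) (h1.trans_eq hfb.symm)

/-! ### Quasiconcavity of the surplus and bid flows -/

/-- The analytic core of quasiconcavity: where the derivative of this function vanishes, it is about
to become positive, because the weights `(v - t) / (w j - t)` of its terms decrease in `t`. -/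
lemma not_isLocalMax_sum_log {ι : Type*} (T : Finset ι) {v x : ℝ} {w : ι → ℝ}
    (hv : x < v) (hw : ∀ j ∈ T, v ≤ w j) :
    ¬ IsLocalMax
      (fun t => ∑ j ∈ T, Real.log (w j - t) - (T.card - 1 : ℝ) * Real.log (v - t)) x := by
  intro hmax
  set f' : ℝ → ℝ := fun t => ∑ j ∈ T, (-1) / (w j - t) -
    (T.card - 1 : ℝ) * ((-1) / (v - t)) with hf'
  have hderiv : ∀ t < v, HasDerivAt
      (fun t => ∑ j ∈ T, Real.log (w j - t) - (T.card - 1 : ℝ) * Real.log (v - t)) (f' t) t := by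
    intro t ht
    refine HasDerivAt.sub (HasDerivAt.fun_sum fun j hj => ?_) (HasDerivAt.const_mul _ ?_)
    · exact ((hasDerivAt_id t).const_sub (w j)).log (by simp; linarith [hw j hj])
    · exact ((hasDerivAt_id t).const_sub v).log (by simp; linarith)
  have h0 : f' x = 0 := hmax.hasDerivAt_eq_zero (hderiv x hv)
  have hmul : ∀ t < v, (v - t) * f' t = (T.card - 1 : ℝ) - ∑ j ∈ T, (v - t) / (w j - t) := by
    intro t ht
    have : v - t ≠ 0 := by linarith
    simp only [hf', mul_sub, Finset.mul_sum]
    rw [show (v - t) * ((T.card - 1 : ℝ) * (-1 / (v - t))) = -(T.card - 1 : ℝ) by field_simp]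
    have h1 : ∑ j ∈ T, (v - t) * (-1 / (w j - t)) = -∑ j ∈ T, (v - t) / (w j - t) := by
      rw [← Finset.sum_neg_distrib]
      exact Finset.sum_congr rfl fun j _ => by ring
    rw [h1]; ring
  -- some `w j` exceeds `v`, as otherwise the balance at `x` would read `|T| = |T| - 1`
  obtain ⟨j0, hj0, hj0v⟩ : ∃ j ∈ T, v < w j := by
    by_contra! h
    have h1 := hmul x hv
    rw [h0, mul_zero, Finset.sum_congr rfl fun j hj => show (v - x) / (w j - x) = 1 by
      rw [le_antisymm (h j hj) (hw j hj), div_self (by linarith)]] at h1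
    simp at h1
  have hpos : ∀ t, x < t → t < v → 0 < f' t := by
    intro t hxt htv
    have hlt : ∑ j ∈ T, (v - t) / (w j - t) < ∑ j ∈ T, (v - x) / (w j - x) := by
      refine Finset.sum_lt_sum (fun j hj => ?_) ⟨j0, hj0, ?_⟩
      · have := hw j hj
        rw [div_le_div_iff₀ (by linarith) (by linarith)]
        nlinarith
      · rw [div_lt_div_iff₀ (by linarith) (by linarith)]
        nlinarith
    have h1 := hmul x hv
    rw [h0, mul_zero] at h1
    have h2 := hmul t htv
    have h3 : 0 < (v - t) * f' t := by rw [h2]; linarith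
    exact (mul_pos_iff_of_pos_left (by linarith)).1 h3
  obtain ⟨ε, hε, hball⟩ := Metric.eventually_nhds_iff.1 hmax
  set y := x + min (ε / 2) ((v - x) / 2) with hy
  have hxy : x < y := by
    have : 0 < min (ε / 2) ((v - x) / 2) := lt_min (by linarith) (by linarith)
    linarith
  have hyv : y < v := by linarith [min_le_right (ε / 2) ((v - x) / 2)]
  have hyε : dist y x < ε := by
    rw [Real.dist_eq, hy, add_sub_cancel_left, abs_of_pos (by linarith)]
    linarith [min_le_left (ε / 2) ((v - x) / 2)]
  have hmono : StrictMonoOn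
      (fun t => ∑ j ∈ T, Real.log (w j - t) - (T.card - 1 : ℝ) * Real.log (v - t))
      (Set.Icc x y) := by
    refine strictMonoOn_of_deriv_pos (convex_Icc x y) (fun t ht => ?_) fun t ht => ?_
    · exact (hderiv t (ht.2.trans_lt hyv)).continuousAt.continuousWithinAt
    · rw [interior_Icc] at ht
      rw [(hderiv t (ht.2.trans hyv)).deriv]
      exact hpos t ht.1 (ht.2.trans hyv)
  exact absurd (hball hyε) (not_le.2
    (hmono (Set.left_mem_Icc.2 hxy.le) (Set.right_mem_Icc.2 hxy.le) hxy))

/-- The bid distribution functions of an equilibrium on `[b, ∞)`, seen as a flow in the bid.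
By `right_antitone`, a buyer some of whose lower-or-equal bids come from the value `A.value i k` or
a larger one does not gain from raising a bid; by `left_monotone`, a buyer some of whose larger
bids come from `A.value i k` or a smaller value does not gain from lowering a bid. By
`exceptional`, at most one buyer bids `b` with positive probability when the value is above `b`. -/
structure IsFlow (A : FirstPriceAuction n) (b : ℝ) (F : Fin n → ℝ → ℝ) : Prop where
  pos : ∀ i x, b ≤ x → 0 < F i x
  le_one : ∀ i x, b ≤ x → F i x ≤ 1
  mono : ∀ i, MonotoneOn (F i) (Set.Ici b)
  cont : ∀ i, ContinuousOn (F i) (Set.Ici b)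
  valueCDF_le : ∀ i x, b ≤ x → A.valueCDF i x ≤ F i x
  right_antitone : ∀ i k x y, b ≤ x → x ≤ y → A.cumLT i k < F i x →
    (A.value i k - y) * others F i y ≤ (A.value i k - x) * others F i x
  left_monotone : ∀ i k x y, b ≤ x → x ≤ y → F i y < A.cumLE i k →
    (A.value i k - x) * others F i x ≤ (A.value i k - y) * others F i y
  exceptional : ∃ e, ∀ i ≠ e, F i b = A.valueCDF i b

namespace Profile

variable {σ : A.Profile} {i : Fin n} {k : Fin (A.d i)}

lemma continuousOn_others {F : Fin n → ℝ → ℝ} {s : Set ℝ} (h : ∀ i, ContinuousOn (F i) s)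
    (i : Fin n) : ContinuousOn (others F i) s := by
  intro x hx
  exact tendsto_finsetProd (Finset.univ.erase i) fun j _ => h j x hx

namespace IsBNE

/-- Above the bottom, a point is optimal for some value of buyer `j`, or buyer `j` does not bid
near it. -/
lemma optimal_or_eventually_const [NeZero n] (hσ : σ.IsBNE) {x : ℝ} (hx : σ.bottom < x)
    (j : Fin n) : (∃ k, (A.value j k - x) * others σ.bidCDF j x = σ.utility j k) ∨
      ∀ᶠ t in 𝓝 x, σ.bidCDF j t = σ.bidCDF j x := by
  by_contra h
  rw [not_or, not_exists] at h
  obtain ⟨h1, h2⟩ := h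
  apply h2
  have hc : ContinuousAt (others σ.bidCDF j) x :=
    tendsto_finsetProd _ fun l _ => hσ.continuousAt_bidCDF hx l
  have h3 : ∀ᶠ t in 𝓝 x, ∀ k, (A.value j k - t) * others σ.bidCDF j t ≠ σ.utility j k := by
    refine Filter.eventually_all.2 fun k => ?_
    have : ContinuousAt (fun t => (A.value j k - t) * others σ.bidCDF j t) x :=
      (continuousAt_const.sub continuousAt_id).mul hc
    exact this.eventually_ne (h1 k)
  obtain ⟨ε, hε, hball⟩ := Metric.eventually_nhds_iff.1 h3
  -- where no bid is optimal, nobody bids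
  have hnull : ∀ k s t, x - ε < s → s ≤ t → t < x + ε →
      (σ.law j k).real (Set.Iic t) = (σ.law j k).real (Set.Iic s) := by
    intro k s t hs hst ht
    by_contra hne
    have h4 : 0 < (σ.law j k).real (Set.Ioc s t) := by
      rw [← Set.Iic_sdiff_Iic, measureReal_sdiff (Set.Iic_subset_Iic.2 hst) measurableSet_Iic]
      have := measureReal_mono (μ := σ.law j k) (Set.Iic_subset_Iic.2 hst)
      exact sub_pos.2 (lt_of_le_of_ne this (Ne.symm hne))
    obtain ⟨y, hy, -, hyU⟩ := hσ.exists_optimal h4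
    refine hball ?_ k hyU
    rw [Real.dist_eq, abs_lt]
    constructor <;> linarith [hy.1, hy.2]
  filter_upwards [Ioo_mem_nhds (show x - ε < x by linarith) (show x < x + ε by linarith)] with t ht
  refine Finset.sum_congr rfl fun k _ => ?_
  rcases le_total t x with h | h
  · rw [hnull k t x ht.1 h (by linarith)]
  · rw [hnull k x t (by linarith) h ht.2]

/-- The surplus of buyer `i` with any value `v`, whether or not it occurs, is a quasiconcave
function of the bid above the smallest winning bid. At an interior minimum `x`, buyer `i` does not
bid, and the competition grows at the rate `1 / (v - x)`. The growth comes from the buyers `j` for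
whom `x` is optimal, and each of those has a value `w j` that is at least `v`. Adding up their
optimality conditions contradicts `not_isLocalMax_sum_log`. -/
lemma surplus_no_dip [NeZero n] (hσ : σ.IsBNE) (i : Fin n) {v p x q : ℝ} (hp : σ.bottom ≤ p)
    (hpx : p < x) (hxq : x < q)
    (h1 : (v - x) * others σ.bidCDF i x < (v - p) * others σ.bidCDF i p)
    (h2 : (v - x) * others σ.bidCDF i x < (v - q) * others σ.bidCDF i q) : False := by
  set φ : ℝ → ℝ := fun t => (v - t) * others σ.bidCDF i t with hφ
  have hφc : ContinuousOn φ (Set.Icc p q) := by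
    refine ContinuousOn.mul (by fun_prop) ?_
    exact (continuousOn_others hσ.continuousOn_bidCDF i).mono fun t ht => hp.trans ht.1
  obtain ⟨x', hx', hmin⟩ := isCompact_Icc.exists_isMinOn ⟨x, hpx.le, hxq.le⟩ hφc
  have hx'le : φ x' ≤ φ x := hmin ⟨hpx.le, hxq.le⟩
  have h1' : φ x' < φ p := hx'le.trans_lt h1
  have h2' : φ x' < φ q := hx'le.trans_lt h2
  have hpx' : p < x' := lt_of_le_of_ne hx'.1 fun h => by rw [h] at h1'; exact lt_irrefl _ h1'
  have hx'q : x' < q := lt_of_le_of_ne hx'.2 fun h => by rw [h] at h2'; exact lt_irrefl _ h2'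
  clear h1 h2 hx'le hpx hxq x
  rename' x' => x
  have hcx : σ.bottom < x := hp.trans_lt hpx'
  have hc0 := σ.bottom_nonneg
  have hmono := σ.others_bidCDF_mono i
  have hopos := fun j => hσ.others_pos_of_bottom_le hcx.le j
  have hxv : x < v := by
    by_contra hvx
    have h3 := hmono hx'q.le
    have h4 := (hopos i).le
    simp only [hφ] at h2'
    nlinarith
  -- buyer `i` does not bid near the dip, whatever the value
  have hi : ∀ᶠ t in 𝓝 x, σ.bidCDF i t = σ.bidCDF i x := by
    refine (hσ.optimal_or_eventually_const hcx i).resolve_left ?_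
    rintro ⟨k, hk⟩
    have h3 := hσ.surplus_le_utility i k (hc0.trans (hcx.le.trans hx'q.le))
    have h4 := hσ.surplus_le_utility i k (hc0.trans hp)
    have h5 := hmono hx'q.le
    have h6 := hmono hpx'.le
    rw [← hk] at h3 h4
    simp only [hφ] at h1' h2'
    rcases le_total v (A.value i k) with h | h <;> nlinarith
  classical
  set T : Finset (Fin n) := (Finset.univ.erase i).filter
    fun j => ∃ k, (A.value j k - x) * others σ.bidCDF j x = σ.utility j k with hT
  -- each active buyer `j` has a value `w j` for which `x` is optimal
  have hTw : ∀ j, ∃ w : ℝ, j ∈ T → x < w ∧ ∀ t, 0 ≤ t →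
      (w - t) * others σ.bidCDF j t ≤ (w - x) * others σ.bidCDF j x := by
    intro j
    by_cases hj : j ∈ T
    · obtain ⟨k, hk⟩ := (Finset.mem_filter.1 hj).2
      refine ⟨A.value j k, fun _ => ⟨?_, fun t ht => ?_⟩⟩
      · have h3 : σ.bottom < A.value j k := by
          by_contra hle
          have h4 := hσ.utility_nonneg j k
          rw [← hk] at h4
          have := mul_neg_of_neg_of_pos (show A.value j k - x < 0 by linarith) (hopos j)
          linarith
        exact hσ.lt_value_of_optimal h3 hk
      · rw [hk]; exact hσ.surplus_le_utility j k ht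
    · exact ⟨0, fun h => absurd h hj⟩
  choose w hw using hTw
  -- the other buyers do not bid near `x`
  have hconst : ∀ᶠ t in 𝓝 x, ∀ j, j ∉ T → σ.bidCDF j t = σ.bidCDF j x := by
    refine Filter.eventually_all.2 fun j => Filter.eventually_all.2 fun hj => ?_
    by_cases hji : j = i
    · rw [hji]; exact hi
    · refine (hσ.optimal_or_eventually_const hcx j).resolve_left fun hk => hj ?_
      exact Finset.mem_filter.2 ⟨Finset.mem_erase.2 ⟨hji, Finset.mem_univ _⟩, hk⟩
  -- logarithmic coordinates
  set lam : Fin n → ℝ → ℝ := fun j t => Real.log (σ.bidCDF j t) with hlam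
  set Lam : ℝ → ℝ := fun t => ∑ j, lam j t with hLam
  have hlogo : ∀ t, σ.bottom ≤ t → ∀ j, Real.log (others σ.bidCDF j t) = Lam t - lam j t := by
    intro t ht j
    rw [others, Real.log_prod fun l _ => (hσ.bidCDF_pos ht l).ne']
    have := Finset.add_sum_erase Finset.univ (fun l => lam l t) (Finset.mem_univ j)
    simp only [hLam, hlam] at this ⊢
    linarith
  have hlamT : ∀ᶠ t in 𝓝 x, Lam t - Lam x = ∑ j ∈ T, (lam j t - lam j x) := by
    filter_upwards [hconst] with t ht
    rw [hLam, ← Finset.sum_sub_distrib]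
    refine (Finset.sum_subset (Finset.subset_univ T) fun j _ hj => ?_).symm
    rw [hlam]
    simp only [ht j hj, sub_self]
  have hnear : ∀ᶠ t in 𝓝 x, p < t ∧ t < q ∧ t < v ∧ ∀ j ∈ T, t < w j := by
    refine (lt_mem_nhds hpx').and ((gt_mem_nhds hx'q).and ((gt_mem_nhds hxv).and ?_))
    exact Filter.eventually_all.2 fun j => Filter.eventually_all.2 fun hj => gt_mem_nhds (hw j hj).1
  -- the surplus of `i` is minimal at `x`
  have hivt : ∀ᶠ t in 𝓝 x, Lam x - Lam t ≤ Real.log (v - t) - Real.log (v - x) := by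
    filter_upwards [hnear, hi] with t ht hit
    have htc : σ.bottom ≤ t := hp.trans ht.1.le
    have h3 : φ x ≤ φ t := hmin ⟨ht.1.le, ht.2.1.le⟩
    have h4 := Real.log_le_log (mul_pos (sub_pos.2 hxv) (hopos i)) h3
    simp only [hφ] at h4
    rw [Real.log_mul (by linarith) (hopos i).ne', Real.log_mul (by linarith [ht.2.2.1])
      (hσ.others_pos_of_bottom_le htc i).ne', hlogo x hcx.le, hlogo t htc] at h4
    have h5 : lam i t = lam i x := by simp only [hlam, hit]
    linarith
  -- the surplus of `j` with value `w j` is maximal at `x`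
  have hjvt : ∀ᶠ t in 𝓝 x, ∀ j ∈ T, Lam t - lam j t + Real.log (w j - t) ≤
      Lam x - lam j x + Real.log (w j - x) := by
    filter_upwards [hnear] with t ht j hj
    have htc : σ.bottom ≤ t := hp.trans ht.1.le
    have hto := hσ.others_pos_of_bottom_le htc j
    have h4 := Real.log_le_log (mul_pos (sub_pos.2 (ht.2.2.2 j hj)) hto)
      ((hw j hj).2 t (hc0.trans htc))
    rw [Real.log_mul (by linarith [ht.2.2.2 j hj]) hto.ne', Real.log_mul (by linarith [(hw j hj).1])
      (hopos j).ne', hlogo x hcx.le, hlogo t htc] at h4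
    linarith
  -- without active buyers the competition would be constant, and the surplus decreasing
  have hTne : T.Nonempty := by
    by_contra hTe
    rw [Finset.not_nonempty_iff_eq_empty] at hTe
    have hev := (hlamT.and (hivt.and hnear)).filter_mono (nhdsWithin_le_nhds (s := Set.Ioi x))
    obtain ⟨t, ⟨h3, h4, h5⟩, hxt⟩ := (hev.and self_mem_nhdsWithin).exists
    rw [hTe, Finset.sum_empty] at h3
    have hxt : x < t := hxt
    have := Real.log_lt_log (show 0 < v - t by linarith [h5.2.2.1]) (show v - t < v - x by linarith)
    linarith
  -- when the bid goes down from `x`, the competition of `i` falls at least as fast as that of `j`,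
  -- but lowering the bid pays for `i` and not for `j`
  have hwv : ∀ j ∈ T, v ≤ w j := by
    intro j hj
    have hev := (hivt.and (hjvt.and hnear)).filter_mono (nhdsWithin_le_nhds (s := Set.Iio x))
    obtain ⟨t, ⟨h3, h4, h5⟩, htx⟩ := (hev.and self_mem_nhdsWithin).exists
    have htx : t < x := htx
    have h6 : lam j t ≤ lam j x := Real.log_le_log (hσ.bidCDF_pos (hp.trans h5.1.le) j)
      (σ.bidCDF_mono j htx.le)
    have h7 := h4 j hj
    have h8 := (hw j hj).1
    have h9 : Real.log (w j - t) + Real.log (v - x) ≤ Real.log (v - t) + Real.log (w j - x) := by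
      linarith
    rw [← Real.log_mul (by linarith) (by linarith), ← Real.log_mul (by linarith [h5.2.2.1])
      (by linarith)] at h9
    have h10 := (Real.log_le_log_iff (mul_pos (by linarith) (by linarith))
      (mul_pos (by linarith [h5.2.2.1]) (by linarith))).1 h9
    by_contra hlt
    nlinarith
  refine not_isLocalMax_sum_log T hxv hwv ?_
  filter_upwards [hlamT, hivt, hjvt] with t h3 h4 h5
  have h6 := Finset.sum_le_sum h5
  simp only [Finset.sum_add_distrib, Finset.sum_sub_distrib, Finset.sum_const, nsmul_eq_mul] at h6
  rw [Finset.sum_sub_distrib] at h3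
  have h7 : (1 : ℝ) ≤ T.card := by exact_mod_cast Finset.card_pos.2 hTne
  nlinarith

/-- The bid distribution functions of an equilibrium form a flow above the smallest winning bid. -/
lemma isFlow [NeZero n] (hσ : σ.IsBNE) : A.IsFlow σ.bottom σ.bidCDF where
  pos i x hx := hσ.bidCDF_pos hx i
  le_one i x _ := σ.bidCDF_le_one i x
  mono i := (σ.bidCDF_mono i).monotoneOn _
  cont := hσ.continuousOn_bidCDF
  valueCDF_le i x _ := σ.valueCDF_le_bidCDF i x
  exceptional := hσ.exists_exceptional
  right_antitone i k x y hx hxy hk := by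
    have hmono := σ.others_bidCDF_mono i
    obtain ⟨l, hkl, hl⟩ : ∃ l, k ≤ l ∧ 0 < (σ.law i l).real (Set.Iic x) := by
      by_contra! h
      refine absurd hk (not_lt.2 (Finset.sum_le_sum fun l _ => ?_))
      split_ifs with hlk
      · exact mul_le_of_le_one_right (A.prob_pos i l).le measureReal_le_one
      · rw [le_antisymm (h l (not_lt.1 hlk)) measureReal_nonneg, mul_zero]
    have hkl' := (A.value_strictMono i).monotone hkl
    rcases le_or_gt (A.value i l) σ.bottom with hlb | hlb
    · have h1 := hmono hxy
      have h2 := σ.others_bidCDF_nonneg i x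
      nlinarith
    have h1 : 0 < (σ.law i l).real (Set.Iic x \ Set.Iio σ.bottom) := by
      rw [measureReal_sdiff (Set.Iio_subset_Iic_self.trans (Set.Iic_subset_Iic.2 hx))
        measurableSet_Iio,
        hσ.law_Iio_bottom hlb, sub_zero]
      exact hl
    obtain ⟨p, ⟨hpx, hpc⟩, hp0, hpU⟩ := hσ.exists_optimal h1
    have hpx : p ≤ x := hpx
    have hpc : σ.bottom ≤ p := not_lt.1 hpc
    -- the bid `p` is optimal for the value `l ≥ k`, so for `k` it is no worse than the larger
    -- bid `y`
    have h2 : (A.value i k - y) * others σ.bidCDF i y ≤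
        (A.value i k - p) * others σ.bidCDF i p := by
      have h3 := hσ.surplus_le_utility i l (hp0.trans (hpx.trans hxy))
      rw [← hpU] at h3
      have h4 := hmono (hpx.trans hxy)
      nlinarith
    by_contra! hlt
    rcases hpx.eq_or_lt with h | hpx
    · rw [h] at h2; linarith
    rcases hxy.eq_or_lt with h | hxy
    · rw [h] at hlt; exact lt_irrefl _ hlt
    exact hσ.surplus_no_dip i hpc hpx hxy (hlt.trans_le h2) hlt
  left_monotone i k x y hx hxy hk := by
    have hmono := σ.others_bidCDF_mono i
    obtain ⟨l, hkl, hl⟩ : ∃ l, l ≤ k ∧ (σ.law i l).real (Set.Iic y) < 1 := by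
      by_contra! h
      refine absurd hk (not_lt.2 (Finset.sum_le_sum fun l _ => ?_))
      split_ifs with hlk
      · rw [le_antisymm measureReal_le_one (h l hlk), mul_one]
      · exact mul_nonneg (A.prob_pos i l).le measureReal_nonneg
    have hkl' := (A.value_strictMono i).monotone hkl
    have h1 : 0 < (σ.law i l).real (Set.Ioi y) := by
      rw [← Set.compl_Iic, measureReal_compl measurableSet_Iic, probReal_univ]
      linarith
    obtain ⟨q, hyq, hq0, hqU⟩ := hσ.exists_optimal h1
    have hyq : y < q := hyq
    have h2 : (A.value i k - x) * others σ.bidCDF i x ≤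
        (A.value i k - q) * others σ.bidCDF i q := by
      have h3 := hσ.surplus_le_utility i l (σ.bottom_nonneg.trans hx)
      rw [← hqU] at h3
      have h4 := hmono (hxy.trans hyq.le)
      nlinarith
    by_contra! hlt
    rcases hxy.eq_or_lt with h | hxy
    · rw [h] at hlt; exact lt_irrefl _ hlt
    exact hσ.surplus_no_dip i hx hxy hyq hlt (hlt.trans_le h2)

/-- Larger values bid more: above the smallest winning bid, if some value of buyer `i` bids more
than `x`, then no larger value bids `x` or less. -/
lemma law_Iic_eq_zero_of_lt [NeZero n] (hσ : σ.IsBNE) {i : Fin n} {k l : Fin (A.d i)} (hkl : k < l)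
    {x : ℝ} (hx : σ.bottom ≤ x) (hk : (σ.law i k).real (Set.Iic x) < 1) :
    (σ.law i l).real (Set.Iic x) = 0 := by
  have hkl' := A.value_strictMono i hkl
  have h1 : 0 < (σ.law i k).real (Set.Ioi x) := by
    rw [← Set.compl_Iic, measureReal_compl measurableSet_Iic, probReal_univ]
    linarith
  have hkb : σ.bottom < A.value i k := by
    by_contra h
    have := σ.law_Iic_eq_one ((not_lt.1 h).trans hx)
    linarith
  by_contra hne
  have h2 : 0 < (σ.law i l).real (Set.Iic x \ Set.Iio σ.bottom) := by
    rw [measureReal_sdiff (Set.Iio_subset_Iic_self.trans (Set.Iic_subset_Iic.2 hx))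
        measurableSet_Iio,
      hσ.law_Iio_bottom (hkb.trans hkl'), sub_zero]
    exact lt_of_le_of_ne measureReal_nonneg (Ne.symm hne)
  obtain ⟨q, hq, hq0, hqU⟩ := hσ.exists_optimal h1
  obtain ⟨p, ⟨hpx, hpc⟩, hp0, hpU⟩ := hσ.exists_optimal h2
  have hpx : p ≤ x := hpx
  have hq : x < q := hq
  have hpc : σ.bottom ≤ p := not_lt.1 hpc
  have h3 := hσ.surplus_le_utility i k hp0
  have h4 := hσ.surplus_le_utility i l hq0
  rw [← hqU] at h3
  rw [← hpU] at h4
  have h5 := σ.others_bidCDF_mono i (hpx.trans hq.le)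
  have h6 := hσ.others_pos_of_bottom_le hpc i
  have h7 := hσ.lt_value_of_optimal hkb hqU
  nlinarith [mul_pos (show 0 < q - p by linarith) h6]

/-- Since larger values bid more, the bid distribution function of a buyer determines the law of the
bids for each value. -/
lemma law_Iic_le_of_bidCDF_eq [NeZero n] {τ : A.Profile} (hσ : σ.IsBNE) (hτ : τ.IsBNE) {i : Fin n}
    {x : ℝ} (hxσ : σ.bottom ≤ x) (hxτ : τ.bottom ≤ x) (h : σ.bidCDF i x = τ.bidCDF i x)
    (k : Fin (A.d i)) : (σ.law i k).real (Set.Iic x) ≤ (τ.law i k).real (Set.Iic x) := by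
  by_contra! hlt
  have h1 : (τ.law i k).real (Set.Iic x) < 1 := hlt.trans_le measureReal_le_one
  refine absurd h (ne_of_gt (Finset.sum_lt_sum (fun l _ => ?_) ⟨k, Finset.mem_univ _,
    mul_lt_mul_of_pos_left hlt (A.prob_pos i k)⟩))
  refine mul_le_mul_of_nonneg_left ?_ (A.prob_pos i l).le
  rcases lt_trichotomy l k with hl | hl | hl
  · by_contra! hl'
    have := hσ.law_Iic_eq_zero_of_lt hl hxσ (hl'.trans_le measureReal_le_one)
    have h0 : 0 ≤ (τ.law i k).real (Set.Iic x) := measureReal_nonneg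
    linarith
  · rw [hl]; exact hlt.le
  · rw [hτ.law_Iic_eq_zero_of_lt hl hxτ h1]
    exact measureReal_nonneg

lemma law_restrict_eq [NeZero n] {τ : A.Profile} (hσ : σ.IsBNE) (hτ : τ.IsBNE) {b : ℝ}
    (hbσ : σ.bottom = b) (hbτ : τ.bottom = b) {i : Fin n}
    (h : ∀ x, b ≤ x → σ.bidCDF i x = τ.bidCDF i x) (k : Fin (A.d i)) :
    (σ.law i k).restrict (Set.Ioi b) = (τ.law i k).restrict (Set.Ioi b) := by
  have hIic : ∀ x, b ≤ x → (σ.law i k).real (Set.Iic x) = (τ.law i k).real (Set.Iic x) :=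
    fun x hx => le_antisymm
      (hσ.law_Iic_le_of_bidCDF_eq hτ (hbσ.trans_le hx) (hbτ.trans_le hx) (h x hx) k)
      (hτ.law_Iic_le_of_bidCDF_eq hσ (hbτ.trans_le hx) (hbσ.trans_le hx) (h x hx).symm k)
  refine Measure.ext_of_Iic _ _ fun x => ?_
  rw [Measure.restrict_apply measurableSet_Iic, Measure.restrict_apply measurableSet_Iic]
  have : Set.Iic x ∩ Set.Ioi b = Set.Iic (max x b) \ Set.Iic b := by
    ext t
    simp only [Set.mem_inter_iff, Set.mem_Iic, Set.mem_Ioi, Set.mem_sdiff, le_max_iff, not_le]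
    constructor
    · exact fun h => ⟨Or.inl h.1, h.2⟩
    · rintro ⟨h | h, h'⟩
      · exact ⟨h, h'⟩
      · linarith
  rw [this, ← measureReal_eq_measureReal_iff,
    measureReal_sdiff (Set.Iic_subset_Iic.2 (le_max_right x b)) measurableSet_Iic,
    measureReal_sdiff (Set.Iic_subset_Iic.2 (le_max_right x b)) measurableSet_Iic,
    hIic b le_rfl, hIic _ (le_max_right x b)]

end IsBNE
end Profile

/-! ### Uniqueness of the flow -/

lemma exists_cumLT_lt_le (i : Fin n) {s : ℝ} (h0 : 0 < s) (h1 : s ≤ 1) :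
    ∃ k, A.cumLT i k < s ∧ s ≤ A.cumLE i k := by
  have hne : (Finset.univ.filter fun k => A.cumLT i k < s).Nonempty := by
    refine ⟨⟨0, A.d_pos i⟩, Finset.mem_filter.2 ⟨Finset.mem_univ _, ?_⟩⟩
    have : A.cumLT i ⟨0, A.d_pos i⟩ = 0 :=
      Finset.sum_eq_zero fun l _ => if_neg (Nat.not_lt_zero _)
    rw [this]; exact h0
  obtain ⟨k, hk, hmax⟩ := Finset.exists_max_image _ id hne
  refine ⟨k, (Finset.mem_filter.1 hk).2, ?_⟩
  by_contra! hlt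
  by_cases hlast : (k : ℕ) + 1 < A.d i
  · have h2 : A.cumLT i ⟨k + 1, hlast⟩ = A.cumLE i k := by
      refine Finset.sum_congr rfl fun l _ => ?_
      have : l < ⟨k + 1, hlast⟩ ↔ l ≤ k := by
        rw [Fin.lt_def, Fin.le_def]; exact Nat.lt_succ_iff
      simp only [this]
    have h3 := hmax ⟨k + 1, hlast⟩ (Finset.mem_filter.2 ⟨Finset.mem_univ _, by rw [h2]; exact hlt⟩)
    simp only [id, Fin.le_def] at h3
    omega
  · have h2 : A.cumLE i k = 1 := by
      rw [← A.prob_sum i]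
      refine Finset.sum_congr rfl fun l _ => if_pos ?_
      rw [Fin.le_def]
      have := l.2
      omega
    linarith

/-- The value index of buyer `i` is monotone in the quantile. -/
lemma index_le_of_cum {i : Fin n} {k l : Fin (A.d i)} {s t : ℝ} (hst : s ≤ t)
    (hk : A.cumLT i k < s) (hl : t ≤ A.cumLE i l) : k ≤ l := by
  by_contra! h
  linarith [cumLE_le_cumLT h]

lemma exists_cumLE_eq_one (A : FirstPriceAuction n) (i : Fin n) :
    ∃ k, A.cumLE i k = 1 ∧ ∀ l, l ≤ k := by
  have h : A.d i - 1 < A.d i := Nat.sub_lt (A.d_pos i) one_pos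
  have hle : ∀ l : Fin (A.d i), l ≤ ⟨A.d i - 1, h⟩ := fun l => by
    rw [Fin.le_def]; have := l.2; simp only; omega
  refine ⟨⟨A.d i - 1, h⟩, ?_, hle⟩
  rw [← A.prob_sum i]
  exact Finset.sum_congr rfl fun l _ => if_pos (hle l)

/-- The growth factor of a product whose factors grow by `max 1 (g * β i)`, where `g` is the growth
of the whole product, is antitone in `β`. -/
lemma growth_le_growth {ι : Type*} [Fintype ι] {β β' : ι → ℝ} {g g' : ℝ}
    (h0 : ∀ i, 0 ≤ β i) (hβ : ∀ i, β' i ≤ β i) (h1 : ∀ i, β i < 1) (hg : g = ∏ i, max 1 (g * β i))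
    (hg' : g' = ∏ i, max 1 (g' * β' i)) (hg'1 : 1 < g') : g ≤ g' := by
  classical
  by_contra! hlt
  have hg0 : 0 < g' := by linarith
  set T := Finset.univ.filter fun i => 1 < g' * β i with hT
  have hle : g' ≤ ∏ i ∈ T, g' * β i := by
    calc g' = ∏ i, max 1 (g' * β' i) := hg'
      _ ≤ ∏ i, max 1 (g' * β i) := Finset.prod_le_prod (fun i _ => by positivity) fun i _ =>
          max_le_max_left _ (mul_le_mul_of_nonneg_left (hβ i) hg0.le)
      _ = ∏ i ∈ T, max 1 (g' * β i) := by
          refine (Finset.prod_subset (Finset.subset_univ T) fun i _ hi => ?_).symm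
          simp only [hT, Finset.mem_filter, Finset.mem_univ, true_and, not_lt] at hi
          exact max_eq_left hi
      _ = ∏ i ∈ T, g' * β i := Finset.prod_congr rfl fun i hi =>
          max_eq_right (Finset.mem_filter.1 hi).2.le
  have hge : (g / g') ^ T.card * g' ≤ g := by
    calc (g / g') ^ T.card * g' ≤ (g / g') ^ T.card * ∏ i ∈ T, g' * β i :=
          mul_le_mul_of_nonneg_left hle (pow_nonneg (div_nonneg (by linarith) hg0.le) _)
      _ = ∏ i ∈ T, g * β i := by
          rw [← Finset.prod_const, ← Finset.prod_mul_distrib]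
          exact Finset.prod_congr rfl fun i _ => by field_simp
      _ ≤ ∏ i ∈ T, max 1 (g * β i) := Finset.prod_le_prod
          (fun i _ => mul_nonneg (by linarith) (h0 i)) fun i _ => le_max_right _ _
      _ ≤ ∏ i, max 1 (g * β i) := by
          rw [← Finset.prod_mul_prod_compl T]
          exact le_mul_of_one_le_right (Finset.prod_nonneg fun i _ => by positivity)
            (Finset.one_le_prod fun i _ => le_max_left _ _)
      _ = g := hg.symm
  have hr : 1 < g / g' := (one_lt_div hg0).2 hlt
  -- a single growing factor would be smaller than the product, as `β i < 1`
  have hcard : 2 ≤ T.card := by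
    by_contra! hc
    interval_cases hcT : T.card
    · rw [Finset.card_eq_zero.1 hcT, Finset.prod_empty] at hle
      linarith
    · obtain ⟨i, hi⟩ := Finset.card_eq_one.1 hcT
      rw [hi, Finset.prod_singleton] at hle
      nlinarith [h1 i]
  have h2 : (g / g') ^ 2 ≤ (g / g') ^ T.card := pow_le_pow_right₀ hr.le hcard
  have h3 : (g / g') ^ 2 * g' = g * (g / g') := by field_simp
  nlinarith

/-- The factor by which the margin `w - x` of a buyer with value `w` shrinks when the bid is raised
from `x` to `z`, or `0` if the value is at most `z`. -/
def surplusRatio (z w x : ℝ) : ℝ := if z < w then (w - z) / (w - x) else 0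

lemma surplusRatio_nonneg {z w x : ℝ} (hx : x < z) : 0 ≤ surplusRatio z w x := by
  unfold surplusRatio
  split_ifs with h
  · exact div_nonneg (by linarith) (by linarith)
  · exact le_rfl

lemma surplusRatio_lt_one {z w x : ℝ} (hx : x < z) : surplusRatio z w x < 1 := by
  unfold surplusRatio
  split_ifs with h
  · rw [div_lt_one (by linarith)]; linarith
  · exact one_pos

lemma surplusRatio_mono {z w w' x : ℝ} (hx : x < z) (hw : w' ≤ w) :
    surplusRatio z w' x ≤ surplusRatio z w x := by
  by_cases h : z < w'
  · rw [surplusRatio, surplusRatio, if_pos h, if_pos (h.trans_le hw),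
      div_le_div_iff₀ (by linarith) (by linarith)]
    nlinarith
  · rw [surplusRatio, if_neg h]
    exact surplusRatio_nonneg hx

namespace IsFlow

variable {b : ℝ} {F F' : Fin n → ℝ → ℝ}

lemma others_pos (hF : A.IsFlow b F) {x : ℝ} (hx : b ≤ x) (i : Fin n) : 0 < others F i x :=
  FirstPriceAuction.others_pos fun j _ => hF.pos j x hx

lemma prod_pos (hF : A.IsFlow b F) {x : ℝ} (hx : b ≤ x) : 0 < ∏ i, F i x :=
  Finset.prod_pos fun i _ => hF.pos i x hx

/-- The competition that a buyer faces is strictly increasing as long as the buyer still bids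
more. -/
lemma others_lt (hF : A.IsFlow b F) {x y : ℝ} (hx : b ≤ x) (hxy : x < y) {i : Fin n}
    (hi : F i y < 1) : others F i x < others F i y := by
  obtain ⟨k, hk, hkl⟩ := exists_cumLE_eq_one A i
  have h1 := hF.left_monotone i k x y hx hxy.le (by rw [hk]; exact hi)
  have hv : y < A.value i k := by
    by_contra! hle
    have := hF.valueCDF_le i y (hx.trans hxy.le)
    rw [valueCDF_eq_one fun l => ((A.value_strictMono i).monotone (hkl l)).trans hle] at this
    linarith
  have h2 := hF.others_pos hx i
  by_contra! h3
  nlinarith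

/-- The growth of the bid distribution functions on a short interval to the left of `z` is given
by the surplus ratios of the values at the quantiles `F i z`: either buyer `i` bids in the interval
and is indifferent, or `F i` is constant on it. -/
lemma eventually_growth (hF : A.IsFlow b F) {z : ℝ} (hz : b < z) {i : Fin n} {k : Fin (A.d i)}
    (hk1 : A.cumLT i k < F i z) (hk2 : F i z ≤ A.cumLE i k) : ∀ᶠ x in 𝓝[<] z,
      F i z / F i x = max 1 ((∏ j, F j z) / (∏ j, F j x) * surplusRatio z (A.value i k) x) := by
  have hIoo : ∀ᶠ x in 𝓝[<] z, x ∈ Set.Ioo b z := Ioo_mem_nhdsLT hz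
  have hcont : Filter.Tendsto (F i) (𝓝[<] z) (𝓝 (F i z)) := by
    refine ((hF.cont i).continuousAt (Ici_mem_nhds hz)).tendsto.mono_left nhdsWithin_le_nhds
  have hright : ∀ᶠ x in 𝓝[<] z, A.cumLT i k < F i x := hcont.eventually (lt_mem_nhds hk1)
  have hoc : Filter.Tendsto (fun y => (A.value i k - y) * others F i y) (𝓝[<] z)
      (𝓝 ((A.value i k - z) * others F i z)) := by
    have h1 : ContinuousAt (fun y => (A.value i k - y) * others F i y) z := by
      refine (continuousAt_const.sub continuousAt_id).mul ?_
      exact tendsto_finsetProd _ fun j _ => ((hF.cont j).continuousAt (Ici_mem_nhds hz)).tendsto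
    exact h1.tendsto.mono_left nhdsWithin_le_nhds
  have hdich : ∀ᶠ x in 𝓝[<] z, F i x = F i z ∨
      (A.value i k - x) * others F i x ≤ (A.value i k - z) * others F i z := by
    by_cases h : ∃ y, b ≤ y ∧ y < z ∧ F i z ≤ F i y
    · obtain ⟨y, hby, hyz, hy⟩ := h
      filter_upwards [Ioo_mem_nhdsLT hyz] with x hx
      left
      have hbx := hby.trans hx.1.le
      exact le_antisymm (hF.mono i hbx hz.le hx.2.le) (hy.trans (hF.mono i hby hbx hx.1.le))
    · push Not at h
      filter_upwards [hIoo] with x hx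
      right
      refine ge_of_tendsto hoc ?_
      filter_upwards [Ioo_mem_nhdsLT hx.2] with y hy
      exact hF.left_monotone i k x y hx.1.le hy.1.le
        ((h y (hx.1.le.trans hy.1.le) hy.2).trans_le hk2)
  have hval : ∀ᶠ x in 𝓝[<] z, A.value i k < z → A.value i k < x := by
    refine Filter.eventually_all.2 fun h => ?_
    filter_upwards [Ioo_mem_nhdsLT h] with x hx using hx.1
  filter_upwards [hIoo, hright, hdich, hval] with x hx hr hd hv
  have hFx := hF.pos i x hx.1.le
  have hFz := hF.pos i z hz.le
  have hox := hF.others_pos hx.1.le i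
  have hoz := hF.others_pos hz.le i
  have hone : 1 ≤ F i z / F i x := (one_le_div hFx).2 (hF.mono i hx.1.le hz.le hx.2.le)
  have hr := hF.right_antitone i k x z hx.1.le hx.2.le hr
  rw [← others_mul i z, ← others_mul i x]
  unfold surplusRatio
  split_ifs with hw
  · have hwz : 0 < A.value i k - z := by linarith
    have hwx : 0 < A.value i k - x := by linarith [hx.2]
    have he : F i z * others F i z / (F i x * others F i x) *
        ((A.value i k - z) / (A.value i k - x)) = F i z / F i x *
        (((A.value i k - z) * others F i z) / ((A.value i k - x) * others F i x)) := by
      field_simp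
    rw [he]
    have hle : ((A.value i k - z) * others F i z) / ((A.value i k - x) * others F i x) ≤ 1 :=
      (div_le_one (by positivity)).2 hr
    rcases hd with hd | hd
    · rw [hd, div_self hFz.ne', one_mul, max_eq_left hle]
    · have : ((A.value i k - z) * others F i z) / ((A.value i k - x) * others F i x) = 1 := by
        rw [le_antisymm hr hd, div_self (by positivity)]
      rw [this, mul_one, max_eq_right hone]
  · rw [mul_zero, max_eq_left zero_le_one]
    rcases hd with hd | hd
    · rw [hd, div_self hFz.ne']
    · rcases (not_lt.1 hw).eq_or_lt with h | h
      · rw [h, sub_self, zero_mul] at hd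
        have := mul_pos (show 0 < z - x by linarith [hx.2]) hox
        linarith
      · have h1 := hF.valueCDF_le i x hx.1.le
        have h2 := cumLE_le_valueCDF (hv h).le
        have h3 : F i x = F i z :=
          le_antisymm (hF.mono i hx.1.le hz.le hx.2.le) (hk2.trans (h2.trans h1))
        rw [h3, div_self hFz.ne']

/-- One step of the comparison of two flows, to the left of a point `z` where they are ordered:
they stay ordered, and the competition grows at least as fast in the smaller one. -/
lemma eventually_compare (hF : A.IsFlow b F) (hF' : A.IsFlow b F') {z : ℝ} (hz : b < z)
    (hle : ∀ i, F' i z ≤ F i z) (hactive : ∀ y, b ≤ y → y < z → ∃ i, F' i y < 1) :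
    ∀ᶠ x in 𝓝[<] z, (∀ i, F' i x ≤ F i x) ∧
      ∀ i, others F i z * others F' i x ≤ others F i x * others F' i z := by
  choose k hk1 hk2 using fun i => exists_cumLT_lt_le (A := A) i (hF.pos i z hz.le)
    (hF.le_one i z hz.le)
  choose k' hk1' hk2' using fun i => exists_cumLT_lt_le (A := A) i (hF'.pos i z hz.le)
    (hF'.le_one i z hz.le)
  have hkk : ∀ i, k' i ≤ k i := fun i => index_le_of_cum (hle i) (hk1' i) (hk2 i)
  have hg := Filter.eventually_all.2 fun i => hF.eventually_growth hz (hk1 i) (hk2 i)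
  have hg' := Filter.eventually_all.2 fun i => hF'.eventually_growth hz (hk1' i) (hk2' i)
  -- a strict order at `z` persists near `z` by continuity; only equalities need the growth factors
  have hstrict : ∀ᶠ x in 𝓝[<] z, ∀ i, F' i z < F i z → F' i x ≤ F i x := by
    refine Filter.eventually_all.2 fun i => Filter.eventually_all.2 fun hi => ?_
    have h1 : ContinuousAt (F i) z := (hF.cont i).continuousAt (Ici_mem_nhds hz)
    have h2 : ContinuousAt (F' i) z := (hF'.cont i).continuousAt (Ici_mem_nhds hz)
    have h3 : ∀ᶠ x in 𝓝 z, F' i x < F i x := h2.tendsto.eventually_lt h1.tendsto hi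
    exact (h3.filter_mono nhdsWithin_le_nhds).mono fun x hx => hx.le
  filter_upwards [hg, hg', hstrict, Ioo_mem_nhdsLT hz] with x hgx hgx' hs hx
  have hbx := hx.1.le
  set g := (∏ j, F j z) / ∏ j, F j x with hgdef
  set g' := (∏ j, F' j z) / ∏ j, F' j x with hgdef'
  have hg1 : g = ∏ i, max 1 (g * surplusRatio z (A.value i (k i)) x) := by
    rw [← Finset.prod_congr rfl fun i _ => hgx i, Finset.prod_div_distrib]
  have hg1' : g' = ∏ i, max 1 (g' * surplusRatio z (A.value i (k' i)) x) := by
    rw [← Finset.prod_congr rfl fun i _ => hgx' i, Finset.prod_div_distrib]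
  have hg'one : 1 < g' := by
    rw [hgdef', one_lt_div (hF'.prod_pos hbx)]
    obtain ⟨y, hxy, hyz⟩ := exists_between hx.2
    obtain ⟨i, hi⟩ := hactive y (hbx.trans hxy.le) hyz
    have h1 := hF'.others_lt hbx hxy hi
    have hby := hbx.trans hxy.le
    calc ∏ j, F' j x = F' i x * others F' i x := (others_mul i x).symm
      _ < F' i y * others F' i y := by
          refine mul_lt_mul' (hF'.mono i hbx hby hxy.le) h1 (hF'.others_pos hbx i).le
            (hF'.pos i y hby)
      _ = ∏ j, F' j y := others_mul i y
      _ ≤ ∏ j, F' j z := Finset.prod_le_prod (fun j _ => (hF'.pos j y hby).le)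
          fun j _ => hF'.mono j hby hz.le hyz.le
  have hβ : ∀ i, surplusRatio z (A.value i (k' i)) x ≤ surplusRatio z (A.value i (k i)) x :=
    fun i => surplusRatio_mono hx.2 ((A.value_strictMono i).monotone (hkk i))
  have hβ0 : ∀ w, 0 ≤ surplusRatio z w x := fun w => surplusRatio_nonneg hx.2
  have hgg := growth_le_growth (fun i => hβ0 _) hβ (fun i => surplusRatio_lt_one hx.2) hg1 hg1'
    hg'one
  have hg0 : 0 < g := div_pos (hF.prod_pos hz.le) (hF.prod_pos hbx)
  refine ⟨fun i => ?_, fun i => ?_⟩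
  · rcases (hle i).eq_or_lt with heq | hlt
    · have hkk' : k i = k' i :=
        le_antisymm (index_le_of_cum heq.symm.le (hk1 i) (hk2' i)) (hkk i)
      have h1 : F i z / F i x ≤ F' i z / F' i x := by
        rw [hgx i, hgx' i, hkk']
        exact max_le_max_left _ (mul_le_mul_of_nonneg_right hgg (hβ0 _))
      rw [heq] at h1
      have hp := hF.pos i z hz.le
      exact (div_le_div_iff_of_pos_left hp (hF.pos i x hbx) (hF'.pos i x hbx)).1 h1
    · exact hs i hlt
  · have hx0 := hF.pos i x hbx
    have hx0' := hF'.pos i x hbx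
    have hz0 := hF.pos i z hz.le
    have hz0' := hF'.pos i z hz.le
    have hox := hF.others_pos hbx i
    have hox' := hF'.others_pos hbx i
    have hoz := hF.others_pos hz.le i
    have hoz' := hF'.others_pos hz.le i
    have h1 : g * (F' i z / F' i x) ≤ g' * (F i z / F i x) := by
      rw [hgx i, hgx' i, mul_max_of_nonneg _ _ hg0.le, mul_max_of_nonneg _ _ (by linarith)]
      refine max_le_max (by linarith) ?_
      have := mul_le_mul_of_nonneg_left (hβ i) (mul_pos hg0 (show 0 < g' by linarith)).le
      linarith
    rw [hgdef, hgdef', ← others_mul i z, ← others_mul i x, ← others_mul (F := F') i z,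
      ← others_mul (F := F') i x] at h1
    have h2 : F i z * others F i z / (F i x * others F i x) * (F' i z / F' i x) =
        (F i z * F' i z / (F i x * F' i x)) * (others F i z / others F i x) := by field_simp
    have h3 : F' i z * others F' i z / (F' i x * others F' i x) * (F i z / F i x) =
        (F i z * F' i z / (F i x * F' i x)) * (others F' i z / others F' i x) := by field_simp
    rw [h2, h3] at h1
    have h4 := le_of_mul_le_mul_left h1 (by positivity)
    rw [div_le_div_iff₀ hox hox'] at h4
    linarith

/-- Comparison principle: if `F` reaches `1` no later than `F'`, then an order `F' ≤ F` at `y`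
propagates to the left, and the ratio of the competitions is antitone. -/
lemma compare (hF : A.IsFlow b F) (hF' : A.IsFlow b F')
    (hone : ∀ x, b ≤ x → (∀ i, F' i x = 1) → ∀ i, F i x = 1) {x y : ℝ} (hx : b ≤ x) (hxy : x ≤ y)
    (hle : ∀ i, F' i y ≤ F i y) : (∀ i, F' i x ≤ F i x) ∧
      ∀ i, others F i y * others F' i x ≤ others F i x * others F' i y := by
  set s : Set ℝ := {t | t ∈ Set.Icc x y ∧ ((∀ i, F' i t ≤ F i t) ∧
      ∀ i, others F i y * others F' i t ≤ others F i t * others F' i y)} with hs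
  have hsub : Set.Icc x y ⊆ Set.Ici b := fun t ht => hx.trans ht.1
  have hoc : ∀ i, ContinuousOn (others F i) (Set.Icc x y) := fun i =>
    (Profile.continuousOn_others hF.cont i).mono hsub
  have hoc' : ∀ i, ContinuousOn (others F' i) (Set.Icc x y) := fun i =>
    (Profile.continuousOn_others hF'.cont i).mono hsub
  have hclosed : IsClosed s := by
    have : s = (⋂ i, {t ∈ Set.Icc x y | F' i t ≤ F i t}) ∩ (Set.Icc x y ∩
        ⋂ i, {t ∈ Set.Icc x y |
          others F i y * others F' i t ≤ others F i t * others F' i y}) := by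
      ext t
      simp only [hs, Set.mem_ofPred_eq, Set.mem_inter_iff, Set.mem_iInter]
      constructor
      · rintro ⟨h1, h2, h3⟩
        exact ⟨fun i => ⟨h1, h2 i⟩, h1, fun i => ⟨h1, h3 i⟩⟩
      · rintro ⟨h1, h2, h3⟩
        exact ⟨h2, fun i => (h1 i).2, fun i => (h3 i).2⟩
    rw [this]
    refine (isClosed_iInter fun i => ?_).inter (isClosed_Icc.inter (isClosed_iInter fun i => ?_))
    · exact isClosed_Icc.isClosed_le ((hF'.cont i).mono hsub) ((hF.cont i).mono hsub)
    · exact isClosed_Icc.isClosed_le (continuousOn_const.mul (hoc' i))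
        ((hoc i).mul continuousOn_const)
  have hys : y ∈ s := ⟨⟨hxy, le_rfl⟩, hle, fun i => le_rfl⟩
  have hbdd : BddBelow s := ⟨x, fun t ht => ht.1.1⟩
  obtain ⟨hzI, hz⟩ := hclosed.csInf_mem ⟨y, hys⟩ hbdd
  set z := sInf s with hzdef
  rcases hzI.1.eq_or_lt with heq | hlt
  · rw [heq]; exact hz
  exfalso
  have hbz := hx.trans_lt hlt
  have hstep : ∀ᶠ t in 𝓝[<] z, (∀ i, F' i t ≤ F i t) ∧
      ∀ i, others F i z * others F' i t ≤ others F i t * others F' i z := by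
    by_cases hact : ∀ t, b ≤ t → t < z → ∃ i, F' i t < 1
    · exact hF.eventually_compare hF' hbz hz.1 hact
    · push Not at hact
      obtain ⟨t, hbt, htz, ht⟩ := hact
      have h1' : ∀ i, F' i t = 1 := fun i => le_antisymm (hF'.le_one i t hbt) (ht i)
      have h1 := hone t hbt h1'
      have h2 : ∀ u, t ≤ u → ∀ i, F i u = 1 := fun u hu i => le_antisymm
        (hF.le_one i u (hbt.trans hu)) ((h1 i).symm.le.trans (hF.mono i hbt (hbt.trans hu) hu))
      have h2' : ∀ u, t ≤ u → ∀ i, F' i u = 1 := fun u hu i => le_antisymm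
        (hF'.le_one i u (hbt.trans hu)) ((h1' i).symm.le.trans (hF'.mono i hbt (hbt.trans hu) hu))
      have ho : ∀ u, t ≤ u → ∀ i, others F i u = 1 := fun u hu i =>
        Finset.prod_eq_one fun j _ => h2 u hu j
      have ho' : ∀ u, t ≤ u → ∀ i, others F' i u = 1 := fun u hu i =>
        Finset.prod_eq_one fun j _ => h2' u hu j
      filter_upwards [Ioo_mem_nhdsLT htz] with u hu
      refine ⟨fun i => by rw [h2 u hu.1.le, h2' u hu.1.le], fun i => le_of_eq ?_⟩
      rw [ho u hu.1.le, ho' u hu.1.le, ho z htz.le, ho' z htz.le]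
  obtain ⟨t, ht, htI⟩ := (hstep.and (Ioo_mem_nhdsLT hlt)).exists
  have hts : t ∈ s := by
    refine ⟨⟨htI.1.le, htI.2.le.trans hzI.2⟩, ht.1, fun i => ?_⟩
    have h1 := hz.2 i
    have h2 := ht.2 i
    have hbt := hx.trans htI.1.le
    have hoz := hF.others_pos hbz.le i
    have hoz' := hF'.others_pos hbz.le i
    have hot := hF.others_pos hbt i
    have hot' := hF'.others_pos hbt i
    have h3 := mul_le_mul h1 h2 (by positivity)
      (mul_pos hoz (hF'.others_pos (hbz.le.trans hzI.2) i)).le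
    have h4 : (others F i y * others F' i t) * (others F i z * others F' i z) ≤
        (others F i t * others F' i y) * (others F i z * others F' i z) := by linarith
    exact le_of_mul_le_mul_right h4 (by positivity)
  exact absurd (csInf_le hbdd hts) (not_le.2 htI.2)

lemma eq_one_of_top_le (hF : A.IsFlow b F) {x : ℝ} (hb : b ≤ x) (hx : A.top ≤ x) (i : Fin n) :
    F i x = 1 :=
  le_antisymm (hF.le_one i x hb)
    ((valueCDF_eq_one fun k => (value_le_top i k).trans hx).symm.le.trans (hF.valueCDF_le i x hb))

/-- The flow that reaches `1` first is the larger one, by comparison from above all values. -/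
lemma le_of_one (hF : A.IsFlow b F) (hF' : A.IsFlow b F')
    (hone : ∀ x, b ≤ x → (∀ i, F' i x = 1) → ∀ i, F i x = 1) {x : ℝ} (hx : b ≤ x) (i : Fin n) :
    F' i x ≤ F i x := by
  refine (hF.compare hF' hone hx (le_max_left x A.top) fun j => ?_).1 i
  rw [hF.eq_one_of_top_le (hx.trans (le_max_left _ _)) (le_max_right _ _) j]
  exact hF'.le_one j _ (hx.trans (le_max_left _ _))

/-- A flow is determined by the auction and the lower end. By comparison, the flow `F` that reaches
`1` first is larger, while the competition of its exceptional buyer `e` grows no faster in `F` than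
in `F'`. At `b` this competition is as small in `F` as it can be, so the two flows agree for all
buyers but `e`. Then they reach `1` together, and comparison applies in both directions. -/
theorem unique (hF : A.IsFlow b F) (hF' : A.IsFlow b F') {x : ℝ} (hx : b ≤ x) (i : Fin n) :
    F i x = F' i x := by
  wlog hone : ∀ x, b ≤ x → (∀ i, F' i x = 1) → ∀ i, F i x = 1 generalizing F F'
  · refine (this hF' hF ?_).symm
    push Not at hone
    obtain ⟨y, hby, hy', j, hj⟩ := hone
    intro t hbt ht l
    rcases le_total y t with h | h
    · exact le_antisymm (hF'.le_one l t hbt) ((hy' l).symm.le.trans (hF'.mono l hby hbt h))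
    · exact absurd (le_antisymm (hF.le_one j y hby)
        ((ht j).symm.le.trans (hF.mono j hbt hby h))) hj
  have hle : ∀ x, b ≤ x → ∀ i, F' i x ≤ F i x := fun x hx i => hF.le_of_one hF' hone hx i
  obtain ⟨e, he⟩ := hF.exceptional
  have hne : ∀ x, b ≤ x → ∀ i ≠ e, F' i x = F i x := by
    intro x hx
    refine eq_of_others_le (fun j _ => hF'.pos j x hx) (fun j _ => hle x hx j) ?_
    have h1 := (hF.compare hF' hone le_rfl hx (hle x hx)).2 e
    have h2 : others F e b ≤ others F' e b := others_le_others (fun j _ => (hF.pos j b le_rfl).le)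
      fun j hj => by rw [he j hj]; exact hF'.valueCDF_le j b le_rfl
    have h3 := hF'.others_pos hx e
    have h4 := hF'.others_pos le_rfl e
    have h5 := mul_le_mul_of_nonneg_right h2 h3.le
    have h6 : others F e x * others F' e b ≤ others F' e x * others F' e b := by linarith
    exact le_of_mul_le_mul_right h6 h4
  have hone' : ∀ x, b ≤ x → (∀ i, F i x = 1) → ∀ i, F' i x = 1 := by
    intro x hx h1
    have h1' : ∀ y, x ≤ y → ∀ i ≠ e, F' i y = 1 := by
      intro y hy i hi
      rw [hne y (hx.trans hy) i hi]
      exact le_antisymm (hF.le_one i y (hx.trans hy))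
        ((h1 i).symm.le.trans (hF.mono i hx (hx.trans hy) hy))
    intro i
    by_cases hi : i = e
    · subst hi
      by_contra hne1
      have hlt : F' i x < 1 := lt_of_le_of_ne (hF'.le_one i x hx) hne1
      have hc : Filter.Tendsto (F' i) (𝓝[>] x) (𝓝 (F' i x)) :=
        (hF'.cont i x hx).mono_left (nhdsWithin_mono x fun t ht => hx.trans (le_of_lt ht))
      obtain ⟨y, hy, hxy⟩ := ((hc.eventually (gt_mem_nhds hlt)).and self_mem_nhdsWithin).exists
      have hxy : x < y := hxy
      have h2 := hF'.others_lt hx hxy hy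
      rw [others_congr (F := F') (G := F') (x := x) (y := y) fun j hj => by
        rw [h1' x le_rfl j hj, h1' y hxy.le j hj]] at h2
      exact lt_irrefl _ h2
    · exact h1' x le_rfl i hi
  exact le_antisymm (hF'.le_of_one hF hone' hx i) (hle x hx i)

end IsFlow

/-! ### The growth rate of the highest bid -/

/-- The growth rate `W` at which the positive parts of `W - a i` sum up to `W`. If `a i` is the
growth rate of the competition that buyer `i` requires in order not to regret raising the bid, then
`W` is the growth rate of the distribution function of the highest bid. It is a minimum over the
sets of buyers that could be active. -/
def totalRate {ι : Type*} (a : ι → ℝ) : ℝ :=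
  ⨅ S : {S : Finset ι // 2 ≤ S.card}, (∑ i ∈ S.1, a i) / ((S.1.card : ℝ) - 1)

section totalRate

variable {ι : Type*} {a : ι → ℝ}

lemma card_sub_one_pos {S : Finset ι} (hS : 2 ≤ S.card) : (0 : ℝ) < (S.card : ℝ) - 1 := by
  have : (2 : ℝ) ≤ S.card := by exact_mod_cast hS
  linarith

variable [Fintype ι]

lemma totalRate_mul_le {S : Finset ι} (hS : 2 ≤ S.card) :
    totalRate a * ((S.card : ℝ) - 1) ≤ ∑ i ∈ S, a i := by
  rw [← le_div_iff₀ (card_sub_one_pos hS)]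
  exact ciInf_le (f := fun S : {S : Finset ι // 2 ≤ S.card} =>
    (∑ i ∈ S.1, a i) / ((S.1.card : ℝ) - 1)) (Set.finite_range _).bddBelow ⟨S, hS⟩

lemma totalRate_le_add {i j : ι} (h : i ≠ j) : totalRate a ≤ a i + a j := by
  classical
  have h1 := totalRate_mul_le (a := a) (S := {i, j}) (by rw [Finset.card_pair h])
  rw [Finset.card_pair h, Finset.sum_pair h] at h1
  norm_num at h1
  exact h1

lemma le_totalRate_of_mem (ha : ∀ i, 0 ≤ a i) {S : Finset ι} (hS : 2 ≤ S.card)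
    (he : totalRate a * ((S.card : ℝ) - 1) = ∑ i ∈ S, a i) {i : ι} (hi : i ∈ S) :
    a i ≤ totalRate a := by
  classical
  have h1 : ∑ l ∈ S.erase i, a l = totalRate a * ((S.card : ℝ) - 1) - a i := by
    rw [he, ← Finset.add_sum_erase S a hi]; ring
  have hc : ((S.erase i).card : ℝ) = S.card - 1 := by
    rw [Finset.card_erase_of_mem hi, Nat.cast_sub (by omega)]; simp
  rcases hS.eq_or_lt with h | h
  · have h2 : 0 ≤ ∑ l ∈ S.erase i, a l := Finset.sum_nonneg fun l _ => ha l
    rw [h1, ← h] at h2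
    norm_num at h2
    exact h2
  · have h2 := totalRate_mul_le (a := a) (S := S.erase i)
      (by rw [Finset.card_erase_of_mem hi]; omega)
    rw [h1, hc] at h2
    linarith

variable [Nontrivial ι]

instance : Nonempty {S : Finset ι // 2 ≤ S.card} :=
  ⟨⟨Finset.univ, by rw [Finset.card_univ]; exact Fintype.one_lt_card⟩⟩

lemma exists_totalRate_mul_eq (a : ι → ℝ) :
    ∃ S : Finset ι, 2 ≤ S.card ∧ totalRate a * ((S.card : ℝ) - 1) = ∑ i ∈ S, a i := by
  obtain ⟨S, hS⟩ := exists_eq_ciInf_of_finite (f := fun S : {S : Finset ι // 2 ≤ S.card} =>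
    (∑ i ∈ S.1, a i) / ((S.1.card : ℝ) - 1))
  refine ⟨S.1, S.2, ?_⟩
  rw [totalRate, ← hS, div_mul_cancel₀ _ (card_sub_one_pos S.2).ne']

lemma le_totalRate {c : ℝ} (hc : 0 ≤ c) (h : ∀ i, c ≤ a i) : c ≤ totalRate a := by
  obtain ⟨S, hS, he⟩ := exists_totalRate_mul_eq a
  have h1 : S.card * c ≤ ∑ i ∈ S, a i := by
    rw [← nsmul_eq_mul]; exact Finset.card_nsmul_le_sum _ _ _ fun i _ => h i
  have h2 := card_sub_one_pos hS
  by_contra! hlt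
  nlinarith

/-- The defining equation of the total growth rate. -/
lemma sum_max_totalRate_sub (ha : ∀ i, 0 ≤ a i) :
    ∑ i, max (totalRate a - a i) 0 = totalRate a := by
  have hW := le_totalRate le_rfl ha
  apply le_antisymm
  · set T := Finset.univ.filter fun i => a i < totalRate a with hT
    have h1 : ∑ i, max (totalRate a - a i) 0 = ∑ i ∈ T, (totalRate a - a i) := by
      rw [hT, Finset.sum_filter]
      refine Finset.sum_congr rfl fun i _ => ?_
      split_ifs with h
      · exact max_eq_left (by linarith)
      · exact max_eq_right (by linarith)
    rw [h1]
    by_cases hc : 2 ≤ T.card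
    · rw [Finset.sum_sub_distrib, Finset.sum_const, nsmul_eq_mul]
      linarith [totalRate_mul_le (a := a) hc]
    · push Not at hc
      interval_cases h : T.card
      · rw [Finset.card_eq_zero.1 h, Finset.sum_empty]; exact hW
      · obtain ⟨i, hi⟩ := Finset.card_eq_one.1 h
        rw [hi, Finset.sum_singleton]
        linarith [ha i]
  · obtain ⟨S, hS, he⟩ := exists_totalRate_mul_eq a
    calc totalRate a = ∑ i ∈ S, (totalRate a - a i) := by
          rw [Finset.sum_sub_distrib, Finset.sum_const, nsmul_eq_mul, ← he]; ring
      _ ≤ ∑ i ∈ S, max (totalRate a - a i) 0 := Finset.sum_le_sum fun i _ => le_max_left _ _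
      _ ≤ ∑ i, max (totalRate a - a i) 0 := Finset.sum_le_univ_sum_of_nonneg fun i =>
          le_max_right _ _

lemma lipschitzWith_totalRate : LipschitzWith 2 (totalRate : (ι → ℝ) → ℝ) := by
  refine LipschitzWith.of_le_add_mul 2 fun a a' => ?_
  obtain ⟨S, hS, he⟩ := exists_totalRate_mul_eq a'
  have h1 := totalRate_mul_le (a := a) hS
  have h2 : ∑ i ∈ S, a i ≤ ∑ i ∈ S, a' i + S.card * dist a a' := by
    rw [← nsmul_eq_mul, ← Finset.sum_const, ← Finset.sum_add_distrib]
    refine Finset.sum_le_sum fun i _ => ?_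
    have := dist_le_pi_dist a a' i
    rw [Real.dist_eq] at this
    linarith [le_abs_self (a i - a' i)]
  have h3 := card_sub_one_pos hS
  have h4 : (2 : ℝ) ≤ S.card := by exact_mod_cast hS
  have h5 : (0 : ℝ) ≤ dist a a' := dist_nonneg
  have h6 : (S.card : ℝ) * dist a a' ≤ 2 * dist a a' * ((S.card : ℝ) - 1) := by nlinarith
  refine le_of_mul_le_mul_right ?_ h3
  rw [add_mul, he]
  simp only [NNReal.coe_ofNat]
  linarith

end totalRate

/-! ### A regularized system of differential equations -/

/-- A continuous approximation of the value of buyer `i` at the quantile `s`. It is at least the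
value at the quantile, and it exceeds it only if `s` is within `1 / M` of the next larger value. -/
def level (A : FirstPriceAuction n) (M : ℝ) (i : Fin n) (s : ℝ) : ℝ :=
  ⨆ k, A.value i k * max 0 (min 1 ((s - A.cumLT i k) * M + 1))

/-- The growth rate of the competition that keeps buyer `i` indifferent at the bid `p.1`, when
`p.2` lists the logarithms of the bid distribution functions. The surplus is truncated below by
`1 / M`. -/
def rate (A : FirstPriceAuction n) (M : ℝ) (p : ℝ × (Fin n → ℝ)) (i : Fin n) : ℝ :=
  (max (level A M i (Real.exp (min (p.2 i) 0)) - p.1) M⁻¹)⁻¹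

/-- The growth rates of the bid distribution functions. -/
def drift (A : FirstPriceAuction n) (M : ℝ) (p : ℝ × (Fin n → ℝ)) (i : Fin n) : ℝ :=
  max (min (totalRate (rate A M p)) M - rate A M p i) 0

instance (i : Fin n) : Nonempty (Fin (A.d i)) := ⟨⟨0, A.d_pos i⟩⟩

lemma level_mono {M : ℝ} (hM : 0 ≤ M) (i : Fin n) : Monotone (A.level M i) := by
  intro s t hst
  refine ciSup_mono (Set.finite_range _).bddAbove fun k => ?_
  refine mul_le_mul_of_nonneg_left ?_ (A.value_nonneg i k)
  gcongr

lemma value_le_level {M : ℝ} (hM : 0 ≤ M) {i : Fin n} {k : Fin (A.d i)} {s : ℝ}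
    (h : A.cumLT i k ≤ s) : A.value i k ≤ A.level M i s := by
  refine le_ciSup_of_le (Set.finite_range _).bddAbove k ?_
  have : min 1 ((s - A.cumLT i k) * M + 1) = 1 :=
    min_eq_left (by linarith [mul_nonneg (sub_nonneg.2 h) hM])
  rw [this, max_eq_right zero_le_one, mul_one]

lemma level_le_value {M : ℝ} (hM : 0 < M) {i : Fin n} {k : Fin (A.d i)} {s : ℝ}
    (h : s ≤ A.cumLE i k - M⁻¹) : A.level M i s ≤ A.value i k := by
  refine ciSup_le fun l => ?_
  rcases le_or_gt l k with hl | hl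
  · calc A.value i l * max 0 (min 1 ((s - A.cumLT i l) * M + 1)) ≤ A.value i l * 1 :=
          mul_le_mul_of_nonneg_left (max_le zero_le_one (min_le_left _ _)) (A.value_nonneg i l)
      _ ≤ A.value i k := by rw [mul_one]; exact (A.value_strictMono i).monotone hl
  · have h1 := cumLE_le_cumLT hl
    have h2 : (s - A.cumLT i l) * M ≤ -M⁻¹ * M :=
      mul_le_mul_of_nonneg_right (by linarith) hM.le
    rw [neg_mul, inv_mul_cancel₀ hM.ne'] at h2
    rw [max_eq_left ((min_le_right _ _).trans (by linarith)), mul_zero]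
    exact A.value_nonneg i k

lemma level_le_top (M : ℝ) (i : Fin n) (s : ℝ) : A.level M i s ≤ A.top := by
  refine ciSup_le fun l => ?_
  calc A.value i l * max 0 (min 1 ((s - A.cumLT i l) * M + 1)) ≤ A.value i l * 1 :=
        mul_le_mul_of_nonneg_left (max_le zero_le_one (min_le_left _ _)) (A.value_nonneg i l)
    _ ≤ A.top := by rw [mul_one]; exact value_le_top i l

lemma level_one_ge {M : ℝ} (hM : 0 ≤ M) (i : Fin n) (k : Fin (A.d i)) :
    A.value i k ≤ A.level M i 1 :=
  value_le_level hM ((cumLT_lt_cumLE i k).le.trans (cumLE_le_one i k))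

lemma rate_pos {M : ℝ} (hM : 0 < M) (p : ℝ × (Fin n → ℝ)) (i : Fin n) : 0 < A.rate M p i :=
  inv_pos.2 (lt_max_of_lt_right (inv_pos.2 hM))

lemma drift_nonneg (M : ℝ) (p : ℝ × (Fin n → ℝ)) (i : Fin n) : 0 ≤ A.drift M p i :=
  le_max_right _ _

lemma drift_le {M : ℝ} (hM : 0 < M) (p : ℝ × (Fin n → ℝ)) (i : Fin n) : A.drift M p i ≤ M :=
  max_le (by linarith [min_le_right (totalRate (A.rate M p)) M, rate_pos (A := A) hM p i]) hM.le

open scoped NNReal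

lemma exists_lipschitzWith_ciSup {α κ : Type*} [PseudoMetricSpace α] [Finite κ] [Nonempty κ]
    {f : κ → α → ℝ} (h : ∀ k, ∃ K : ℝ≥0, LipschitzWith K (f k)) :
    ∃ K : ℝ≥0, LipschitzWith K fun x => ⨆ k, f k x := by
  have := Fintype.ofFinite κ
  choose K hK using h
  refine ⟨∑ k, K k, LipschitzWith.of_le_add_mul _ fun x y => ?_⟩
  refine ciSup_le fun k => ?_
  have h1 := ((hK k).weaken (Finset.single_le_sum (fun _ _ => zero_le) (Finset.mem_univ k)))
  have h2 := h1.dist_le_mul x y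
  rw [Real.dist_eq] at h2
  have h3 := le_ciSup (f := fun k => f k y) (Set.finite_range _).bddAbove k
  have h4 := le_abs_self (f k x - f k y)
  have h3' : f k y ≤ ⨆ k, f k y := h3
  linarith

lemma exists_lipschitzWith_mul_const {α : Type*} [PseudoMetricSpace α] {f : α → ℝ}
    (h : ∃ K : ℝ≥0, LipschitzWith K f) (c : ℝ) : ∃ K : ℝ≥0, LipschitzWith K fun x => f x * c := by
  obtain ⟨K, hK⟩ := h
  refine ⟨K * ‖c‖₊, LipschitzWith.of_dist_le_mul fun x y => ?_⟩
  have := hK.dist_le_mul x y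
  rw [Real.dist_eq] at this
  rw [Real.dist_eq, ← sub_mul, abs_mul, NNReal.coe_mul, coe_nnnorm, Real.norm_eq_abs]
  nlinarith [abs_nonneg c]

lemma lipschitzWith_exp_min : LipschitzWith 1 fun x : ℝ => Real.exp (min x 0) := by
  refine LipschitzWith.of_le_add_mul 1 fun x y => ?_
  have h1 := (LipschitzWith.id.min_const (0 : ℝ)).dist_le_mul x y
  simp only [id, NNReal.coe_one, one_mul, Real.dist_eq] at h1 ⊢
  rcases le_total (min x 0) (min y 0) with h | h
  · linarith [Real.exp_le_exp.2 h, abs_nonneg (x - y)]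
  · have h2 := Real.add_one_le_exp (min y 0 - min x 0)
    have h3 : Real.exp (min y 0) = Real.exp (min x 0) * Real.exp (min y 0 - min x 0) := by
      rw [← Real.exp_add]; ring_nf
    have h4 : Real.exp (min x 0) ≤ 1 := Real.exp_le_one_iff.2 (min_le_right _ _)
    have h5 := Real.exp_pos (min x 0)
    have h6 := le_abs_self (min x 0 - min y 0)
    rw [h3]
    nlinarith

lemma exists_lipschitzWith_inv_max {α : Type*} [PseudoMetricSpace α] {f : α → ℝ}
    (h : ∃ K : ℝ≥0, LipschitzWith K f) {c : ℝ} (hc : 0 < c) :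
    ∃ K : ℝ≥0, LipschitzWith K fun x => (max (f x) c)⁻¹ := by
  obtain ⟨K, hK⟩ := h
  refine ⟨K * (Real.toNNReal (c⁻¹ * c⁻¹)), LipschitzWith.of_dist_le_mul fun x y => ?_⟩
  have h1 := (hK.max_const c).dist_le_mul x y
  have hx : 0 < max (f x) c := lt_max_of_lt_right hc
  have hy : 0 < max (f y) c := lt_max_of_lt_right hc
  rw [Real.dist_eq] at h1
  rw [Real.dist_eq, NNReal.coe_mul, Real.coe_toNNReal _ (by positivity)]
  have h2 : (max (f x) c)⁻¹ - (max (f y) c)⁻¹ =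
      (max (f y) c - max (f x) c) * ((max (f x) c)⁻¹ * (max (f y) c)⁻¹) := by field_simp
  rw [h2, abs_mul, abs_sub_comm, abs_of_pos (show 0 < (max (f x) c)⁻¹ * (max (f y) c)⁻¹ by
    positivity)]
  have h3 : (max (f x) c)⁻¹ * (max (f y) c)⁻¹ ≤ c⁻¹ * c⁻¹ := mul_le_mul
    (inv_anti₀ hc (le_max_right _ _)) (inv_anti₀ hc (le_max_right _ _)) (by positivity)
    (by positivity)
  calc |max (f x) c - max (f y) c| * ((max (f x) c)⁻¹ * (max (f y) c)⁻¹)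
      ≤ (K * dist x y) * (c⁻¹ * c⁻¹) := mul_le_mul h1 h3 (by positivity) (by positivity)
    _ = K * (c⁻¹ * c⁻¹) * dist x y := by ring

lemma exists_lipschitzWith_pi {α ι : Type*} [PseudoMetricSpace α] [Fintype ι] {f : α → ι → ℝ}
    (h : ∀ i, ∃ K : ℝ≥0, LipschitzWith K fun x => f x i) : ∃ K : ℝ≥0, LipschitzWith K f := by
  choose K hK using h
  refine ⟨∑ k, K k, LipschitzWith.of_dist_le_mul fun x y => ?_⟩
  refine (dist_pi_le_iff (by positivity)).2 fun i => ?_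
  exact ((hK i).weaken (Finset.single_le_sum (fun _ _ => zero_le)
    (Finset.mem_univ i))).dist_le_mul x y

lemma exists_lipschitzWith_rate {M : ℝ} (hM : 0 < M) :
    ∃ K : ℝ≥0, LipschitzWith K (A.rate M) := by
  refine exists_lipschitzWith_pi fun i => exists_lipschitzWith_inv_max ?_ (inv_pos.2 hM)
  have h0 : LipschitzWith (1 * (1 * 1)) fun p : ℝ × (Fin n → ℝ) => Real.exp (min (p.2 i) 0) :=
    lipschitzWith_exp_min.comp ((LipschitzWith.eval i).comp LipschitzWith.prod_snd)
  have h1 : ∃ K : ℝ≥0, LipschitzWith K fun p : ℝ × (Fin n → ℝ) =>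
      A.level M i (Real.exp (min (p.2 i) 0)) := by
    refine exists_lipschitzWith_ciSup fun k => ?_
    obtain ⟨K, hK⟩ := exists_lipschitzWith_mul_const ⟨_, h0.sub (LipschitzWith.const
      (A.cumLT i k))⟩ M
    have h2 := ((hK.add (LipschitzWith.const (1 : ℝ))).const_min 1).const_max 0
    simp only [mul_comm (A.value i k)]
    exact exists_lipschitzWith_mul_const ⟨_, h2⟩ _
  obtain ⟨K, hK⟩ := h1
  exact ⟨_, hK.sub LipschitzWith.prod_fst⟩

lemma exists_lipschitzWith_drift [Nontrivial (Fin n)] {M : ℝ} (hM : 0 < M) :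
    ∃ K : ℝ≥0, LipschitzWith K (A.drift M) := by
  obtain ⟨K, hK⟩ := exists_lipschitzWith_rate (A := A) hM
  refine exists_lipschitzWith_pi fun i => ?_
  exact ⟨_, (((lipschitzWith_totalRate.comp hK).min_const M).sub
    ((LipschitzWith.eval i).comp hK)).max_const 0⟩

/-- The global flow of a bounded Lipschitz vector field on bounded sets, with continuous
dependence on the initial point. -/
lemma exists_continuousOn_flow {E : Type*} [NormedAddCommGroup E] [NormedSpace ℝ E]
    [CompleteSpace E] {v : E → E} {K L : ℝ≥0} (hK : LipschitzWith K v) (hL : ∀ x, ‖v x‖ ≤ L)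
    (x₀ : E) (r T : ℝ≥0) : ∃ α : E × ℝ → E, (∀ x ∈ Metric.closedBall x₀ r, α (x, 0) = x ∧
      ∀ t ∈ Set.Icc (-T : ℝ) T, HasDerivWithinAt (fun t => α (x, t)) (v (α (x, t)))
        (Set.Icc (-T : ℝ) T) t) ∧
      ContinuousOn α (Metric.closedBall x₀ r ×ˢ Set.Icc (-T : ℝ) T) := by
  have h0 : (0 : ℝ) ∈ Set.Icc (-T : ℝ) T := ⟨by simp, by simp⟩
  have hp : IsPicardLindelof (fun _ => v) (⟨0, h0⟩ : Set.Icc (-T : ℝ) T) x₀ (r + L * T) r L K :=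
    { lipschitzOnWith := fun _ _ => hK.lipschitzOnWith
      continuousOn := fun _ _ => continuousOn_const
      norm_le := fun _ _ x _ => hL x
      mul_max_le := by simp }
  exact hp.exists_forall_mem_closedBall_eq_hasDerivWithinAt_continuousOn

/-- The solutions of the regularized system that reach `1` at `B`, for all `B` in `[b, V]`. They
depend continuously on `B`, because `B` is the initial time of an autonomous system in which time is
a coordinate of the state. -/
lemma exists_solution_family [Nontrivial (Fin n)] {M b V : ℝ} (hM : 0 < M) (hbV : b ≤ V) :
    ∃ Λ : ℝ × ℝ → Fin n → ℝ,
      ContinuousOn Λ {p | p.1 ∈ Set.Icc b V ∧ p.2 ∈ Set.Icc b p.1} ∧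
      ∀ B ∈ Set.Icc b V, Λ (B, B) = 0 ∧ ∀ x ∈ Set.Icc b B, ∀ i,
        HasDerivWithinAt (fun x => Λ (B, x) i) (A.drift M (x, Λ (B, x)) i) (Set.Icc b B) x := by
  obtain ⟨K, hK⟩ := exists_lipschitzWith_drift (A := A) hM
  set v : ℝ × (Fin n → ℝ) → ℝ × (Fin n → ℝ) := fun p => (1, A.drift M p) with hv
  have hvK : LipschitzWith (max 0 K) v := (LipschitzWith.const (1 : ℝ)).prodMk hK
  have hvL : ∀ p, ‖v p‖ ≤ (max 1 M.toNNReal : NNReal) := by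
    intro p
    rw [Prod.norm_def, NNReal.coe_max, Real.coe_toNNReal _ hM.le]
    refine max_le_max (by simp [hv]) ((pi_norm_le_iff_of_nonneg hM.le).2 fun i => ?_)
    rw [Real.norm_of_nonneg (drift_nonneg M p i)]
    exact drift_le hM p i
  set T : NNReal := (V - b).toNNReal with hT
  have hTc : (T : ℝ) = V - b := Real.coe_toNNReal _ (by linarith)
  obtain ⟨α, hα, hαc⟩ := exists_continuousOn_flow hvK hvL (b, 0) T T
  have hball : ∀ B ∈ Set.Icc b V, ((B, 0) : ℝ × (Fin n → ℝ)) ∈ Metric.closedBall (b, 0) T := by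
    intro B hB
    rw [Metric.mem_closedBall, Prod.dist_eq, hTc, dist_self, Real.dist_eq,
      abs_of_nonneg (by linarith [hB.1])]
    exact max_le (by linarith [hB.2]) (by linarith)
  have hfst : ∀ B ∈ Set.Icc b V, ∀ t ∈ Set.Icc (-T : ℝ) T, (α ((B, 0), t)).1 = B + t := by
    intro B hB t ht
    obtain ⟨h0, hd⟩ := hα _ (hball B hB)
    have hd1 : ∀ t ∈ Set.Icc (-T : ℝ) T,
        HasDerivWithinAt (fun t => (α ((B, 0), t)).1 - t) 0 (Set.Icc (-T : ℝ) T) t := by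
      intro t ht
      have h1 : HasDerivWithinAt (fun t => (α ((B, 0), t)).1) 1 (Set.Icc (-T : ℝ) T) t := by
        have h := (hasFDerivAt_fst (𝕜 := ℝ) (p := α ((B, 0), t))).comp_hasDerivWithinAt t (hd t ht)
        exact h
      have h2 := h1.fun_sub (hasDerivWithinAt_id t _)
      rw [sub_self] at h2
      exact h2
    have hc := constant_of_has_deriv_right_zero (fun t ht => (hd1 t ht).continuousWithinAt)
      fun t ht => (hd1 t ⟨ht.1, ht.2.le⟩).mono_of_mem_nhdsWithin (Icc_mem_nhdsGE_of_mem ht)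
    have h1 := hc t ht
    have h2 := hc 0 ⟨by simp, by simp⟩
    rw [h0] at h2
    simp only [sub_zero] at h2
    linarith
  have hmemT : ∀ B ∈ Set.Icc b V, ∀ x ∈ Set.Icc b B, x - B ∈ Set.Icc (-T : ℝ) T := by
    intro B hB x hx
    rw [hTc]
    exact ⟨by linarith [hx.1, hB.2], by linarith [hx.2]⟩
  refine ⟨fun p => (α ((p.1, 0), p.2 - p.1)).2, ?_, fun B hB => ⟨?_, fun x hx i => ?_⟩⟩
  · refine continuous_snd.comp_continuousOn (hαc.comp ?_ fun p hp =>
      ⟨hball _ hp.1, hmemT _ hp.1 _ hp.2⟩)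
    exact Continuous.continuousOn (by fun_prop)
  · simp only [sub_self]
    rw [(hα _ (hball B hB)).1]
  · have hpt : (x, (α ((B, 0), x - B)).2) = α ((B, 0), x - B) := by
      have := hfst B hB _ (hmemT B hB x hx)
      ext
      · rw [this]; ring
      · rfl
    simp only
    rw [hpt]
    have h1 := (hα _ (hball B hB)).2 _ (hmemT B hB x hx)
    have h2 : HasDerivWithinAt (fun t => (α ((B, 0), t)).2) (A.drift M (α ((B, 0), x - B)))
        (Set.Icc (-T : ℝ) T) (x - B) := by
      have h := (hasFDerivAt_snd (𝕜 := ℝ) (p := α ((B, 0), x - B))).comp_hasDerivWithinAt _ h1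
      exact h
    have h3 := hasDerivWithinAt_pi.1 h2 i
    have h4 := h3.comp x ((hasDerivWithinAt_id x (Set.Icc b B)).sub_const B)
      fun y hy => hmemT B hB y hy
    rw [mul_one] at h4
    exact h4

/-- A solution of the regularized system on `[b, B]`; at the upper end `B` all bid distribution
functions reach `1`. -/
structure IsSolution (A : FirstPriceAuction n) (M b B : ℝ) (Λ : ℝ → Fin n → ℝ) : Prop where
  cont : ∀ i, ContinuousOn (fun x => Λ x i) (Set.Icc b B)
  deriv : ∀ x ∈ Set.Ioo b B, ∀ i, HasDerivAt (fun t => Λ t i) (A.drift M (x, Λ x) i) x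
  final : ∀ i, Λ B i = 0
  totalRate_le : ∀ x ∈ Set.Icc b B, totalRate (A.rate M (x, Λ x)) ≤ M

/-- The upper end can be chosen such that the total growth rate just reaches the bound `M`: the
maximal total rate is at most `M` if the upper end is `b`, at least `M` if it is `V`, and depends
continuously on the upper end. -/
lemma exists_isSolution [Nontrivial (Fin n)] {M b V : ℝ} (hM : 0 < M) (hbV : b ≤ V)
    (hb : totalRate (A.rate M (b, 0)) ≤ M) (hV : A.top ≤ V) :
    ∃ B Λ, b ≤ B ∧ B ≤ V ∧ A.IsSolution M b B Λ ∧
      ∃ q ∈ Set.Icc b B, totalRate (A.rate M (q, Λ q)) = M := by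
  obtain ⟨K', hK'⟩ := exists_lipschitzWith_rate (A := A) hM
  obtain ⟨Λ, hΛc, hΛ⟩ := exists_solution_family (A := A) hM hbV
  -- the maximum of the total rate depends continuously on the upper end
  obtain ⟨β, hβ⟩ : ∃ β : ℝ → ℝ, β = fun B => max b (min B V) := ⟨_, rfl⟩
  have hβmem : ∀ B, β B ∈ Set.Icc b V := fun B => by
    rw [hβ]; exact ⟨le_max_left _ _, max_le hbV (min_le_right _ _)⟩
  have hβeq : ∀ B ∈ Set.Icc b V, β B = B := fun B hB => by
    rw [hβ]; simp only; rw [min_eq_left hB.2, max_eq_right hB.1]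
  obtain ⟨γ, hγ⟩ : ∃ γ : ℝ → ℝ → ℝ, γ = fun B s => b + max 0 (min s 1) * (β B - b) := ⟨_, rfl⟩
  have hγmem : ∀ B s, γ B s ∈ Set.Icc b (β B) := by
    intro B s
    have h1 := (hβmem B).1
    have h2 : 0 ≤ max 0 (min s 1) := le_max_left _ _
    have h3 : max 0 (min s 1) ≤ 1 := max_le zero_le_one (min_le_right _ _)
    simp only [hγ]
    exact ⟨by nlinarith, by nlinarith⟩
  obtain ⟨H, hH⟩ : ∃ H : ℝ → ℝ → ℝ, H = fun B s =>
      totalRate (A.rate M (γ B s, Λ (β B, γ B s))) := ⟨_, rfl⟩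
  have hβc : Continuous β := by rw [hβ]; fun_prop
  have hγc : Continuous fun p : ℝ × ℝ => γ p.1 p.2 := by rw [hγ]; fun_prop
  have hHc : Continuous ↿H := by
    have h1 : Continuous fun p : ℝ × ℝ => Λ (β p.1, γ p.1 p.2) :=
      hΛc.comp_continuous ((hβc.comp continuous_fst).prodMk hγc) fun p =>
        ⟨hβmem p.1, hγmem p.1 p.2⟩
    rw [hH]
    exact lipschitzWith_totalRate.continuous.comp (hK'.continuous.comp (hγc.prodMk h1))
  have hfc : Continuous fun B => sSup (H B '' Set.Icc 0 1) := isCompact_Icc.continuous_sSup hHc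
  have hHB : ∀ B, Continuous (H B) := fun B => hHc.comp (Continuous.prodMk_right B)
  have hfb : sSup (H b '' Set.Icc 0 1) ≤ M := by
    refine csSup_le (Set.Nonempty.image _ ⟨0, by simp⟩) ?_
    rintro _ ⟨s, -, rfl⟩
    have h1 : β b = b := hβeq b ⟨le_rfl, hbV⟩
    have h2 : γ b s = b := by simp only [hγ]; rw [h1, sub_self, mul_zero, add_zero]
    simp only [hH]
    rw [h2, h1, (hΛ b ⟨le_rfl, hbV⟩).1]
    exact hb
  have hfV : M ≤ sSup (H V '' Set.Icc 0 1) := by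
    refine le_csSup_of_le ((isCompact_Icc.image (hHB V)).bddAbove)
      (Set.mem_image_of_mem _ (Set.right_mem_Icc.2 zero_le_one)) ?_
    have h1 : β V = V := hβeq V ⟨hbV, le_rfl⟩
    have h2 : γ V 1 = V := by simp only [hγ]; rw [h1]; simp
    simp only [hH]
    rw [h2, h1]
    refine le_totalRate hM.le fun i => ?_
    have h3 := level_le_top (A := A) M i (Real.exp (min (Λ (V, V) i) 0))
    have h4 := inv_pos.2 hM
    rw [rate, max_eq_right (by simp only; linarith), inv_inv]
  obtain ⟨B, hB, hBM⟩ := intermediate_value_Icc hbV hfc.continuousOn ⟨hfb, hfV⟩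
  simp only at hBM
  have hβB := hβeq B hB
  obtain ⟨hB0, hd⟩ := hΛ B hB
  refine ⟨B, fun x => Λ (B, x), hB.1, hB.2, ⟨fun i x hx => (hd x hx i).continuousWithinAt,
    fun x hx i => (hd x ⟨hx.1.le, hx.2.le⟩ i).hasDerivAt (Icc_mem_nhds hx.1 hx.2),
    fun i => congrFun hB0 i, fun x hx => ?_⟩, ?_⟩
  · refine le_trans ?_ hBM.le
    obtain ⟨s, hs, hsx⟩ : ∃ s ∈ Set.Icc (0 : ℝ) 1, b + s * (B - b) = x := by
      rcases hx.1.eq_or_lt with h | h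
      · exact ⟨0, by simp, by rw [← h]; ring⟩
      · have h2 : 0 < B - b := by linarith [hx.2]
        refine ⟨(x - b) / (B - b), ⟨by apply div_nonneg <;> linarith, ?_⟩, ?_⟩
        · rw [div_le_one h2]; linarith [hx.2]
        · field_simp; ring
    refine le_csSup_of_le ((isCompact_Icc.image (hHB B)).bddAbove)
      (Set.mem_image_of_mem _ hs) ?_
    simp only [hH, hγ]
    rw [hβB, min_eq_left hs.2, max_eq_right hs.1, hsx]
  · obtain ⟨s, hs, hsM⟩ := isCompact_Icc.exists_sSup_image_eq (Set.nonempty_Icc.2 zero_le_one)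
      (hHB B).continuousOn
    have hq := hγmem B s
    rw [hβB] at hq
    refine ⟨γ B s, hq, ?_⟩
    refine Eq.trans ?_ hBM
    rw [hsM]
    simp only [hH]
    rw [hβB]

/-! ### Surplus along the solutions of the regularized system -/

namespace IsSolution

variable {M b B : ℝ} {Λ : ℝ → Fin n → ℝ}

lemma monotoneOn (h : A.IsSolution M b B Λ) (i : Fin n) :
    MonotoneOn (fun x => Λ x i) (Set.Icc b B) := by
  refine monotoneOn_of_deriv_nonneg (convex_Icc b B) (h.cont i) ?_ ?_ <;> rw [interior_Icc]
  · exact fun x hx => (h.deriv x hx i).differentiableAt.differentiableWithinAt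
  · intro x hx
    rw [(h.deriv x hx i).deriv]
    exact drift_nonneg _ _ _

lemma nonpos (h : A.IsSolution M b B Λ) {x : ℝ} (hx : x ∈ Set.Icc b B) (i : Fin n) :
    Λ x i ≤ 0 := by
  rw [← h.final i]
  exact h.monotoneOn i hx ⟨hx.1.trans hx.2, le_rfl⟩ hx.2

lemma rate_eq (h : A.IsSolution M b B Λ) {x : ℝ} (hx : x ∈ Set.Icc b B) (i : Fin n) :
    A.rate M (x, Λ x) i = (max (A.level M i (Real.exp (Λ x i)) - x) M⁻¹)⁻¹ := by
  rw [rate, min_eq_left (h.nonpos hx i)]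

lemma level_le_level (h : A.IsSolution M b B Λ) (hM : 0 ≤ M) {x y : ℝ} (hx : x ∈ Set.Icc b B)
    (hy : y ∈ Set.Icc b B) (hxy : x ≤ y) (i : Fin n) :
    A.level M i (Real.exp (Λ x i)) ≤ A.level M i (Real.exp (Λ y i)) :=
  level_mono hM i (Real.exp_le_exp.2 (h.monotoneOn i hx hy hxy))

lemma drift_eq (h : A.IsSolution M b B Λ) {x : ℝ} (hx : x ∈ Set.Icc b B) (i : Fin n) :
    A.drift M (x, Λ x) i = max (totalRate (A.rate M (x, Λ x)) - A.rate M (x, Λ x) i) 0 := by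
  rw [drift, min_eq_left (h.totalRate_le x hx)]

lemma others_exp (i : Fin n) (x : ℝ) : others (fun j t => Real.exp (Λ t j)) i x =
    Real.exp (∑ j ∈ Finset.univ.erase i, Λ x j) := (Real.exp_sum _ _).symm

lemma continuousOn_surplus (h : A.IsSolution M b B Λ) (i : Fin n) (v : ℝ) :
    ContinuousOn (fun t => (v - t) * others (fun j t => Real.exp (Λ t j)) i t) (Set.Icc b B) :=
  (continuousOn_const.sub continuousOn_id).mul
    (Profile.continuousOn_others (fun j => (h.cont j).rexp) i)

/-- A buyer who will still bid more later is active at some later bid, and the value then exceeds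
that bid. -/
lemma exists_active (h : A.IsSolution M b B Λ) (hM : 0 < M) {y : ℝ} (hby : b ≤ y) (hyB : y ≤ B)
    {i : Fin n} {k : Fin (A.d i)} (hk : Real.exp (Λ y i) < A.cumLE i k - M⁻¹) :
    ∃ q, y < q ∧ q < B ∧ A.level M i (Real.exp (Λ q i)) ≤ A.value i k ∧
      M⁻¹ < A.value i k - q ∧ 1 ≤ (A.value i k - q) * totalRate (A.rate M (q, Λ q)) := by
  set s := A.cumLE i k - M⁻¹ with hs
  have hs1 : s < 1 := by linarith [cumLE_le_one i k, inv_pos.2 hM]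
  have hs0 : 0 < s := (Real.exp_pos _).trans hk
  have hc : ContinuousOn (fun x => Real.exp (Λ x i)) (Set.Icc y B) :=
    ((h.cont i).mono (Set.Icc_subset_Icc hby le_rfl)).rexp
  have hB1 : Real.exp (Λ B i) = 1 := by rw [h.final i, Real.exp_zero]
  obtain ⟨z, ⟨hzI, hz⟩, hmin⟩ : ∃ z, IsLeast {x ∈ Set.Icc y B | s ≤ Real.exp (Λ x i)} z :=
    (isCompact_Icc.of_isClosed_subset (isClosed_Icc.isClosed_le continuousOn_const hc)
      fun x hx => hx.1).exists_isLeast ⟨B, ⟨hyB, le_rfl⟩, by rw [hB1]; exact hs1.le⟩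
  have hyz : y < z := by
    rcases hzI.1.eq_or_lt with h1 | h1
    · rw [← h1] at hz; linarith
    · exact h1
  have hlt : ∀ t ∈ Set.Ioo y z, Real.exp (Λ t i) ≤ s := fun t ht => by
    by_contra! h1
    exact absurd (hmin ⟨⟨ht.1.le, ht.2.le.trans hzI.2⟩, h1.le⟩) (not_le.2 ht.2)
  obtain ⟨q, hq, hqd⟩ := exists_hasDerivAt_eq_slope (fun x => Λ x i)
    (fun x => A.drift M (x, Λ x) i) hyz
    ((h.cont i).mono (Set.Icc_subset_Icc hby hzI.2))
    fun x hx => h.deriv x (Set.Ioo_subset_Ioo hby hzI.2 hx) i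
  have hqI : q ∈ Set.Icc b B := ⟨hby.trans hq.1.le, hq.2.le.trans hzI.2⟩
  have hpos : 0 < A.drift M (q, Λ q) i := by
    rw [hqd]
    refine div_pos ?_ (by linarith)
    have := Real.exp_lt_exp.1 (hk.trans_le hz)
    linarith
  have hlev := level_le_value hM (hlt q hq)
  rw [h.drift_eq hqI] at hpos
  have hW : A.rate M (q, Λ q) i < totalRate (A.rate M (q, Λ q)) := by
    by_contra! h1
    rw [max_eq_right (by linarith)] at hpos
    exact lt_irrefl _ hpos
  have hWM := h.totalRate_le q hqI
  have hr := h.rate_eq hqI i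
  have hMi := inv_pos.2 hM
  -- the truncation is not active, since the rate is below `M`
  have hm : M⁻¹ < A.level M i (Real.exp (Λ q i)) - q := by
    by_contra! h1
    rw [max_eq_right h1, inv_inv] at hr
    linarith
  rw [max_eq_left hm.le] at hr
  have hm0 := hMi.trans hm
  refine ⟨q, hq.1, hq.2.trans_le hzI.2, hlev, by linarith, ?_⟩
  calc (1 : ℝ) = (A.level M i (Real.exp (Λ q i)) - q) * A.rate M (q, Λ q) i := by
        rw [hr, mul_inv_cancel₀ hm0.ne']
    _ ≤ (A.value i k - q) * totalRate (A.rate M (q, Λ q)) := mul_le_mul (by linarith) hW.le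
        (rate_pos hM _ _).le (by linarith)

/-- Nobody overbids, up to the error of the regularization. -/
lemma cumLE_le (h : A.IsSolution M b B Λ) (hM : 0 < M) {y : ℝ} (hby : b ≤ y) (hyB : y ≤ B)
    {i : Fin n} {k : Fin (A.d i)} (hk : A.value i k ≤ y) :
    A.cumLE i k - M⁻¹ ≤ Real.exp (Λ y i) := by
  by_contra! hlt
  obtain ⟨q, hyq, hqB, hlev, hq1, hq2⟩ := h.exists_active hM hby hyB hlt
  linarith [inv_pos.2 hM]

/-- After a point `q` where the total rate reaches its bound, two buyers cannot both have passed a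
quantile above which they have a surplus by much: while both are above it, the total rate is bounded
by `C`, and at `q` one of them is below it. -/
lemma le_or_le (h : A.IsSolution M b B Λ) (hM : 0 < M) {q x : ℝ}
    (hq : q ∈ Set.Icc b B) (hqM : totalRate (A.rate M (q, Λ q)) = M) (hqx : q ≤ x) (hxB : x ≤ B)
    {i l : Fin n} (hil : i ≠ l) {k : Fin (A.d i)} {m : Fin (A.d l)} {C : ℝ} (hCM : C < M)
    (hk : x < A.value i k) (hm : x < A.value l m)
    (hC : (A.value i k - x)⁻¹ + (A.value l m - x)⁻¹ ≤ C) :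
    Real.exp (Λ x i) ≤ A.cumLT i k * Real.exp (C * (x - b)) ∨
      Real.exp (Λ x l) ≤ A.cumLT l m * Real.exp (C * (x - b)) := by
  have hW : ∀ t ∈ Set.Icc q x, A.cumLT i k ≤ Real.exp (Λ t i) → A.cumLT l m ≤ Real.exp (Λ t l) →
      totalRate (A.rate M (t, Λ t)) ≤ C := by
    intro t ht h1 h2
    have htI : t ∈ Set.Icc b B := ⟨hq.1.trans ht.1, ht.2.trans hxB⟩
    have hr : ∀ (j : Fin n) (k : Fin (A.d j)), x < A.value j k →
        A.cumLT j k ≤ Real.exp (Λ t j) → A.rate M (t, Λ t) j ≤ (A.value j k - x)⁻¹ := by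
      intro j k hk hle
      rw [h.rate_eq htI]
      refine inv_anti₀ (by linarith) ?_
      have := value_le_level hM.le hle
      exact le_max_of_le_left (by linarith [ht.2])
    exact (totalRate_le_add hil).trans ((add_le_add (hr i k hk h1) (hr l m hm h2)).trans hC)
  have hC0 : 0 ≤ C := le_trans (add_nonneg (inv_nonneg.2 (by linarith))
    (inv_nonneg.2 (by linarith))) hC
  have hcont : ∀ j, ContinuousOn (fun t => Real.exp (Λ t j)) (Set.Icc q x) := fun j =>
    ((h.cont j).mono (Set.Icc_subset_Icc hq.1 hxB)).rexp
  -- the last point at which one of the two buyers has not yet passed the quantile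
  set s : Set ℝ := {t ∈ Set.Icc q x | Real.exp (Λ t i) ≤ A.cumLT i k} ∪
    {t ∈ Set.Icc q x | Real.exp (Λ t l) ≤ A.cumLT l m} with hs
  have hsc : IsClosed s := (isClosed_Icc.isClosed_le (hcont i) continuousOn_const).union
    (isClosed_Icc.isClosed_le (hcont l) continuousOn_const)
  have hsub : s ⊆ Set.Icc q x := by rintro t (ht | ht) <;> exact ht.1
  have hqs : q ∈ s := by
    by_contra hqs
    simp only [hs, Set.mem_union, Set.mem_ofPred_eq, not_or, not_and, not_le] at hqs
    have hqI : q ∈ Set.Icc q x := ⟨le_rfl, hqx⟩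
    linarith [hW q hqI (hqs.1 hqI).le (hqs.2 hqI).le]
  obtain ⟨t, hts, hmax⟩ := (isCompact_Icc.of_isClosed_subset hsc hsub).exists_isGreatest ⟨q, hqs⟩
  have htI := hsub hts
  have hWt : ∀ u ∈ Set.Ioo t x, totalRate (A.rate M (u, Λ u)) ≤ C := by
    intro u hu
    have huI : u ∈ Set.Icc q x := ⟨htI.1.trans hu.1.le, hu.2.le⟩
    have hus : u ∉ s := fun hus => absurd (hmax hus) (not_le.2 hu.1)
    simp only [hs, Set.mem_union, Set.mem_ofPred_eq, not_or, not_and, not_le] at hus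
    exact hW u huI (hus.1 huI).le (hus.2 huI).le
  have hgrow : ∀ j, Real.exp (Λ x j) ≤ Real.exp (Λ t j) * Real.exp (C * (x - b)) := by
    intro j
    have hanti : AntitoneOn (fun u => Λ u j - u * C) (Set.Icc t x) := by
      have hsubo : Set.Ioo t x ⊆ Set.Ioo b B := Set.Ioo_subset_Ioo (hq.1.trans htI.1) hxB
      have hd : ∀ u ∈ Set.Ioo t x, HasDerivAt (fun u => Λ u j - u * C)
          (A.drift M (u, Λ u) j - 1 * C) u := fun u hu =>
        (h.deriv u (hsubo hu) j).sub ((hasDerivAt_id u).mul_const C)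
      refine antitoneOn_of_deriv_nonpos (convex_Icc t x) ?_ ?_ ?_
      · exact ((h.cont j).mono (Set.Icc_subset_Icc (hq.1.trans htI.1) hxB)).sub (by fun_prop)
      · rw [interior_Icc]
        exact fun u hu => (hd u hu).differentiableAt.differentiableWithinAt
      · rw [interior_Icc]
        intro u hu
        rw [(hd u hu).deriv, one_mul, sub_nonpos,
          h.drift_eq ⟨(hsubo hu).1.le, (hsubo hu).2.le⟩]
        exact max_le (by linarith [hWt u hu, rate_pos (A := A) hM (u, Λ u) j]) hC0
    have h1 := hanti ⟨le_rfl, htI.2⟩ ⟨htI.2, le_rfl⟩ htI.2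
    simp only at h1
    rw [← Real.exp_add]
    refine Real.exp_le_exp.2 ?_
    have h2 : C * (x - t) ≤ C * (x - b) :=
      mul_le_mul_of_nonneg_left (by linarith [hq.1, htI.1]) hC0
    linarith
  rcases hts with hts | hts
  · exact Or.inl ((hgrow i).trans (mul_le_mul_of_nonneg_right hts.2 (Real.exp_pos _).le))
  · exact Or.inr ((hgrow l).trans (mul_le_mul_of_nonneg_right hts.2 (Real.exp_pos _).le))

variable [Nontrivial (Fin n)]

lemma sum_drift (h : A.IsSolution M b B Λ) (hM : 0 < M) {x : ℝ} (hx : x ∈ Set.Icc b B) :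
    ∑ i, A.drift M (x, Λ x) i = totalRate (A.rate M (x, Λ x)) := by
  rw [← sum_max_totalRate_sub fun i => (rate_pos hM (x, Λ x) i).le]
  exact Finset.sum_congr rfl fun i _ => h.drift_eq hx i

/-- The growth rate of the competition that buyer `i` faces. -/
lemma sum_erase_drift (h : A.IsSolution M b B Λ) (hM : 0 < M) {x : ℝ} (hx : x ∈ Set.Icc b B)
    (i : Fin n) : ∑ j ∈ Finset.univ.erase i, A.drift M (x, Λ x) j =
      min (totalRate (A.rate M (x, Λ x))) (A.rate M (x, Λ x) i) := by
  have h1 := Finset.add_sum_erase Finset.univ (A.drift M (x, Λ x)) (Finset.mem_univ i)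
  rw [h.sum_drift hM hx, h.drift_eq hx] at h1
  rcases le_total (totalRate (A.rate M (x, Λ x))) (A.rate M (x, Λ x) i) with h2 | h2
  · rw [max_eq_right (by linarith)] at h1
    rw [min_eq_left h2]; linarith
  · rw [max_eq_left (by linarith)] at h1
    rw [min_eq_right h2]; linarith

lemma hasDerivAt_surplus (h : A.IsSolution M b B Λ) (hM : 0 < M) {x : ℝ} (hx : x ∈ Set.Ioo b B)
    (i : Fin n) (v : ℝ) :
    HasDerivAt (fun t => (v - t) * others (fun j t => Real.exp (Λ t j)) i t)
      (Real.exp (∑ j ∈ Finset.univ.erase i, Λ x j) *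
        ((v - x) * min (totalRate (A.rate M (x, Λ x))) (A.rate M (x, Λ x) i) - 1)) x := by
  simp only [others_exp]
  have h1 : HasDerivAt (fun t => ∑ j ∈ Finset.univ.erase i, Λ t j)
      (∑ j ∈ Finset.univ.erase i, A.drift M (x, Λ x) j) x :=
    HasDerivAt.fun_sum fun j _ => h.deriv x hx j
  rw [h.sum_erase_drift hM ⟨hx.1.le, hx.2.le⟩ i] at h1
  refine (((hasDerivAt_id x).const_sub v).mul h1.exp).congr_deriv ?_
  simp only [id]
  ring

/-- A buyer does not gain from raising a bid. -/
lemma surplus_anti (h : A.IsSolution M b B Λ) (hM : 0 < M) {x y : ℝ} (hx : b ≤ x) (hxy : x ≤ y)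
    (hy : y ≤ B) {i : Fin n} {k : Fin (A.d i)} (hk : A.cumLT i k ≤ Real.exp (Λ x i)) :
    (A.value i k - y) * others (fun j t => Real.exp (Λ t j)) i y ≤
      (A.value i k - x) * others (fun j t => Real.exp (Λ t j)) i x := by
  have hsub : Set.Icc x y ⊆ Set.Icc b B := Set.Icc_subset_Icc hx hy
  have hsubo : Set.Ioo x y ⊆ Set.Ioo b B := Set.Ioo_subset_Ioo hx hy
  refine antitoneOn_of_deriv_nonpos (convex_Icc x y)
    ((h.continuousOn_surplus i (A.value i k)).mono hsub) ?_ ?_ ⟨le_rfl, hxy⟩ ⟨hxy, le_rfl⟩ hxy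
    <;> rw [interior_Icc]
  · exact fun t ht =>
      (h.hasDerivAt_surplus hM (hsubo ht) i _).differentiableAt.differentiableWithinAt
  · intro t ht
    rw [(h.hasDerivAt_surplus hM (hsubo ht) i _).deriv]
    have htI := hsub ⟨ht.1.le, ht.2.le⟩
    refine mul_nonpos_of_nonneg_of_nonpos (Real.exp_pos _).le ?_
    have h1 : A.value i k ≤ A.level M i (Real.exp (Λ t i)) := value_le_level hM.le
      (hk.trans (Real.exp_le_exp.2 (h.monotoneOn i ⟨hx, hxy.trans hy⟩ htI ht.1.le)))
    have h2 := h.rate_eq htI i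
    have hr := rate_pos (A := A) hM (t, Λ t) i
    have hW : 0 ≤ totalRate (A.rate M (t, Λ t)) :=
      le_totalRate le_rfl fun i => (rate_pos hM (t, Λ t) i).le
    set m := max (A.level M i (Real.exp (Λ t i)) - t) M⁻¹ with hm
    have hm0 : 0 < m := lt_max_of_lt_right (inv_pos.2 hM)
    rcases le_or_gt (A.value i k - t) 0 with h3 | h3
    · have := mul_nonpos_of_nonpos_of_nonneg h3 (le_min hW hr.le)
      linarith
    · have h4 : (A.value i k - t) * min (totalRate (A.rate M (t, Λ t))) (A.rate M (t, Λ t) i) ≤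
          m * m⁻¹ := mul_le_mul ((by linarith : A.value i k - t ≤ _).trans (le_max_left _ _))
            (by rw [← h2]; exact min_le_right _ _) (le_min hW hr.le) hm0.le
      rw [mul_inv_cancel₀ hm0.ne'] at h4
      linarith

/-- Single crossing: if a buyer with value `v` wants to raise the bid at `q`, the same holds at all
lower bids. -/
lemma one_le_mul_totalRate (h : A.IsSolution M b B Λ) (hM : 0 < M) {t q v : ℝ} (ht : b ≤ t)
    (htq : t ≤ q) (hq : q ≤ B) (hv : q < v) (h1 : 1 ≤ (v - q) * totalRate (A.rate M (q, Λ q))) :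
    1 ≤ (v - t) * totalRate (A.rate M (t, Λ t)) := by
  have htI : t ∈ Set.Icc b B := ⟨ht, htq.trans hq⟩
  have hqI : q ∈ Set.Icc b B := ⟨ht.trans htq, hq⟩
  by_contra! hlt
  -- the set of active buyers at `t` bounds the total rate at `q`
  obtain ⟨S, hS, he⟩ := exists_totalRate_mul_eq (A.rate M (t, Λ t))
  have hmem := fun i hi => le_totalRate_of_mem (fun i => (rate_pos hM (t, Λ t) i).le) hS he
    (i := i) hi
  have h2 := totalRate_mul_le (a := A.rate M (q, Λ q)) hS
  have hD : 0 < v - q := by linarith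
  have hDt : 0 < v - t := by linarith
  have h3 : ∀ i ∈ S, (v - q) * A.rate M (q, Λ q) i ≤ (v - t) * A.rate M (t, Λ t) i := by
    intro i hi
    have h4 := hmem i hi
    rw [h.rate_eq htI] at h4 ⊢
    rw [h.rate_eq hqI]
    set m := max (A.level M i (Real.exp (Λ t i)) - t) M⁻¹ with hm
    set m' := max (A.level M i (Real.exp (Λ q i)) - q) M⁻¹ with hm'
    have hm0 : 0 < m := lt_max_of_lt_right (inv_pos.2 hM)
    have hm0' : 0 < m' := lt_max_of_lt_right (inv_pos.2 hM)
    have h5 : v - t ≤ m := by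
      have h6 : (v - t) * m⁻¹ ≤ 1 := (mul_le_mul_of_nonneg_left h4 hDt.le).trans hlt.le
      rwa [← div_eq_mul_inv, div_le_one hm0] at h6
    have h7 : m - (q - t) ≤ m' := by
      have h8 := h.level_le_level hM.le htI hqI htq i
      rw [sub_le_iff_le_add, hm]
      refine max_le ?_ ?_
      · linarith [le_max_left (A.level M i (Real.exp (Λ q i)) - q) M⁻¹]
      · linarith [le_max_right (A.level M i (Real.exp (Λ q i)) - q) M⁻¹]
    rw [← div_eq_mul_inv, ← div_eq_mul_inv, div_le_div_iff₀ hm0' hm0]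
    nlinarith
  have h4 := Finset.sum_le_sum h3
  rw [← Finset.mul_sum, ← Finset.mul_sum, ← he] at h4
  have h5 := card_sub_one_pos hS
  have h6 := mul_le_mul_of_nonneg_left h2 hD.le
  have h7 : (v - q) * totalRate (A.rate M (q, Λ q)) * ((S.card : ℝ) - 1) ≤
      (v - t) * totalRate (A.rate M (t, Λ t)) * ((S.card : ℝ) - 1) := by linarith
  linarith [le_of_mul_le_mul_right h7 h5]

/-- A buyer who has not yet made all bids does not gain from lowering a bid. -/
lemma surplus_mono (h : A.IsSolution M b B Λ) (hM : 0 < M) {x y : ℝ} (hx : b ≤ x) (hxy : x ≤ y)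
    (hyB : y ≤ B) {i : Fin n} {k : Fin (A.d i)} (hk : Real.exp (Λ y i) < A.cumLE i k - M⁻¹) :
    (A.value i k - x) * others (fun j t => Real.exp (Λ t j)) i x ≤
      (A.value i k - y) * others (fun j t => Real.exp (Λ t j)) i y := by
  obtain ⟨q, hyq, hqB, hlev, hq1, hq2⟩ := h.exists_active hM (hx.trans hxy) hyB hk
  have hMi := inv_pos.2 hM
  have hsub : Set.Icc x y ⊆ Set.Icc b B := Set.Icc_subset_Icc hx hyB
  have hsubo : Set.Ioo x y ⊆ Set.Ioo b B := Set.Ioo_subset_Ioo hx hyB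
  refine monotoneOn_of_deriv_nonneg (convex_Icc x y)
    ((h.continuousOn_surplus i (A.value i k)).mono hsub) ?_ ?_ ⟨le_rfl, hxy⟩ ⟨hxy, le_rfl⟩ hxy
    <;> rw [interior_Icc]
  · exact fun t ht =>
      (h.hasDerivAt_surplus hM (hsubo ht) i _).differentiableAt.differentiableWithinAt
  · intro t ht
    rw [(h.hasDerivAt_surplus hM (hsubo ht) i _).deriv]
    have htI := hsub ⟨ht.1.le, ht.2.le⟩
    refine mul_nonneg (Real.exp_pos _).le (sub_nonneg.2 ?_)
    have htq : t ≤ q := ht.2.le.trans hyq.le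
    have h1 := h.one_le_mul_totalRate hM htI.1 htq hqB.le (by linarith) hq2
    have h2 : 1 ≤ (A.value i k - t) * A.rate M (t, Λ t) i := by
      rw [h.rate_eq htI, ← div_eq_mul_inv,
        one_le_div (lt_max_of_lt_right hMi)]
      have := h.level_le_level hM.le htI ⟨htI.1.trans htq, hqB.le⟩ htq i
      exact max_le (by linarith) (by linarith)
    rcases min_choice (totalRate (A.rate M (t, Λ t))) (A.rate M (t, Λ t) i) with h3 | h3 <;>
      rw [h3] <;> assumption

/-- The distribution function of the highest bid grows at least exponentially. -/
lemma prod_growth (h : A.IsSolution M b B Λ) (hM : 1 ≤ M) (hb : 0 ≤ b) {x y : ℝ} (hx : b ≤ x)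
    (hxy : x ≤ y) (hyB : y ≤ B) :
    (∏ i, Real.exp (Λ x i)) * Real.exp ((y - x) * (A.top + 1)⁻¹) ≤ ∏ i, Real.exp (Λ y i) := by
  have hM0 : 0 < M := by linarith
  have htop : 0 ≤ A.top :=
    Finset.sum_nonneg fun i _ => Finset.sum_nonneg fun k _ => A.value_nonneg i k
  have hsub : Set.Icc x y ⊆ Set.Icc b B := Set.Icc_subset_Icc hx hyB
  have hsubo : Set.Ioo x y ⊆ Set.Ioo b B := Set.Ioo_subset_Ioo hx hyB
  have hd : ∀ t ∈ Set.Ioo x y, HasDerivAt (fun t => ∑ i, Λ t i - t * (A.top + 1)⁻¹)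
      (totalRate (A.rate M (t, Λ t)) - 1 * (A.top + 1)⁻¹) t := by
    intro t ht
    have h1 : HasDerivAt (fun t => ∑ i, Λ t i) (∑ i, A.drift M (t, Λ t) i) t :=
      HasDerivAt.fun_sum fun i _ => h.deriv t (hsubo ht) i
    rw [h.sum_drift hM0 (hsub ⟨ht.1.le, ht.2.le⟩)] at h1
    exact h1.sub ((hasDerivAt_id t).mul_const _)
  have hmono : MonotoneOn (fun t => ∑ i, Λ t i - t * (A.top + 1)⁻¹) (Set.Icc x y) := by
    refine monotoneOn_of_deriv_nonneg (convex_Icc x y) ?_ ?_ ?_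
    · refine ContinuousOn.sub ?_ (by fun_prop)
      exact continuousOn_finsetSum _ fun i _ => (h.cont i).mono hsub
    · rw [interior_Icc]
      exact fun t ht => (hd t ht).differentiableAt.differentiableWithinAt
    · rw [interior_Icc]
      intro t ht
      rw [(hd t ht).deriv, one_mul, sub_nonneg]
      refine le_totalRate (by positivity) fun i => inv_anti₀ ?_ ?_
      · exact lt_max_of_lt_right (inv_pos.2 hM0)
      · refine max_le ?_ ?_
        · have := level_le_top (A := A) M i (Real.exp (min (Λ t i) 0))
          simp only
          linarith [ht.1]
        · linarith [inv_le_one_of_one_le₀ hM]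
  have := hmono ⟨le_rfl, hxy⟩ ⟨hxy, le_rfl⟩ hxy
  simp only at this
  rw [← Real.exp_sum, ← Real.exp_sum, ← Real.exp_add]
  exact Real.exp_le_exp.2 (by linarith)

/-- Where the total rate reaches its bound, all buyers but one have hardly any surplus left. -/
lemma exists_le_of_totalRate_eq (h : A.IsSolution M b B Λ) (hM : 0 < M) {q : ℝ}
    (hq : q ∈ Set.Icc b B) (hqM : totalRate (A.rate M (q, Λ q)) = M) :
    ∃ e, ∀ i ≠ e, ∀ k, q + 2 * M⁻¹ < A.value i k → Real.exp (Λ q i) < A.cumLT i k := by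
  have hhalf : ∀ i k, q + 2 * M⁻¹ < A.value i k → A.cumLT i k ≤ Real.exp (Λ q i) →
      A.rate M (q, Λ q) i < M / 2 := by
    intro i k hk hle
    have h1 := value_le_level hM.le hle
    have hMi := inv_pos.2 hM
    rw [h.rate_eq hq, show M / 2 = (2 * M⁻¹)⁻¹ by rw [mul_inv, inv_inv]; ring]
    exact inv_strictAnti₀ (by positivity) (lt_max_of_lt_left (by linarith))
  by_cases hex : ∃ e k, q + 2 * M⁻¹ < A.value e k ∧ A.cumLT e k ≤ Real.exp (Λ q e)
  · obtain ⟨e, k, h1, h2⟩ := hex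
    refine ⟨e, fun i hi l hl => ?_⟩
    by_contra! h3
    have h4 := totalRate_le_add (a := A.rate M (q, Λ q)) hi
    linarith [hhalf e k h1 h2, hhalf i l hl h3]
  · push Not at hex
    obtain ⟨e⟩ : Nonempty (Fin n) := inferInstance
    exact ⟨e, fun i _ k hk => hex i k hk⟩

end IsSolution

/-! ### Approximate flows and their limits -/

lemma valueCDF_eq_zero_or (i : Fin n) (x : ℝ) :
    A.valueCDF i x = 0 ∨ ∃ k, A.value i k ≤ x ∧ A.valueCDF i x = A.cumLE i k := by
  by_cases h : (Finset.univ.filter fun k => A.value i k ≤ x).Nonempty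
  · obtain ⟨k, hk, hmax⟩ := Finset.exists_max_image _ id h
    have hkx : A.value i k ≤ x := (Finset.mem_filter.1 hk).2
    refine Or.inr ⟨k, hkx, Finset.sum_congr rfl fun l _ => ?_⟩
    have : A.value i l ≤ x ↔ l ≤ k := ⟨fun hl => hmax l (Finset.mem_filter.2 ⟨Finset.mem_univ _, hl⟩),
      fun hl => ((A.value_strictMono i).monotone hl).trans hkx⟩
    simp only [this]
  · refine Or.inl (Finset.sum_eq_zero fun k _ => if_neg fun hk => h ⟨k, ?_⟩)
    exact Finset.mem_filter.2 ⟨Finset.mem_univ _, hk⟩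

lemma valueCDF_eq_one_or (i : Fin n) (x : ℝ) :
    A.valueCDF i x = 1 ∨ ∃ k, x < A.value i k ∧ A.valueCDF i x = A.cumLT i k := by
  by_cases h : (Finset.univ.filter fun k => x < A.value i k).Nonempty
  · obtain ⟨k, hk, hmin⟩ := Finset.exists_min_image _ id h
    have hkx : x < A.value i k := (Finset.mem_filter.1 hk).2
    refine Or.inr ⟨k, hkx, Finset.sum_congr rfl fun l _ => ?_⟩
    have : A.value i l ≤ x ↔ l < k := by
      constructor
      · intro hl
        exact (A.value_strictMono i).lt_iff_lt.1 (hl.trans_lt hkx)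
      · intro hl
        by_contra! hx
        exact absurd (hmin l (Finset.mem_filter.2 ⟨Finset.mem_univ _, hx⟩)) (not_le.2 hl)
    simp only [this]
  · refine Or.inl (valueCDF_eq_one fun k => ?_)
    by_contra! hk
    exact h ⟨k, Finset.mem_filter.2 ⟨Finset.mem_univ _, hk⟩⟩

/-- An approximate flow on `[b, ∞)`: the bid distribution functions of a solution of the
regularized system on `[b, B]` whose total rate reaches its bound `M` at `q`. As the limits for
`M → ∞` need not be continuous, everything that is needed of the system is stated without
derivatives and with bounds that are uniform in `M`. -/
structure IsApproxFlow (A : FirstPriceAuction n) (M b B q : ℝ) (F : Fin n → ℝ → ℝ) : Prop where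
  mem : q ∈ Set.Icc b B
  pos : ∀ i x, b ≤ x → 0 < F i x
  le_one : ∀ i x, b ≤ x → F i x ≤ 1
  eq_one : ∀ i x, B ≤ x → F i x = 1
  mono : ∀ i, MonotoneOn (F i) (Set.Ici b)
  cumLE_le : ∀ i k x, b ≤ x → A.value i k ≤ x → A.cumLE i k - M⁻¹ ≤ F i x
  right_antitone : ∀ i k x y, b ≤ x → x ≤ y → A.cumLT i k ≤ F i x →
    (A.value i k - y) * others F i y ≤ (A.value i k - x) * others F i x
  left_monotone : ∀ i k x y, b ≤ x → x ≤ y → F i y < A.cumLE i k - M⁻¹ →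
    (A.value i k - x) * others F i x ≤ (A.value i k - y) * others F i y
  growth : ∀ x y, b ≤ x → x ≤ y → y ≤ B →
    (∏ i, F i x) * Real.exp ((y - x) * (A.top + 1)⁻¹) ≤ ∏ i, F i y
  exceptional : ∃ e, ∀ i ≠ e, ∀ k, q + 2 * M⁻¹ < A.value i k → F i q < A.cumLT i k
  le_or_le : ∀ x i l k m C, q ≤ x → i ≠ l → C < M → x < A.value i k → x < A.value l m →
    (A.value i k - x)⁻¹ + (A.value l m - x)⁻¹ ≤ C →
    F i x ≤ A.cumLT i k * Real.exp (C * (x - b)) ∨ F l x ≤ A.cumLT l m * Real.exp (C * (x - b))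

lemma IsSolution.isApproxFlow [Nontrivial (Fin n)] {M b B q : ℝ} {Λ : ℝ → Fin n → ℝ}
    (h : A.IsSolution M b B Λ) (hM : 1 ≤ M) (hb : 0 ≤ b) (hq : q ∈ Set.Icc b B)
    (hqM : totalRate (A.rate M (q, Λ q)) = M) :
    A.IsApproxFlow M b B q fun i x => if x ≤ B then Real.exp (Λ x i) else 1 := by
  have hM0 : 0 < M := by linarith
  have hMi := inv_pos.2 hM0
  set F : Fin n → ℝ → ℝ := fun i x => if x ≤ B then Real.exp (Λ x i) else 1 with hF
  have hFle : ∀ i x, x ≤ B → F i x = Real.exp (Λ x i) := fun i x hx => if_pos hx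
  have hFge : ∀ i x, B ≤ x → F i x = 1 := by
    intro i x hx
    rcases hx.eq_or_lt with h1 | h1
    · rw [hFle i x h1.symm.le, ← h1, h.final i, Real.exp_zero]
    · exact if_neg (not_le.2 h1)
  have hle1 : ∀ i x, b ≤ x → F i x ≤ 1 := by
    intro i x hx
    rcases le_total x B with h1 | h1
    · rw [hFle i x h1]; exact Real.exp_le_one_iff.2 (h.nonpos ⟨hx, h1⟩ i)
    · exact (hFge i x h1).le
  have ho : ∀ i x, x ≤ B → others F i x = others (fun j t => Real.exp (Λ t j)) i x :=
    fun i x hx => others_congr fun j _ => hFle j x hx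
  have ho1 : ∀ i x, B ≤ x → others F i x = 1 := fun i x hx =>
    Finset.prod_eq_one fun j _ => hFge j x hx
  refine ⟨hq, fun i x _ => ?_, hle1, hFge, fun i x hx y hy hxy => ?_, fun i k x hx hk => ?_,
    fun i k x y hx hxy hk => ?_, fun i k x y hx hxy hk => ?_, fun x y hx hxy hy => ?_, ?_,
    fun x i l k m C hqx hil hCM hk hm hC => ?_⟩
  · simp only [hF]; split_ifs; exacts [Real.exp_pos _, one_pos]
  · rcases le_total y B with h1 | h1
    · rw [hFle i y h1, hFle i x (hxy.trans h1)]
      exact Real.exp_le_exp.2 (h.monotoneOn i ⟨hx, hxy.trans h1⟩ ⟨hy, h1⟩ hxy)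
    · rw [hFge i y h1]; exact hle1 i x hx
  · rcases le_total x B with h1 | h1
    · rw [hFle i x h1]; exact h.cumLE_le hM0 hx h1 hk
    · rw [hFge i x h1]; linarith [cumLE_le_one i k]
  · rcases le_total y B with h1 | h1
    · rw [ho i y h1, ho i x (hxy.trans h1)]
      rw [hFle i x (hxy.trans h1)] at hk
      exact h.surplus_anti hM0 hx hxy h1 hk
    · rcases le_total x B with h2 | h2
      · have h3 : (A.value i k - B) * others F i B ≤ (A.value i k - x) * others F i x := by
          rw [ho i B le_rfl, ho i x h2]
          rw [hFle i x h2] at hk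
          exact h.surplus_anti hM0 hx h2 le_rfl hk
        rw [ho1 i B le_rfl] at h3
        rw [ho1 i y h1]
        linarith
      · rw [ho1 i y h1, ho1 i x h2]; linarith
  · rcases lt_or_ge y B with h1 | h1
    · rw [ho i y h1.le, ho i x (hxy.trans h1.le)]
      rw [hFle i y h1.le] at hk
      exact h.surplus_mono hM0 hx hxy h1.le hk
    · rw [hFge i y h1] at hk
      linarith [cumLE_le_one i k]
  · rw [Finset.prod_congr rfl fun i _ => hFle i x (hxy.trans hy),
      Finset.prod_congr rfl fun i _ => hFle i y hy]
    exact h.prod_growth hM hb hx hxy hy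
  · simp only [hFle _ q hq.2]
    exact h.exists_le_of_totalRate_eq hM0 hq hqM
  · have hCpos : 0 < C := lt_of_lt_of_le (add_pos (inv_pos.2 (by linarith))
      (inv_pos.2 (by linarith))) hC
    rcases le_total x B with h1 | h1
    · rw [hFle i x h1, hFle l x h1]
      exact h.le_or_le hM0 hq hqM hqx h1 hil hCM hk hm hC
    · have h2 := h.le_or_le hM0 hq hqM hq.2 le_rfl hil hCM (h1.trans_lt hk) (h1.trans_lt hm)
        (le_trans (add_le_add (inv_anti₀ (by linarith) (by linarith))
          (inv_anti₀ (by linarith) (by linarith))) hC)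
      have h3 : Real.exp (C * (B - b)) ≤ Real.exp (C * (x - b)) :=
        Real.exp_le_exp.2 (mul_le_mul_of_nonneg_left (by linarith) hCpos.le)
      rw [hFge i x h1, hFge l x h1, ← hFge i B le_rfl, hFle i B le_rfl]
      rw [h.final l, ← h.final i] at h2
      exact h2.imp (fun h4 => h4.trans (mul_le_mul_of_nonneg_left h3 (cumLT_nonneg i k)))
        fun h4 => h4.trans (mul_le_mul_of_nonneg_left h3 (cumLT_nonneg l m))

/-- Approximate flows exist if two buyers have values above `b`. -/
lemma exists_isApproxFlow {b : ℝ} (hb : 0 ≤ b) {i l : Fin n} (hil : i ≠ l) {k : Fin (A.d i)}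
    {m : Fin (A.d l)} (hk : b < A.value i k) (hm : b < A.value l m) {M : ℝ} (hM : 1 ≤ M)
    (hM' : (A.value i k - b)⁻¹ + (A.value l m - b)⁻¹ ≤ M) :
    ∃ B q F, B ≤ A.top ∧ A.IsApproxFlow M b B q F := by
  have : Nontrivial (Fin n) := ⟨i, l, hil⟩
  have hM0 : 0 < M := by linarith
  have hr : ∀ (j : Fin n) (k : Fin (A.d j)), b < A.value j k →
      A.rate M (b, 0) j ≤ (A.value j k - b)⁻¹ := by
    intro j k hk
    have h1 := level_one_ge (A := A) hM0.le j k
    refine inv_anti₀ (by linarith) (le_max_of_le_left ?_)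
    simp only [Pi.zero_apply, min_self, Real.exp_zero]
    linarith
  obtain ⟨B, Λ, -, hB, hS, q, hq, hqM⟩ := exists_isSolution (A := A) hM0
    (hk.le.trans (value_le_top i k))
    ((totalRate_le_add hil).trans ((add_le_add (hr i k hk) (hr l m hm)).trans hM')) le_rfl
  exact ⟨B, q, _, hB, hS.isApproxFlow hM hb hq hqM⟩

/-- A pointwise limit of approximate flows for `M → ∞`; the points `B` and `q` are limits as well.
Compared with `IsFlow`, the functions may still jump or vanish, and the exceptional buyer is known
only at `q`. -/
structure IsLimitFlow (A : FirstPriceAuction n) (b B q : ℝ) (F : Fin n → ℝ → ℝ) : Prop where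
  mem : q ∈ Set.Icc b B
  nonneg : ∀ i x, b ≤ x → 0 ≤ F i x
  le_one : ∀ i x, b ≤ x → F i x ≤ 1
  eq_one : ∀ i x, B < x → F i x = 1
  mono : ∀ i, MonotoneOn (F i) (Set.Ici b)
  valueCDF_le : ∀ i x, b ≤ x → A.valueCDF i x ≤ F i x
  right_antitone : ∀ i k x y, b ≤ x → x ≤ y → A.cumLT i k < F i x →
    (A.value i k - y) * others F i y ≤ (A.value i k - x) * others F i x
  left_monotone : ∀ i k x y, b ≤ x → x ≤ y → F i y < A.cumLE i k →
    (A.value i k - x) * others F i x ≤ (A.value i k - y) * others F i y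
  growth : ∀ x y, b ≤ x → x < y → y < B → 0 < ∏ i, F i x → ∏ i, F i x < ∏ i, F i y
  exceptional : ∃ e, ∀ i ≠ e, ∀ x, b ≤ x → x < q → F i x ≤ A.valueCDF i q
  le_or_le : ∀ x i l k m C, q < x → i ≠ l → x < A.value i k → x < A.value l m →
    (A.value i k - x)⁻¹ + (A.value l m - x)⁻¹ ≤ C →
    F i x ≤ A.cumLT i k * Real.exp (C * (x - b)) ∨ F l x ≤ A.cumLT l m * Real.exp (C * (x - b))

lemma exists_isLimitFlow {b : ℝ} (hb : 0 ≤ b) {i l : Fin n} (hil : i ≠ l) {k : Fin (A.d i)}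
    {m : Fin (A.d l)} (hk : b < A.value i k) (hm : b < A.value l m) :
    ∃ B q F, A.IsLimitFlow b B q F := by
  set M : ℕ → ℝ := fun r => r + 1 + ((A.value i k - b)⁻¹ + (A.value l m - b)⁻¹) with hMdef
  have hpos : 0 < (A.value i k - b)⁻¹ + (A.value l m - b)⁻¹ :=
    add_pos (inv_pos.2 (by linarith)) (inv_pos.2 (by linarith))
  have hM1 : ∀ r, 1 ≤ M r := fun r => by
    have : (0 : ℝ) ≤ r := r.cast_nonneg
    simp only [hMdef]; linarith
  choose B q F hBt hF using fun r => exists_isApproxFlow (A := A) hb hil hk hm (hM1 r)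
    (by have : (0 : ℝ) ≤ r := r.cast_nonneg
        simp only [hMdef]; linarith)
  -- bounded sequences converge along a nonprincipal ultrafilter
  set U : Ultrafilter ℕ := Filter.hyperfilter ℕ with hU
  have hMtop : Filter.Tendsto M U Filter.atTop := by
    have h1 : Filter.Tendsto M Filter.atTop Filter.atTop :=
      Filter.tendsto_atTop_add_const_right _ _
        (Filter.tendsto_atTop_add_const_right _ _ tendsto_natCast_atTop_atTop)
    exact h1.mono_left Nat.hyperfilter_le_atTop
  have hMinv : Filter.Tendsto (fun r => (M r)⁻¹) U (𝓝 0) := tendsto_inv_atTop_zero.comp hMtop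
  have hlim : ∀ (u : ℕ → ℝ) (c d : ℝ), (∀ r, u r ∈ Set.Icc c d) →
      ∃ a ∈ Set.Icc c d, Filter.Tendsto u U (𝓝 a) := by
    intro u c d hu
    refine isCompact_Icc.ultrafilter_le_nhds (U.map u) ?_
    rw [Filter.le_principal_iff]
    exact Filter.mem_map.2 (Filter.univ_mem' hu)
  obtain ⟨B', -, hB'⟩ := hlim B b A.top fun r => ⟨(hF r).mem.1.trans (hF r).mem.2, hBt r⟩
  obtain ⟨q', -, hq'⟩ := hlim q b A.top fun r => ⟨(hF r).mem.1, (hF r).mem.2.trans (hBt r)⟩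
  have hlimF : ∀ i x, ∃ a, b ≤ x → Filter.Tendsto (fun r => F r i x) U (𝓝 a) := by
    intro i x
    by_cases hx : b ≤ x
    · obtain ⟨a, -, ha⟩ := hlim (fun r => F r i x) 0 1 fun r =>
        ⟨((hF r).pos i x hx).le, (hF r).le_one i x hx⟩
      exact ⟨a, fun _ => ha⟩
    · exact ⟨0, fun h => absurd h hx⟩
  choose G hG using hlimF
  have hGo : ∀ i x, b ≤ x → Filter.Tendsto (fun r => others (F r) i x) U (𝓝 (others G i x)) :=
    fun i x hx => tendsto_finsetProd _ fun j _ => hG j x hx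
  have hGp : ∀ x, b ≤ x → Filter.Tendsto (fun r => ∏ i, F r i x) U (𝓝 (∏ i, G i x)) :=
    fun x hx => tendsto_finsetProd _ fun j _ => hG j x hx
  have hq'mem : q' ∈ Set.Icc b B' := ⟨ge_of_tendsto hq' (Filter.Eventually.of_forall fun r =>
    (hF r).mem.1), le_of_tendsto_of_tendsto hq' hB' (Filter.Eventually.of_forall fun r =>
    (hF r).mem.2)⟩
  have hcumLE : ∀ i k x, b ≤ x → A.value i k ≤ x → A.cumLE i k ≤ G i x := by
    intro i k x hx hkx
    have h1 : Filter.Tendsto (fun r => A.cumLE i k - (M r)⁻¹) U (𝓝 (A.cumLE i k - 0)) :=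
      tendsto_const_nhds.sub hMinv
    rw [sub_zero] at h1
    exact le_of_tendsto_of_tendsto h1 (hG i x hx) (Filter.Eventually.of_forall fun r =>
      (hF r).cumLE_le i k x hx hkx)
  refine ⟨B', q', G, hq'mem, fun i x hx => ?_, fun i x hx => ?_, fun i x hx => ?_,
    fun i x hx y hy hxy => ?_, fun i x hx => ?_, fun i k x y hx hxy hk => ?_,
    fun i k x y hx hxy hk => ?_, fun x y hx hxy hy hpos => ?_, ?_,
    fun x i l k m C hqx hil hk hm hC => ?_⟩
  · exact ge_of_tendsto (hG i x hx) (Filter.Eventually.of_forall fun r => ((hF r).pos i x hx).le)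
  · exact le_of_tendsto (hG i x hx) (Filter.Eventually.of_forall fun r => (hF r).le_one i x hx)
  · have hbx : b ≤ x := (hq'mem.1.trans hq'mem.2).trans hx.le
    refine tendsto_nhds_unique (hG i x hbx) (tendsto_const_nhds.congr' ?_)
    filter_upwards [hB'.eventually (gt_mem_nhds hx)] with r hr
    exact ((hF r).eq_one i x hr.le).symm
  · exact le_of_tendsto_of_tendsto (hG i x hx) (hG i y hy) (Filter.Eventually.of_forall fun r =>
      (hF r).mono i hx hy hxy)
  · rcases valueCDF_eq_zero_or (A := A) i x with h | ⟨k, hk, h⟩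
    · rw [h]
      exact ge_of_tendsto (hG i x hx) (Filter.Eventually.of_forall fun r =>
        ((hF r).pos i x hx).le)
    · rw [h]; exact hcumLE i k x hx hk
  · refine le_of_tendsto_of_tendsto ((hGo i y (hx.trans hxy)).const_mul _)
      ((hGo i x hx).const_mul _) ?_
    filter_upwards [(hG i x hx).eventually (lt_mem_nhds hk)] with r hr
    exact (hF r).right_antitone i k x y hx hxy hr.le
  · refine le_of_tendsto_of_tendsto ((hGo i x hx).const_mul _)
      ((hGo i y (hx.trans hxy)).const_mul _) ?_
    have h1 : Filter.Tendsto (fun r => F r i y + (M r)⁻¹) U (𝓝 (G i y + 0)) :=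
      (hG i y (hx.trans hxy)).add hMinv
    rw [add_zero] at h1
    filter_upwards [h1.eventually (gt_mem_nhds hk)] with r hr
    exact (hF r).left_monotone i k x y hx hxy (by linarith)
  · have htop : 0 ≤ A.top :=
      Finset.sum_nonneg fun i _ => Finset.sum_nonneg fun k _ => A.value_nonneg i k
    have h1 : (∏ i, G i x) * Real.exp ((y - x) * (A.top + 1)⁻¹) ≤ ∏ i, G i y := by
      refine le_of_tendsto_of_tendsto ((hGp x hx).mul_const _) (hGp y (hx.trans hxy.le)) ?_
      filter_upwards [hB'.eventually (lt_mem_nhds hy)] with r hr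
      exact (hF r).growth x y hx hxy.le hr.le
    have h2 : 1 < Real.exp ((y - x) * (A.top + 1)⁻¹) := Real.one_lt_exp_iff.2
      (mul_pos (by linarith) (inv_pos.2 (by linarith)))
    nlinarith
  · choose e he using fun r => (hF r).exceptional
    obtain ⟨e', he'⟩ : ∃ e', ∀ᶠ r in U, e r = e' := by
      have h1 : ∀ᶠ r in (U : Filter ℕ), ∃ e', e r = e' := Filter.univ_mem' fun r => ⟨_, rfl⟩
      exact Ultrafilter.eventually_exists_iff.1 h1
    refine ⟨e', fun i hi x hx hxq => ?_⟩
    rcases valueCDF_eq_one_or (A := A) i q' with h | ⟨k, hk, h⟩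
    · rw [h]
      exact le_of_tendsto (hG i x hx) (Filter.Eventually.of_forall fun r => (hF r).le_one i x hx)
    · rw [h]
      have h1 : Filter.Tendsto (fun r => q r + 2 * (M r)⁻¹) U (𝓝 (q' + 2 * 0)) :=
        hq'.add (hMinv.const_mul 2)
      rw [mul_zero, add_zero] at h1
      refine le_of_tendsto (hG i x hx) ?_
      filter_upwards [he', h1.eventually (gt_mem_nhds hk), hq'.eventually (lt_mem_nhds hxq)]
        with r hr1 hr2 hr3
      exact ((hF r).mono i hx (hx.trans hr3.le) hr3.le).trans
        (he r i (by rw [hr1]; exact hi) k hr2).le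
  · have hbx : b ≤ x := hq'mem.1.trans hqx.le
    have h1 : ∀ᶠ r in (U : Filter ℕ), F r i x ≤ A.cumLT i k * Real.exp (C * (x - b)) ∨
        F r l x ≤ A.cumLT l m * Real.exp (C * (x - b)) := by
      filter_upwards [hq'.eventually (gt_mem_nhds hqx), hMtop.eventually_gt_atTop C]
        with r hr1 hr2
      exact (hF r).le_or_le x i l k m C hr1.le hil hr2 hk hm hC
    rcases Ultrafilter.eventually_or.1 h1 with h2 | h2
    · exact Or.inl (le_of_tendsto (hG i x hbx) h2)
    · exact Or.inr (le_of_tendsto (hG l x hbx) h2)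

/-! ### Existence of the flow -/

/-- A monotone function is continuous at `z` if its product with `v - t` is antitone near `z`. -/
lemma continuousAt_of_monotoneOn_of_antitoneOn {f : ℝ → ℝ} {x z v : ℝ} (hxz : x < z) (hzv : z < v)
    (hm : MonotoneOn f (Set.Ioo x v)) (ha : AntitoneOn (fun t => (v - t) * f t) (Set.Ioo x v)) :
    ContinuousAt f z := by
  have hg : Filter.Tendsto (fun t => (v - z) * f z / (v - t)) (𝓝 z) (𝓝 (f z)) := by
    have h1 : ContinuousAt (fun t => (v - z) * f z / (v - t)) z :=
      continuousAt_const.div (continuousAt_const.sub continuousAt_id) (sub_ne_zero.2 hzv.ne')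
    have h2 : (v - z) * f z / (v - z) = f z := mul_div_cancel_left₀ _ (by linarith)
    have h3 := h1.tendsto
    rwa [h2] at h3
  have hmin := (tendsto_const_nhds (x := f z)).min hg
  have hmax := (tendsto_const_nhds (x := f z)).max hg
  rw [min_self] at hmin
  rw [max_self] at hmax
  have hzI : z ∈ Set.Ioo x v := ⟨hxz, hzv⟩
  refine tendsto_of_tendsto_of_tendsto_of_le_of_le' hmin hmax ?_ ?_ <;>
    filter_upwards [Ioo_mem_nhds hxz hzv] with t ht
  · have hvt : 0 < v - t := by linarith [ht.2]
    rcases le_total t z with h | h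
    · refine (min_le_right _ _).trans ?_
      rw [div_le_iff₀ hvt, mul_comm (f t)]
      exact ha ht hzI h
    · exact (min_le_left _ _).trans (hm hzI ht h)
  · have hvt : 0 < v - t := by linarith [ht.2]
    rcases le_total t z with h | h
    · exact (hm ht hzI h).trans (le_max_left _ _)
    · refine le_trans ?_ (le_max_right _ _)
      rw [le_div_iff₀ hvt, mul_comm (f t)]
      exact ha hzI ht h

namespace IsLimitFlow

variable {b B q : ℝ} {F : Fin n → ℝ → ℝ}

/-- This is where the choice of the lower end `b` enters. Every buyer other than `j` has values up
to `b`. If `F j` vanished up to some `y₀ > b`, the values above `y₀` of the others would not bid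
below `y₀`, and `y₀` would be as good as `b` for the smallest value of `j` if the others bid their
values, against the strict maximality of `b`. -/
lemma pos_of_lt (h : A.IsLimitFlow b B q F) {j : Fin n} (hj : A.IsReserve j b) (i : Fin n) {x : ℝ}
    (hx : b < x) : 0 < F i x := by
  rcases le_or_gt (A.low j) b with hlow | hlow
  · exact (valueCDF_pos.2 ((hj.low_le_low i).trans (hlow.trans hx.le))).trans_le
      (h.valueCDF_le i x hx.le)
  have h1 := hj.isMax_strict (A.low j) hlow le_rfl
  rw [sub_self, zero_mul] at h1
  have hΨ : 0 < others A.valueCDF j b := pos_of_mul_pos_right h1 (by linarith)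
  have hne : ∀ i ≠ j, ∀ t, b ≤ t → 0 < F i t := by
    intro i hi t ht
    have h2 : 0 < A.valueCDF i b := by
      refine lt_of_le_of_ne (valueCDF_nonneg i b) fun h3 => ?_
      rw [others_eq_zero hi h3.symm] at hΨ
      exact lt_irrefl _ hΨ
    exact h2.trans_le ((valueCDF_mono i ht).trans (h.valueCDF_le i t ht))
  by_cases hi : i = j
  swap
  · exact hne i hi x hx.le
  subst hi
  by_contra! hneg
  set s : Set ℝ := {t | b ≤ t ∧ F i t = 0} with hs
  have hxs : x ∈ s := ⟨hx.le, le_antisymm hneg (h.nonneg i x hx.le)⟩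
  have hslow : ∀ t ∈ s, t ≤ A.low i := by
    intro t ht
    by_contra! hlt
    have h2 := (valueCDF_pos (A := A).2 hlt.le).trans_le (h.valueCDF_le i t ht.1)
    rw [ht.2] at h2
    exact lt_irrefl _ h2
  have hbdd : BddAbove s := ⟨_, hslow⟩
  set y₀ := sSup s with hy₀
  have hby₀ : b < y₀ := hx.trans_le (le_csSup hbdd hxs)
  have hy₀low : y₀ ≤ A.low i := csSup_le ⟨x, hxs⟩ hslow
  have hzero : ∀ t, b ≤ t → t < y₀ → F i t = 0 := by
    intro t hbt ht
    obtain ⟨u, hu, htu⟩ := exists_lt_of_lt_csSup ⟨x, hxs⟩ ht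
    exact le_antisymm (hu.2 ▸ h.mono i hbt hu.1 htu.le) (h.nonneg i t hbt)
  have hpos : ∀ l t, y₀ < t → 0 < F l t := by
    intro l t ht
    by_cases hl : l = i
    · subst hl
      refine lt_of_le_of_ne (h.nonneg l t (hby₀.trans ht).le) fun h0 => ?_
      exact absurd (le_csSup hbdd ⟨(hby₀.trans ht).le, h0.symm⟩) (not_le.2 ht)
    · exact hne l hl t (hby₀.trans ht).le
  -- as long as `F i` vanishes, values above `y₀` of the others prefer bids above `y₀`
  have hle : ∀ l ≠ i, ∀ t, b ≤ t → t < y₀ → F l t ≤ A.valueCDF l y₀ := by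
    intro l hl t hbt ht
    rcases valueCDF_eq_one_or (A := A) l y₀ with h2 | ⟨k, hk, h2⟩
    · rw [h2]; exact h.le_one l t hbt
    · rw [h2]
      by_contra! hlt
      obtain ⟨u, hu1, hu2⟩ := exists_between hk
      have h3 := h.right_antitone l k t u hbt (ht.trans hu1).le hlt
      rw [others_eq_zero (Ne.symm hl) (hzero t hbt ht), mul_zero] at h3
      have h4 : 0 < others F l u := FirstPriceAuction.others_pos fun m _ => hpos m u hu1
      exact absurd h3 (not_le.2 (mul_pos (by linarith) h4))
  -- the smallest value of `i` has yet to bid, so it does not gain from lowering a bid to `b`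
  have hkey : ∀ t, b ≤ t → t < y₀ → (A.low i - b) * others A.valueCDF i b ≤
      (A.low i - t) * others A.valueCDF i y₀ := by
    intro t hbt ht
    have h2 := h.left_monotone i ⟨0, A.d_pos i⟩ b t le_rfl hbt (by
      rw [hzero t hbt ht]
      exact (cumLT_nonneg i _).trans_lt (cumLT_lt_cumLE i _))
    calc (A.low i - b) * others A.valueCDF i b ≤ (A.low i - b) * others F i b :=
          mul_le_mul_of_nonneg_left (others_le_others (fun l _ => valueCDF_nonneg l b)
            fun l _ => h.valueCDF_le l b le_rfl) (by linarith)
      _ ≤ (A.low i - t) * others F i t := h2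
      _ ≤ (A.low i - t) * others A.valueCDF i y₀ :=
          mul_le_mul_of_nonneg_left (others_le_others (fun l _ => h.nonneg l t hbt)
            fun l hl => hle l hl t hbt ht) (by linarith)
  have hlim : (A.low i - b) * others A.valueCDF i b ≤
      (A.low i - y₀) * others A.valueCDF i y₀ := by
    have h2 : Filter.Tendsto (fun t => (A.low i - t) * others A.valueCDF i y₀) (𝓝[<] y₀)
        (𝓝 ((A.low i - y₀) * others A.valueCDF i y₀)) :=
      ((continuous_const.sub continuous_id).mul continuous_const).continuousAt.tendsto.mono_left
        nhdsWithin_le_nhds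
    refine ge_of_tendsto h2 ?_
    filter_upwards [Ioo_mem_nhdsLT hby₀] with t ht using hkey t ht.1.le ht.2
  exact absurd (hj.isMax_strict y₀ hby₀ hy₀low) (not_lt.2 hlim)

/-- Just below a bid `z` there are two buyers some of whose values above `z` bid less than `z`. This
holds since the distribution function of the highest bid is strictly increasing. -/
lemma exists_valueCDF_lt (h : A.IsLimitFlow b B q F) {j : Fin n} (hj : A.IsReserve j b) {z : ℝ}
    (hz : b < z) (hzB : z ≤ B) (e : Fin n) :
    ∃ i ≠ e, ∃ x, b < x ∧ x < z ∧ A.valueCDF i z < F i x := by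
  by_contra! hle
  have hmono : ∀ i x y, b < x → x ≤ y → F i x ≤ F i y := fun i x y hx hxy =>
    h.mono i hx.le (hx.le.trans hxy) hxy
  have hgrow : ∀ x y, b < x → x < y → y < z → ∏ i, F i x < ∏ i, F i y := fun x y hx hxy hy =>
    h.growth x y hx.le hxy (hy.trans_le hzB) (Finset.prod_pos fun i _ => h.pos_of_lt hj i hx)
  -- otherwise a buyer other than `e` still bids more just below `z`
  obtain ⟨l, hle', hl⟩ : ∃ l ≠ e, ∀ x, b < x → x < z → ∃ y, x < y ∧ y < z ∧ F l x < F l y := by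
    by_contra! hcon
    have hcon' : ∀ l, ∃ x, b < x ∧ x < z ∧ (l ≠ e → ∀ y, x < y → y < z → F l y ≤ F l x) := by
      intro l
      by_cases hl : l = e
      · obtain ⟨x, hx1, hx2⟩ := exists_between hz
        exact ⟨x, hx1, hx2, fun h1 => absurd hl h1⟩
      · obtain ⟨x, hx1, hx2, hx3⟩ := hcon l hl
        exact ⟨x, hx1, hx2, fun _ => hx3⟩
    choose x hx1 hx2 hx3 using hcon'
    obtain ⟨m, -, hm⟩ := Finset.exists_max_image Finset.univ x ⟨e, Finset.mem_univ e⟩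
    obtain ⟨t, ht1, ht2⟩ := exists_between (hx2 m)
    obtain ⟨u, hu1, hu2⟩ := exists_between ht2
    have hbt := (hx1 m).trans ht1
    have hconst : ∀ l ≠ e, F l t = F l u := fun l hl => by
      have hlt := (hm l (Finset.mem_univ l)).trans_lt ht1
      exact le_antisymm (hmono l t u hbt hu1.le) ((hx3 l hl u (hlt.trans hu1) hu2).trans
        (hmono l (x l) t (hx1 l) hlt.le))
    have ho : others F e t = others F e u := others_congr hconst
    have hopos : 0 < others F e t := FirstPriceAuction.others_pos fun l _ => h.pos_of_lt hj l hbt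
    have h1 := hgrow t u hbt hu1 hu2
    rw [← others_mul e t, ← others_mul e u, ← ho] at h1
    have h2 := lt_of_mul_lt_mul_right h1 hopos.le
    obtain ⟨k, hk, -⟩ := exists_cumLE_eq_one A e
    obtain ⟨s, hs1, hs2⟩ := exists_between ht1
    have hbs := (hx1 m).trans hs1
    have hos : others F e s = others F e t := others_congr fun l hl => by
      have hls := (hm l (Finset.mem_univ l)).trans_lt hs1
      exact le_antisymm (hmono l s t hbs hs2.le) ((hx3 l hl t (hls.trans hs2) ht2).trans
        (hmono l (x l) s (hx1 l) hls.le))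
    have h3 := h.left_monotone e k s t hbs.le hs2.le (by
      rw [hk]; exact h2.trans_le (h.le_one e u (hbt.trans hu1).le))
    rw [hos] at h3
    linarith [le_of_mul_le_mul_right h3 hopos]
  have hlt : ∀ x, b < x → x < z → F l x < A.valueCDF l z := fun x hx hxz => by
    obtain ⟨y, hxy, hyz, hlt⟩ := hl x hx hxz
    exact hlt.trans_le (hle l hle' y (hx.trans hxy) hyz)
  obtain ⟨x₀, hx₀1, hx₀2⟩ := exists_between hz
  rcases valueCDF_eq_zero_or (A := A) l z with h0 | ⟨k, hk, h0⟩
  · have := hlt x₀ hx₀1 hx₀2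
    rw [h0] at this
    exact absurd this (not_lt.2 (h.nonneg l x₀ hx₀1.le))
  · -- this buyer has the value `z`, but no surplus left near `z`
    have hkz : A.value l k = z := by
      refine le_antisymm hk (le_of_forall_lt fun t ht => ?_)
      have h1 := max_lt hx₀2 ht
      have h2 : b < max x₀ t := hx₀1.trans_le (le_max_left _ _)
      by_contra! h3
      have h4 := cumLE_le_valueCDF (h3.trans (le_max_right x₀ t))
      rw [← h0] at h4
      exact absurd (hlt _ h2 h1) (not_lt.2 (h4.trans (h.valueCDF_le l _ h2.le)))
    have hopos : 0 < others F l x₀ := FirstPriceAuction.others_pos fun m _ => h.pos_of_lt hj m hx₀1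
    have h1 : ∀ t ∈ Set.Ioo x₀ z, (z - x₀) * others F l x₀ ≤ z - t := by
      intro t ht
      have hbt := hx₀1.trans ht.1
      have h2 := h.left_monotone l k x₀ t hx₀1.le ht.1.le (by rw [← h0]; exact hlt t hbt ht.2)
      rw [hkz] at h2
      refine h2.trans (mul_le_of_le_one_right (by linarith [ht.2]) ?_)
      exact Finset.prod_le_one (fun m _ => h.nonneg m t hbt.le) fun m _ => h.le_one m t hbt.le
    have h2 : (z - x₀) * others F l x₀ ≤ 0 := by
      have h3 : Filter.Tendsto (fun t => z - t) (𝓝[<] z) (𝓝 (z - z)) :=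
        (continuous_const.sub continuous_id).continuousAt.tendsto.mono_left nhdsWithin_le_nhds
      rw [sub_self] at h3
      exact ge_of_tendsto h3 (by filter_upwards [Ioo_mem_nhdsLT hx₀2] with t ht using h1 t ht)
    exact absurd h2 (not_le.2 (mul_pos (by linarith) hopos))

/-- The point at which the growth rates blow up is the lower end: at a larger point two buyers would
still have a surplus. -/
lemma eq_lower (h : A.IsLimitFlow b B q F) {j : Fin n} (hj : A.IsReserve j b) : q = b := by
  rcases h.mem.1.eq_or_lt with h1 | h1
  · exact h1.symm
  exfalso
  obtain ⟨e, he⟩ := h.exceptional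
  obtain ⟨i, hi, x, hbx, hxq, hlt⟩ := h.exists_valueCDF_lt hj h1 h.mem.2 e
  exact absurd (he i hi x hbx.le hxq) (not_le.2 hlt)

/-- Where buyer `i` has a surplus, the bid distribution functions of the others grow at a bounded
rate. -/
lemma sub_mul_le (h : A.IsLimitFlow b B q F) {j : Fin n} (hj : A.IsReserve j b) {i l : Fin n}
    (hil : i ≠ l) {k : Fin (A.d i)} {x y : ℝ} (hx : b < x) (hxy : x ≤ y) (hy : y < A.value i k)
    (hk : A.cumLT i k < F i x) : (A.value i k - y) * F l y ≤ (A.value i k - x) * F l x := by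
  have hby := hx.trans_le hxy
  have hsplit : ∀ t, others F i t = F l t * ∏ m ∈ (Finset.univ.erase i).erase l, F m t := fun t =>
    (Finset.mul_prod_erase _ (fun m => F m t)
      (Finset.mem_erase.2 ⟨hil.symm, Finset.mem_univ l⟩)).symm
  have hR : ∏ m ∈ (Finset.univ.erase i).erase l, F m x ≤
      ∏ m ∈ (Finset.univ.erase i).erase l, F m y :=
    Finset.prod_le_prod (fun m _ => h.nonneg m x hx.le) fun m _ => h.mono m hx.le hby.le hxy
  have hRpos : 0 < ∏ m ∈ (Finset.univ.erase i).erase l, F m x :=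
    Finset.prod_pos fun m _ => h.pos_of_lt hj m hx
  have h1 := h.right_antitone i k x y hx.le hxy hk
  rw [hsplit, hsplit, ← mul_assoc, ← mul_assoc] at h1
  have h2 : 0 ≤ (A.value i k - y) * F l y := mul_nonneg (by linarith) (h.nonneg l y hby.le)
  exact le_of_mul_le_mul_right ((mul_le_mul_of_nonneg_left hR h2).trans h1) hRpos

/-- The flow has no jumps above `b`, since another buyer with a surplus bounds the growth. -/
lemma continuousAt (h : A.IsLimitFlow b B q F) {j : Fin n} (hj : A.IsReserve j b) (l : Fin n)
    {z : ℝ} (hz : b < z) : ContinuousAt (F l) z := by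
  rcases lt_or_ge B z with hB | hB
  · refine (continuousAt_const (y := (1 : ℝ))).congr ?_
    filter_upwards [Ioi_mem_nhds hB] with t ht using (h.eq_one l t ht).symm
  · obtain ⟨i, hil, x, hbx, hxz, hlt⟩ := h.exists_valueCDF_lt hj hz hB l
    rcases valueCDF_eq_one_or (A := A) i z with h1 | ⟨k, hk, h1⟩
    · rw [h1] at hlt
      exact absurd hlt (not_lt.2 (h.le_one i x hbx.le))
    · rw [h1] at hlt
      refine continuousAt_of_monotoneOn_of_antitoneOn hxz hk ?_ ?_
      · exact (h.mono l).mono fun t ht => (hbx.trans ht.1).le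
      · intro t ht u hu htu
        exact h.sub_mul_le hj hil (hbx.trans ht.1) htu hu.2
          (hlt.trans_le (h.mono i hbx.le (hbx.trans ht.1).le ht.1.le))

/-- The right limits at the lower end. -/
lemma exists_rightLim (h : A.IsLimitFlow b B q F) : ∃ R : Fin n → ℝ,
    (∀ i, Filter.Tendsto (F i) (𝓝[>] b) (𝓝 (R i))) ∧ ∀ i x, b < x → R i ≤ F i x := by
  have hm : ∀ i, Monotone fun t => F i (max b t) := fun i s t hst =>
    h.mono i (le_max_left b s) (le_max_left b t) (max_le_max_left b hst)
  refine ⟨fun i => Function.rightLim (fun t => F i (max b t)) b, fun i => ?_, fun i x hx => ?_⟩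
  · refine ((hm i).tendsto_rightLim b).congr' ?_
    filter_upwards [self_mem_nhdsWithin] with t ht
    rw [max_eq_right (le_of_lt ht)]
  · have := (hm i).rightLim_le hx
    simp only [max_eq_right hx.le] at this
    exact this

lemma rightLim_pos (h : A.IsLimitFlow b B q F) {j : Fin n} (hj : A.IsReserve j b)
    {R : Fin n → ℝ} (hR : ∀ i, Filter.Tendsto (F i) (𝓝[>] b) (𝓝 (R i))) (i : Fin n) :
    0 < R i := by
  rcases (h.mem.1.trans h.mem.2).eq_or_lt with hB | hB
  · have h1 : Filter.Tendsto (F i) (𝓝[>] b) (𝓝 1) := by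
      refine tendsto_const_nhds.congr' ?_
      filter_upwards [self_mem_nhdsWithin] with t ht
      exact (h.eq_one i t (by rw [← hB]; exact ht)).symm
    rw [tendsto_nhds_unique (hR i) h1]
    exact one_pos
  · -- some other buyer has a surplus all the way down to `b`
    obtain ⟨l, hl, hlt⟩ : ∃ l ≠ i, ∀ x, b < x → A.valueCDF l b < F l x := by
      by_contra! hcon
      have hcon' : ∀ l, ∃ x, b < x ∧ (l ≠ i → F l x ≤ A.valueCDF l b) := by
        intro l
        by_cases hl : l = i
        · exact ⟨B, hB, fun h1 => absurd hl h1⟩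
        · obtain ⟨x, hx1, hx2⟩ := hcon l hl
          exact ⟨x, hx1, fun _ => hx2⟩
      choose x hx1 hx2 using hcon'
      obtain ⟨m, -, hm⟩ := Finset.exists_min_image Finset.univ x ⟨i, Finset.mem_univ i⟩
      obtain ⟨l, hl, y, hby, hy, hlt⟩ := h.exists_valueCDF_lt hj
        (lt_min (hx1 m) hB) (min_le_right _ _) i
      have h1 : y ≤ x l := hy.le.trans ((min_le_left _ _).trans (hm l (Finset.mem_univ l)))
      have h2 := h.mono l hby.le (hx1 l).le h1
      have h3 := valueCDF_mono (A := A) l (lt_min (hx1 m) hB).le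
      linarith [hx2 l hl]
    rcases valueCDF_eq_one_or (A := A) l b with h1 | ⟨k, hk, h1⟩
    · exact absurd (hlt B hB) (not_lt.2 (h1 ▸ h.le_one l B hB.le))
    · obtain ⟨y, hby, hyv⟩ := exists_between hk
      have hlim : Filter.Tendsto (fun x => (A.value l k - x) * F i x) (𝓝[>] b)
          (𝓝 ((A.value l k - b) * R i)) :=
        ((continuous_const.sub continuous_id).continuousAt.tendsto.mono_left
          nhdsWithin_le_nhds).mul (hR i)
      have h2 : (A.value l k - y) * F i y ≤ (A.value l k - b) * R i := by
        refine ge_of_tendsto hlim ?_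
        filter_upwards [Ioo_mem_nhdsGT hby] with x hx
        exact h.sub_mul_le hj hl hx.1 hx.2.le hyv (h1 ▸ hlt x hx.1)
      have h3 := mul_pos (sub_pos.2 hyv) (h.pos_of_lt hj i hby)
      exact pos_of_mul_pos_right (h3.trans_le h2) (by linarith)

/-- At most one buyer bids just above `b` with a value above `b`: of two such buyers, `le_or_le` at
points close to `q = b` excludes one. -/
lemma exists_rightLim_le_valueCDF [NeZero n] (h : A.IsLimitFlow b B q F) {j : Fin n}
    (hj : A.IsReserve j b) {R : Fin n → ℝ} (hR : ∀ i, Filter.Tendsto (F i) (𝓝[>] b) (𝓝 (R i)))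
    (hR' : ∀ i x, b < x → R i ≤ F i x) : ∃ e, ∀ i ≠ e, R i ≤ A.valueCDF i b := by
  by_cases hex : ∃ e, A.valueCDF e b < R e
  swap
  · push Not at hex
    exact ⟨j, fun i _ => hex i⟩
  obtain ⟨e, he⟩ := hex
  refine ⟨e, fun i hi => ?_⟩
  by_contra! hlt
  have hR1 : ∀ i, R i ≤ 1 := fun i => le_of_tendsto (hR i) (by
    filter_upwards [self_mem_nhdsWithin] with t ht using h.le_one i t (le_of_lt ht))
  have hval : ∀ i, A.valueCDF i b < R i → ∃ k, b < A.value i k ∧ A.cumLT i k < R i := by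
    intro i hi
    rcases valueCDF_eq_one_or (A := A) i b with h1 | ⟨k, hk, h1⟩
    · exact absurd (hi.trans_le (hR1 i)) (by rw [h1]; exact lt_irrefl _)
    · exact ⟨k, hk, h1 ▸ hi⟩
  obtain ⟨k, hk, hk'⟩ := hval e he
  obtain ⟨m, hm, hm'⟩ := hval i hlt
  set C := ((A.value e k - b) / 2)⁻¹ + ((A.value i m - b) / 2)⁻¹ with hC
  have hsmall : ∀ c d : ℝ, c < d →
      ∀ᶠ x in 𝓝[>] b, c * Real.exp (C * (x - b)) < d := by
    intro c d hcd
    have h1 : ContinuousAt (fun x => c * Real.exp (C * (x - b))) b := by fun_prop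
    have h2 := h1.tendsto
    simp only [sub_self, mul_zero, Real.exp_zero, mul_one] at h2
    exact (h2.mono_left nhdsWithin_le_nhds).eventually (gt_mem_nhds hcd)
  have hq := h.eq_lower hj
  have hI : ∀ c : ℝ, b < c → ∀ᶠ x in 𝓝[>] b, x ∈ Set.Ioo b (b + (c - b) / 2) := fun c hc =>
    Ioo_mem_nhdsGT (by linarith)
  obtain ⟨x, hx1, hx2, hx3, hx4⟩ := ((hsmall _ _ hk').and ((hsmall _ _ hm').and
    ((hI _ hk).and (hI _ hm)))).exists
  rcases h.le_or_le x e i k m C (by rw [hq]; exact hx3.1) hi.symm (by linarith [hx3.2])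
    (by linarith [hx4.2]) (add_le_add (inv_anti₀ (by linarith) (by linarith [hx3.2]))
      (inv_anti₀ (by linarith) (by linarith [hx4.2]))) with h1 | h1
  · linarith [hR' e x hx3.1]
  · linarith [hR' i x hx3.1]

/-- Replacing the values at the lower end by the right limits yields a flow. -/
lemma exists_isFlow [NeZero n] (h : A.IsLimitFlow b B q F) {j : Fin n} (hj : A.IsReserve j b) :
    ∃ G, A.IsFlow b G := by
  obtain ⟨R, hR, hR'⟩ := h.exists_rightLim
  set G : Fin n → ℝ → ℝ := fun i => Function.update (F i) b (R i) with hG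
  have hGb : ∀ i, G i b = R i := fun i => Function.update_self _ _ _
  have hGx : ∀ i x, b < x → G i x = F i x := fun i x hx => Function.update_of_ne hx.ne' _ _
  have hGt : ∀ i, Filter.Tendsto (G i) (𝓝[>] b) (𝓝 (G i b)) := by
    intro i
    rw [hGb]
    refine (hR i).congr' ?_
    filter_upwards [self_mem_nhdsWithin] with x hx using (hGx i x hx).symm
  have hoG : ∀ i x, b < x → others G i x = others F i x := fun i x hx =>
    others_congr fun m _ => hGx m x hx
  have hφ : ∀ i v, Filter.Tendsto (fun x => (v - x) * others G i x) (𝓝[>] b)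
      (𝓝 ((v - b) * others G i b)) := fun i v =>
    ((continuous_const.sub continuous_id).continuousAt.tendsto.mono_left nhdsWithin_le_nhds).mul
      (tendsto_finsetProd _ fun m _ => hGt m)
  have hle : ∀ i x, b ≤ x → G i x ≤ 1 := by
    intro i x hx
    rcases hx.eq_or_lt with rfl | hx
    · rw [hGb]
      exact le_of_tendsto (hR i) (by
        filter_upwards [self_mem_nhdsWithin] with t ht using h.le_one i t (le_of_lt ht))
    · rw [hGx i x hx]; exact h.le_one i x hx.le
  have hΦ : ∀ i x, b ≤ x → A.valueCDF i x ≤ G i x := by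
    intro i x hx
    rcases hx.eq_or_lt with rfl | hx
    · rw [hGb]
      refine ge_of_tendsto (hR i) ?_
      filter_upwards [self_mem_nhdsWithin] with t ht
      exact (valueCDF_mono i (le_of_lt ht)).trans (h.valueCDF_le i t (le_of_lt ht))
    · rw [hGx i x hx]; exact h.valueCDF_le i x hx.le
  obtain ⟨e, he⟩ := h.exists_rightLim_le_valueCDF hj hR hR'
  refine ⟨G, fun i x hx => ?_, hle, fun i x hx y hy hxy => ?_, fun i x hx => ?_, hΦ,
    fun i k x y hx hxy hk => ?_, fun i k x y hx hxy hk => ?_, e, fun i hi => ?_⟩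
  · rcases hx.eq_or_lt with rfl | hx
    · rw [hGb]; exact h.rightLim_pos hj hR i
    · rw [hGx i x hx]; exact h.pos_of_lt hj i hx
  · rcases hxy.eq_or_lt with rfl | hlt
    · exact le_rfl
    have hby : b < y := lt_of_le_of_lt hx hlt
    rw [hGx i y hby]
    rcases (show b ≤ x from hx).eq_or_lt with rfl | hx
    · rw [hGb]; exact hR' i y hby
    · rw [hGx i x hx]; exact h.mono i hx.le hby.le hxy
  · rcases (show b ≤ x from hx).eq_or_lt with rfl | hx
    · exact continuousWithinAt_Ioi_iff_Ici.1 (hGt i)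
    · refine ContinuousAt.continuousWithinAt ((h.continuousAt hj i hx).congr ?_)
      filter_upwards [Ioi_mem_nhds hx] with t ht using (hGx i t ht).symm
  · rcases hxy.eq_or_lt with rfl | hlt
    · exact le_rfl
    rcases hx.eq_or_lt with rfl | hx
    · refine ge_of_tendsto (hφ i _) ?_
      filter_upwards [Ioo_mem_nhdsGT hlt] with t ht
      rw [hoG i t ht.1, hoG i y hlt]
      rw [hGb] at hk
      exact h.right_antitone i k t y ht.1.le ht.2.le (hk.trans_le (hR' i t ht.1))
    · rw [hoG i x hx, hoG i y (hx.trans hlt)]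
      rw [hGx i x hx] at hk
      exact h.right_antitone i k x y hx.le hxy hk
  · rcases hxy.eq_or_lt with rfl | hlt
    · exact le_rfl
    have hby : b < y := lt_of_le_of_lt hx hlt
    rw [hGx i y hby] at hk
    rcases hx.eq_or_lt with rfl | hx
    · refine le_of_tendsto (hφ i _) ?_
      filter_upwards [Ioo_mem_nhdsGT hlt] with t ht
      rw [hoG i t ht.1, hoG i y hlt]
      exact h.left_monotone i k t y ht.1.le ht.2.le hk
    · rw [hoG i x hx, hoG i y hby]
      exact h.left_monotone i k x y hx.le hxy hk
  · exact le_antisymm (by rw [hGb]; exact he i hi) (hΦ i b le_rfl)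

end IsLimitFlow

/-- If at most one buyer has values above `b`, nobody bids above `b`. -/
lemma isFlow_one {b : ℝ} {e : Fin n} (h : ∀ i ≠ e, ∀ k, A.value i k ≤ b) :
    A.IsFlow b fun _ _ => 1 := by
  have ho : ∀ i x, others (fun (_ : Fin n) (_ : ℝ) => (1 : ℝ)) i x = 1 := fun i x =>
    Finset.prod_const_one
  refine ⟨fun _ _ _ => one_pos, fun _ _ _ => le_rfl, fun _ => monotoneOn_const,
    fun _ => continuousOn_const, fun i x _ => valueCDF_le_one i x, fun i k x y _ hxy _ => ?_,
    fun i k x y _ _ hk => ?_, e, fun i hi => (valueCDF_eq_one (h i hi)).symm⟩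
  · rw [ho, ho]; linarith
  · exact absurd hk (not_lt.2 (cumLE_le_one i k))

theorem IsReserve.exists_isFlow [NeZero n] {j : Fin n} {b : ℝ} (hj : A.IsReserve j b) :
    ∃ F, A.IsFlow b F := by
  by_cases hex : ∃ (i l : Fin n), i ≠ l ∧ (∃ k, b < A.value i k) ∧ ∃ k, b < A.value l k
  · obtain ⟨i, l, hil, ⟨k, hk⟩, m, hm⟩ := hex
    obtain ⟨B, q, F, hF⟩ := exists_isLimitFlow (A := A) hj.nonneg hil hk hm
    exact hF.exists_isFlow hj
  · push Not at hex
    by_cases he : ∃ e k, b < A.value e k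
    · obtain ⟨e, k, hk⟩ := he
      exact ⟨_, isFlow_one fun i hi => hex e i (Ne.symm hi) ⟨k, hk⟩⟩
    · push Not at he
      exact ⟨_, isFlow_one (e := j) fun i _ => he i⟩

/-! ### From the flow to an equilibrium -/

/-- The share of the bidders with value `A.value i k` that lies below the quantile `s` of
buyer `i`, if the bids increase with the values. -/
def quantileShare (A : FirstPriceAuction n) (i : Fin n) (k : Fin (A.d i)) (s : ℝ) : ℝ :=
  max 0 (min 1 ((s - A.cumLT i k) / A.prob i k))

lemma quantileShare_mono (i : Fin n) (k : Fin (A.d i)) : Monotone (A.quantileShare i k) := by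
  intro s t hst
  have := A.prob_pos i k
  unfold quantileShare
  gcongr

lemma quantileShare_eq_zero {i : Fin n} {k : Fin (A.d i)} {s : ℝ} (h : s ≤ A.cumLT i k) :
    A.quantileShare i k s = 0 :=
  max_eq_left ((min_le_right _ _).trans
    (div_nonpos_of_nonpos_of_nonneg (by linarith) (A.prob_pos i k).le))

lemma quantileShare_eq_one {i : Fin n} {k : Fin (A.d i)} {s : ℝ} (h : A.cumLE i k ≤ s) :
    A.quantileShare i k s = 1 := by
  have h1 : 1 ≤ (s - A.cumLT i k) / A.prob i k := by
    rw [one_le_div (A.prob_pos i k)]; linarith [cumLE_eq (A := A) i k]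
  rw [quantileShare, min_eq_left h1, max_eq_right zero_le_one]

lemma quantileShare_lt_one {i : Fin n} {k : Fin (A.d i)} {s : ℝ} (h : A.quantileShare i k s < 1) :
    s < A.cumLE i k := by
  by_contra! h1
  rw [quantileShare_eq_one h1] at h
  exact lt_irrefl _ h

lemma sum_quantileShare (i : Fin n) {s : ℝ} (h0 : 0 < s) (h1 : s ≤ 1) :
    ∑ k, A.prob i k * A.quantileShare i k s = s := by
  obtain ⟨m, hm1, hm2⟩ := exists_cumLT_lt_le (A := A) i h0 h1
  have h2 : ∀ k, A.prob i k * A.quantileShare i k s =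
      (if k < m then A.prob i k else 0) + if k = m then s - A.cumLT i m else 0 := by
    intro k
    rcases lt_trichotomy k m with h | h | h
    · rw [if_pos h, if_neg h.ne, quantileShare_eq_one ((cumLE_le_cumLT h).trans hm1.le)]
      ring
    · subst h
      have hp := A.prob_pos i k
      have h3 : (s - A.cumLT i k) / A.prob i k ≤ 1 := by
        rw [div_le_one hp]; linarith [cumLE_eq (A := A) i k]
      rw [if_neg (lt_irrefl _), if_pos rfl, quantileShare, min_eq_right h3,
        max_eq_right (div_nonneg (by linarith) hp.le), mul_div_cancel₀ _ hp.ne', zero_add]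
    · rw [if_neg h.le.not_gt, if_neg h.ne', quantileShare_eq_zero (hm2.trans (cumLE_le_cumLT h))]
      ring
  rw [Finset.sum_congr rfl fun k _ => h2 k, Finset.sum_add_distrib,
    Finset.sum_ite_eq' Finset.univ m fun _ => s - A.cumLT i m, if_pos (Finset.mem_univ m)]
  change A.cumLT i m + _ = s
  ring

lemma ae_measure_Ici_ne_zero (μ : Measure ℝ) : ∀ᵐ x ∂μ, μ (Set.Ici x) ≠ 0 := by
  rw [ae_iff]
  refine measure_null_of_locally_null _ fun x hx => ?_
  simp only [not_not, Set.mem_ofPred_eq] at hx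
  by_cases hmin : ∃ y, y < x ∧ μ (Set.Ici y) = 0
  · obtain ⟨y, hxy, hy⟩ := hmin
    exact ⟨Set.Ici y, mem_nhdsWithin_of_mem_nhds (Ici_mem_nhds hxy), hy⟩
  · push Not at hmin
    refine ⟨_, self_mem_nhdsWithin, measure_mono_null (fun y hy => ?_) hx⟩
    simp only [not_not, Set.mem_ofPred_eq] at hy
    by_contra hxy
    exact hmin y (not_le.1 hxy) hy

/-- The law whose distribution function is the share of the bidders with value `A.value i k` below
the quantile `F i x`, with an atom at `b` if this share is already positive there. -/
lemma IsFlow.exists_law {b : ℝ} {F : Fin n → ℝ → ℝ} (hF : A.IsFlow b F) (i : Fin n)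
    (k : Fin (A.d i)) : ∃ μ : Measure ℝ, IsProbabilityMeasure μ ∧
      (∀ x < b, μ (Set.Iic x) = 0) ∧
      ∀ x, b ≤ x → μ.real (Set.Iic x) = A.quantileShare i k (F i x) := by
  have hle : ∀ x, A.quantileShare i k x ≤ 1 := fun x => max_le zero_le_one (min_le_left _ _)
  have hge : ∀ x, 0 ≤ A.quantileShare i k x := fun x => le_max_left _ _
  let f : StieltjesFunction ℝ :=
    { toFun := fun x => if x < b then 0 else A.quantileShare i k (F i x)
      mono' := by
        intro x y hxy
        dsimp only
        split_ifs with h1 h2 h2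
        · exact le_rfl
        · exact hge _
        · exact absurd (hxy.trans_lt h2) h1
        · exact quantileShare_mono i k (hF.mono i (not_lt.1 h1) (not_lt.1 h2) hxy)
      right_continuous' := by
        intro x
        rcases lt_or_ge x b with h | h
        · refine ContinuousAt.continuousWithinAt ((continuousAt_const (y := (0 : ℝ))).congr ?_)
          filter_upwards [Iio_mem_nhds h] with t ht using (if_pos ht).symm
        · have h1 : ContinuousWithinAt (fun t => A.quantileShare i k (F i t)) (Set.Ici x) x := by
            have h2 := (hF.cont i x h).mono (Set.Ici_subset_Ici.2 h)
            have h3 : Continuous (A.quantileShare i k) := by unfold quantileShare; fun_prop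
            exact h3.continuousAt.comp_continuousWithinAt h2
          exact h1.congr (fun t ht => if_neg (not_lt.2 (h.trans ht))) (if_neg (not_lt.2 h)) }
  have hbot : Filter.Tendsto f Filter.atBot (𝓝 0) := by
    refine tendsto_const_nhds.congr' ?_
    filter_upwards [Filter.eventually_lt_atBot b] with t ht using (if_pos ht).symm
  have htop : Filter.Tendsto f Filter.atTop (𝓝 1) := by
    refine tendsto_const_nhds.congr' ?_
    filter_upwards [Filter.eventually_ge_atTop b, Filter.eventually_ge_atTop A.top] with t h1 h2
    refine Eq.symm ((if_neg (not_lt.2 h1)).trans (quantileShare_eq_one ?_))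
    rw [hF.eq_one_of_top_le h1 h2]
    exact cumLE_le_one i k
  refine ⟨f.measure, f.isProbabilityMeasure hbot htop, fun x hx => ?_, fun x hx => ?_⟩
  · rw [f.measure_Iic hbot, sub_zero]
    have : f x = 0 := if_pos hx
    rw [this, ENNReal.ofReal_zero]
  · rw [measureReal_def, f.measure_Iic hbot, sub_zero]
    have : f x = A.quantileShare i k (F i x) := if_neg (not_lt.2 hx)
    rw [this, ENNReal.toReal_ofReal (hge _)]

/-- A profile with bid distribution functions `F` above `b`, in which the bids increase with the
values and values up to `b` are bid truthfully. -/
structure Profile.Follows (σ : A.Profile) (b : ℝ) (F : Fin n → ℝ → ℝ) : Prop where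
  dirac : ∀ i k, A.value i k ≤ b → σ.law i k = Measure.dirac (A.value i k)
  below : ∀ i k, b < A.value i k → ∀ x < b, σ.law i k (Set.Iic x) = 0
  above : ∀ i k, b < A.value i k → ∀ x, b ≤ x →
    (σ.law i k).real (Set.Iic x) = A.quantileShare i k (F i x)

lemma IsFlow.exists_follows {b : ℝ} {F : Fin n → ℝ → ℝ} (hF : A.IsFlow b F) (hb : 0 ≤ b) :
    ∃ σ : A.Profile, σ.Follows b F := by
  classical
  choose μ hμ hμ1 hμ2 using hF.exists_law
  refine ⟨⟨fun i k => if A.value i k ≤ b then Measure.dirac (A.value i k) else μ i k,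
    fun i k => ?_, fun i k => ?_⟩, fun i k hk => if_pos hk, fun i k hk => ?_, fun i k hk => ?_⟩
  · split_ifs
    · infer_instance
    · exact hμ i k
  · split_ifs with h
    · rw [ae_dirac_eq]
      exact ⟨A.value_nonneg i k, le_rfl⟩
    · have := hμ i k
      have hv := not_le.1 h
      have h1 : μ i k (Set.Iic (A.value i k)) = 1 := by
        have h2 := hμ2 i k _ hv.le
        rw [quantileShare_eq_one ((cumLE_le_valueCDF le_rfl).trans
          (hF.valueCDF_le i _ hv.le))] at h2
        rwa [measureReal_def, ENNReal.toReal_eq_one_iff] at h2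
      have h3 : ∀ᵐ y ∂(μ i k), y ∈ Set.Iic (A.value i k) :=
        (prob_compl_eq_zero_iff measurableSet_Iic).2 h1
      filter_upwards [h3, ae_measure_Iic_ne_zero (μ i k)] with y hy1 hy2
      refine ⟨hb.trans ?_, hy1⟩
      by_contra! hlt
      exact hy2 (hμ1 i k y hlt)
  · simp only [if_neg (not_le.2 hk)]
    exact hμ1 i k
  · simp only [if_neg (not_le.2 hk)]
    exact hμ2 i k

namespace Profile.Follows

variable {σ : A.Profile} {b : ℝ} {F : Fin n → ℝ → ℝ}

lemma law_Iic_of_le (h : σ.Follows b F) {i : Fin n} {k : Fin (A.d i)} (hk : A.value i k ≤ b)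
    (x : ℝ) : (σ.law i k).real (Set.Iic x) = if A.value i k ≤ x then 1 else 0 := by
  classical
  rw [h.dirac i k hk, measureReal_def, Measure.dirac_apply' _ measurableSet_Iic]
  by_cases hx : A.value i k ≤ x
  · rw [if_pos hx, Set.indicator_of_mem (Set.mem_Iic.2 hx)]; rfl
  · rw [if_neg hx, Set.indicator_of_notMem (fun h => hx (Set.mem_Iic.1 h))]; rfl

lemma bidCDF_eq (h : σ.Follows b F) (hF : A.IsFlow b F) (i : Fin n) {x : ℝ} (hx : b ≤ x) :
    σ.bidCDF i x = F i x := by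
  rw [← sum_quantileShare (A := A) i (hF.pos i x hx) (hF.le_one i x hx)]
  refine Finset.sum_congr rfl fun k _ => ?_
  rcases le_or_gt (A.value i k) b with hk | hk
  · rw [h.law_Iic_of_le hk, if_pos (hk.trans hx), quantileShare_eq_one
      ((cumLE_le_valueCDF (hk.trans hx)).trans (hF.valueCDF_le i x hx))]
  · rw [h.above i k hk x hx]

lemma bidCDF_eq_valueCDF (h : σ.Follows b F) (i : Fin n) {x : ℝ} (hx : x < b) :
    σ.bidCDF i x = A.valueCDF i x := by
  refine Finset.sum_congr rfl fun k _ => ?_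
  rcases le_or_gt (A.value i k) b with hk | hk
  · rw [h.law_Iic_of_le hk]
    split_ifs <;> ring
  · rw [if_neg (not_le.2 (hx.trans hk)), measureReal_def, h.below i k hk x hx]
    simp

lemma others_bidCDF_eq (h : σ.Follows b F) (hF : A.IsFlow b F) (i : Fin n) {x : ℝ} (hx : b ≤ x) :
    others σ.bidCDF i x = others F i x := others_congr fun l _ => h.bidCDF_eq hF l hx

lemma others_bidCDF_eq_valueCDF (h : σ.Follows b F) (i : Fin n) {x : ℝ} (hx : x < b) :
    others σ.bidCDF i x = others A.valueCDF i x :=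
  others_congr fun l _ => h.bidCDF_eq_valueCDF l hx

lemma others_valueCDF_eq_zero {i j : Fin n} (hj : A.IsReserve j b) (hij : i ≠ j) {x : ℝ}
    (hx : x < b) : others A.valueCDF i x = 0 :=
  others_eq_zero hij.symm (valueCDF_eq_zero (hx.trans_le hj.le_low))

/-- A buyer whose value is at most `b` cannot win anything. -/
lemma interimPayoff_nonpos (h : σ.Follows b F) {j : Fin n} (hj : A.IsReserve j b) {i : Fin n}
    {k : Fin (A.d i)} (hk : A.value i k ≤ b) {y : ℝ} (hy0 : 0 ≤ y) (hy : y ≤ A.value i k) :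
    σ.interimPayoff i k y ≤ 0 := by
  refine (interimPayoff_le hy).trans ?_
  rcases hy.eq_or_lt with hy | hy
  · rw [hy, sub_self, zero_mul]
  have hyb := hy.trans_le hk
  rw [h.others_bidCDF_eq_valueCDF i hyb]
  by_cases hij : i = j
  · subst hij
    have hv : A.value i k = A.low i := le_antisymm (hk.trans hj.le_low) (low_le i k)
    have hvb : A.low i = b := le_antisymm (hv ▸ hk) hj.le_low
    have h1 := hj.isMax y hy0 (hvb ▸ hyb.le)
    rw [hvb, sub_self, zero_mul] at h1
    rwa [hv, hvb]
  · rw [others_valueCDF_eq_zero hj hij hyb, mul_zero]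

/-- The surplus function of a value above `b` bounds all payoffs. -/
lemma interimPayoff_le_of_isMax (h : σ.Follows b F) (hF : A.IsFlow b F) {j : Fin n}
    (hj : A.IsReserve j b) {i : Fin n} {k : Fin (A.d i)} (hk : b < A.value i k) {U : ℝ}
    (hU : ∀ z, b ≤ z → (A.value i k - z) * others F i z ≤ U) {y : ℝ} (hy0 : 0 ≤ y)
    (hy : y ≤ A.value i k) : σ.interimPayoff i k y ≤ U := by
  refine (interimPayoff_le hy).trans ?_
  rcases le_or_gt b y with hyb | hyb
  · rw [h.others_bidCDF_eq hF i hyb]; exact hU y hyb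
  rw [h.others_bidCDF_eq_valueCDF i hyb]
  by_cases hij : i = j
  · subst hij
    refine le_trans ?_ (hU b le_rfl)
    have h1 := hj.isMax y hy0 (hyb.le.trans hj.le_low)
    have h2 : others A.valueCDF i y ≤ others A.valueCDF i b :=
      others_le_others (fun l _ => valueCDF_nonneg l y) fun l _ => valueCDF_mono l hyb.le
    have h3 : others A.valueCDF i b ≤ others F i b :=
      others_le_others (fun l _ => valueCDF_nonneg l b) fun l _ => hF.valueCDF_le l b le_rfl
    have h4 := mul_le_mul_of_nonneg_left h2 (sub_nonneg.2 (low_le i k))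
    have h5 := mul_le_mul_of_nonneg_left h3 (sub_nonneg.2 hk.le)
    linarith
  · rw [others_valueCDF_eq_zero hj hij hyb, mul_zero]
    have := hU _ hk.le
    rwa [sub_self, zero_mul] at this

/-- At `b` only the exceptional buyer bids with a value above `b`, and wins all ties against buyers
whose value is `b`, at the price `b`. -/
lemma le_interimPayoff_bottom (h : σ.Follows b F) (hF : A.IsFlow b F) {i : Fin n}
    {k : Fin (A.d i)} (hk : b < A.value i k) (hi : ∀ l ≠ i, F l b = A.valueCDF l b) :
    (A.value i k - b) * others F i b ≤ σ.interimPayoff i k b := by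
  have hS : MeasurableSet {p : ℝ × ℝ | p.2 < b ∨ (p.2 = b ∧ p.1 = b)} :=
    (measurableSet_lt measurable_snd measurable_const).union
      ((measurableSet_eq_fun measurable_snd measurable_const).inter
        (measurableSet_eq_fun measurable_fst measurable_const))
  refine le_trans ?_ (interimPayoff_ge_of_sets hk
    (S := fun _ => {p | p.2 < b ∨ (p.2 = b ∧ p.1 = b)}) (fun _ => hS) fun _ p hp => hp)
  refine mul_le_mul_of_nonneg_left (Finset.prod_le_prod (fun l _ => (hF.pos l b le_rfl).le)
    fun l hl => ?_) (by linarith)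
  rw [hi l (Finset.ne_of_mem_erase hl), σ.buyerLaw_real l hS]
  refine Finset.sum_le_sum fun m _ => ?_
  split_ifs with hm
  · refine le_of_eq ?_
    have h1 : (σ.law l m).real {x | (A.value l m, x) ∈
        {p : ℝ × ℝ | p.2 < b ∨ (p.2 = b ∧ p.1 = b)}} = 1 := by
      have hmem : A.value l m ∈ {x | (A.value l m, x) ∈
          {p : ℝ × ℝ | p.2 < b ∨ (p.2 = b ∧ p.1 = b)}} := by
        rcases hm.eq_or_lt with h2 | h2
        · exact Or.inr ⟨h2, h2⟩
        · exact Or.inl h2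
      rw [h.dirac l m hm, measureReal_def, Measure.dirac_apply_of_mem hmem]
      rfl
    rw [h1, mul_one]
  · exact mul_nonneg (A.prob_pos l m).le measureReal_nonneg

/-- Almost every bid of a value above `b` maximizes the surplus among the bids from `b` on. -/
lemma ae_isMax (h : σ.Follows b F) (hF : A.IsFlow b F) {i : Fin n} {k : Fin (A.d i)}
    (hk : b < A.value i k) : ∀ᵐ y ∂(σ.law i k), b ≤ y ∧ A.cumLT i k < F i y ∧
      ∀ z, b ≤ z → (A.value i k - z) * others F i z ≤ (A.value i k - y) * others F i y := by
  filter_upwards [ae_measure_Iic_ne_zero (σ.law i k), ae_measure_Ici_ne_zero (σ.law i k)]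
    with y h1 h2
  have hby : b ≤ y := by
    by_contra! hlt
    exact h1 (h.below i k hk y hlt)
  have hcum : A.cumLT i k < F i y := by
    by_contra! hle
    have h3 := h.above i k hk y hby
    rw [quantileShare_eq_zero hle, measureReal_eq_zero_iff] at h3
    exact h1 h3
  refine ⟨hby, hcum, fun z hz => ?_⟩
  rcases le_or_gt y z with hyz | hyz
  · exact hF.right_antitone i k y z hby hyz hcum
  -- buyers with this value still bid at least `y`
  have hlt : ∀ t, b ≤ t → t < y → F i t < A.cumLE i k := by
    intro t ht hty
    refine quantileShare_lt_one ?_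
    rw [← h.above i k hk t ht]
    have h3 : (σ.law i k).real (Set.Iic t) + (σ.law i k).real (Set.Ici y) ≤ 1 := by
      rw [← measureReal_union (Set.disjoint_left.2 fun u hu1 hu2 =>
        absurd ((Set.mem_Ici.1 hu2).trans (Set.mem_Iic.1 hu1)) (not_le.2 hty)) measurableSet_Ici]
      exact measureReal_le_one
    have h4 : 0 < (σ.law i k).real (Set.Ici y) := by
      refine lt_of_le_of_ne measureReal_nonneg fun h5 => h2 ?_
      exact (measureReal_eq_zero_iff).1 h5.symm
    linarith
  have hc : ContinuousAt (fun t => (A.value i k - t) * others F i t) y :=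
    (continuousAt_const.sub continuousAt_id).mul
      (((Profile.continuousOn_others hF.cont i).continuousAt (Ici_mem_nhds (hz.trans_lt hyz))))
  refine ge_of_tendsto (hc.tendsto.mono_left (nhdsWithin_le_nhds (s := Set.Iio y))) ?_
  filter_upwards [Ioo_mem_nhdsLT hyz] with t ht
  exact hF.left_monotone i k z t hz ht.1.le (hlt t (hz.trans ht.1.le) ht.2)

/-- Above `b` the bids have no atoms, so that the full surplus is earned. -/
lemma le_interimPayoff (h : σ.Follows b F) (hF : A.IsFlow b F) {i : Fin n} {k : Fin (A.d i)}
    (hk : b < A.value i k) {y : ℝ} (hby : b ≤ y) (hy : y ≤ A.value i k)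
    (hcum : A.cumLT i k < F i y) :
    (A.value i k - y) * others F i y ≤ σ.interimPayoff i k y := by
  rcases hby.eq_or_lt with rfl | hby
  · obtain ⟨e, he⟩ := hF.exceptional
    by_cases hi : i = e
    · subst hi; exact h.le_interimPayoff_bottom hF hk he
    · rw [he i hi] at hcum
      exact absurd (valueCDF_le_cumLT hk) (not_le.2 hcum)
  · have hc : ContinuousAt (fun t => (A.value i k - y) * others F i t) y :=
      continuousAt_const.mul
        ((Profile.continuousOn_others hF.cont i).continuousAt (Ici_mem_nhds hby))
    refine le_of_tendsto (hc.tendsto.mono_left (nhdsWithin_le_nhds (s := Set.Iio y))) ?_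
    filter_upwards [Ioo_mem_nhdsLT hby] with t ht
    rw [← h.others_bidCDF_eq hF i ht.1.le]
    exact interimPayoff_ge ht.2 hy

theorem isBNE (h : σ.Follows b F) (hF : A.IsFlow b F) {j : Fin n} (hj : A.IsReserve j b) :
    σ.IsBNE := by
  intro i k y hy0 hy
  rcases le_or_gt (A.value i k) b with hk | hk
  · rw [h.dirac i k hk, integral_dirac]
    exact (h.interimPayoff_nonpos hj hk hy0 hy).trans (interimPayoff_nonneg le_rfl)
  · have hmax := h.ae_isMax hF hk
    obtain ⟨y₀, -, hby₀, hcum₀, hy₀⟩ := exists_mem_of_ae (s := Set.univ)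
      (by rw [probReal_univ]; exact one_pos) hmax
    have hle := fun z hz0 hz => h.interimPayoff_le_of_isMax hF hj hk hy₀ (y := z) hz0 hz
    have hconst : ∀ᵐ z ∂(σ.law i k), σ.interimPayoff i k z =
        (A.value i k - y₀) * others F i y₀ := by
      filter_upwards [hmax, σ.bid_mem i k] with z hz hzm
      exact le_antisymm (hle z hzm.1 hzm.2)
        ((hz.2.2 y₀ hby₀).trans (h.le_interimPayoff hF hk hz.1 hzm.2 hz.2.1))
    rw [integral_congr_ae hconst, integral_const, probReal_univ, one_smul]
    exact hle y hy0 hy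

end Profile.Follows

end FirstPriceAuction

end

theorem mainTheorem1 (n : ℕ) (hn : 1 ≤ n) (A : FirstPriceAuction n) :
    (∃ σ : A.Profile, σ.IsBNE) ∧
    ∃ bmin : ℝ,
      (∀ σ : A.Profile, σ.IsBNE → IsLeast σ.winningBids bmin) ∧
      ∀ σ τ : A.Profile, σ.IsBNE → τ.IsBNE →
        (∀ i, ∀ x, bmin ≤ x → σ.bidCDF i x = τ.bidCDF i x) ∧
        (∀ i k, (σ.law i k).restrict (Set.Ioi bmin) = (τ.law i k).restrict (Set.Ioi bmin)) := by
  have : NeZero n := ⟨by omega⟩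
  obtain ⟨j, -, hj⟩ := Finset.exists_max_image Finset.univ A.low ⟨0, Finset.mem_univ _⟩
  have hj' : ∀ i, A.low i ≤ A.low j := fun i => hj i (Finset.mem_univ i)
  obtain ⟨b, hb⟩ := FirstPriceAuction.exists_isReserve A hj'
  have hbot : ∀ σ : A.Profile, σ.IsBNE → σ.bottom = b := fun σ hσ => (hσ.isReserve_bottom hj').eq hb
  refine ⟨?_, b, fun σ hσ => ?_, fun σ τ hσ hτ => ?_⟩
  · obtain ⟨F, hF⟩ := hb.exists_isFlow
    obtain ⟨σ, hσ⟩ := hF.exists_follows hb.nonneg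
    exact ⟨σ, hσ.isBNE hF hb⟩
  · rw [← hbot σ hσ]
    exact σ.isLeast_winningBids
  · have hF := hσ.isFlow
    have hG := hτ.isFlow
    rw [hbot σ hσ] at hF
    rw [hbot τ hτ] at hG
    have heq : ∀ i, ∀ x, b ≤ x → σ.bidCDF i x = τ.bidCDF i x := fun i x hx => hF.unique hG hx i
    exact ⟨heq, fun i k => hσ.law_restrict_eq hτ (hbot σ hσ) (hbot τ hτ) (heq i) k⟩
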